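/- Let $n\ge 2$, $m=2n-1$, $G=\mathrm{Spin}(2n,1)$ (the connected double covering of $\mathrm{SO}_e(2n,1)$), and $\mathfrak g=\mathfrak{so}(2n,1)=\{X\in M_{2n+1}(\mathbb R): XI_{2n,1}+I_{2n,1}X^t=0\}$ with $I_{2n,1}=\mathrm{diag}(1,\dots,1,-1)$. Let $\mathfrak p=\mathfrak m+\mathfrak a+\mathfrak n$ and $P=MAN\subset G$ be the standard minimal parabolic subalgebra and subgroup: $\mathfrak a=\mathbb R H_0$ with $H_0=E_{2n,2n+1}+E_{2n+1,2n}$, $\mathfrak n$ is the space of matrices $\begin{pmatrix}0_{m\times m}&-\alpha^t&\alpha^t\\ \alpha&0&0\\ \alpha&0&0\end{pmatrix}$ with $\alpha\in\mathbb R^{m}$ a row vector, $M$ is the centralizer of $\mathfrak a$ in the maximal compact subgroup $K=\mathrm{Spin}(2n)$ of $G$, with Lie algebra $\mathfrak m=\{\mathrm{diag}(Y,0,0):Y\in\mathfrak{so}(m)\}$, and $A$, $N$ are the analytic subgroups of $\mathfrak a$, $\mathfrak n$. Put $\mathfrak l=\mathfrak m+\mathfrak a$ and regard $\mathfrak l^*$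 as the subspace of those functionals in $\mathfrak p^*$ that vanish on $\mathfrak n$. An element of $\mathfrak p^*$ has depth zero if its coadjoint $P$-orbit is contained in $\mathfrak l^*$, and depth one otherwise. Let $a_1\ge a_2\ge\cdots\ge a_{n-1}\ge|a_n|>0$ be real numbers, let $t_{\vec a}=\mathrm{diag}\left(\begin{pmatrix}0&a_1\\-a_1&0\end{pmatrix},\dots,\begin{pmatrix}0&a_n\\-a_n&0\end{pmatrix},0\right)\in\mathfrak g$, let $f\in\mathfrak g^*$ be the elliptic element $f(Y)=\frac12\mathrm{tr}(t_{\vec a}Y)$, let $\mathcal O_f=G\cdot f$ be its coadjoint orbit, and let $q\colon\mathcal O_f\to\mathfrak p^*$ be the moment map, i.e. the restriction of functionals from $\mathfrak g$ to $\mathfrak p$. Then: 1. every element of the image of $q$ has depth one; 2. for every $g\in G$ the reduced space $q^{-1}(q(g\cdot f))/\mathrm{Stab}_P(q(g\cdot f))$ is a singleton; 3. $q$ is weakly proper: for every compact set $\Omega\subset\mathfrak p^*\setminus\mathfrak l^*$ the preimage $q^{-1}(\Omega)$ is compact; 4. $q$ is not proper: there is a compact set $\Omega\subset\mathfrak p^*$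 for which $q^{-1}(\Omega)$ is not compact. -/

import Mathlib

namespace SpinM1

open Matrix

set_option linter.unusedSimpArgs false

/-! ### The quadratic space `ℝ^{m+1,1}`, its Lie algebra and its spin group -/

/-- The last (timelike) coordinate of `ℝ^{m+2}`. -/
abbrev iz (m : ℕ) : Fin (m + 2) := Fin.last (m + 1)

/-- The last but one coordinate of `ℝ^{m+2}`. -/
abbrev ip (m : ℕ) : Fin (m + 2) := (Fin.last m).castSucc

/-- The first `m` coordinates of `ℝ^{m+2}`. -/
abbrev ic {m : ℕ} (i : Fin m) : Fin (m + 2) := i.castSucc.castSucc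

/-- Real square matrices of size `m + 2`. -/
abbrev Mat (m : ℕ) : Type := Matrix (Fin (m + 2)) (Fin (m + 2)) ℝ

/-- The diagonal entries `1, …, 1, -1`. -/
def sgn (m : ℕ) (i : Fin (m + 2)) : ℝ := if i = iz m then -1 else 1

/-- The matrix `I_{m+1,1} = diag (1, …, 1, -1)`. -/
def J (m : ℕ) : Mat m := Matrix.diagonal (sgn m)

/-- The quadratic form `x₁² + ⋯ + x_{m+1}² - x₀²`. -/
noncomputable def Q (m : ℕ) : QuadraticForm ℝ (Fin (m + 2) → ℝ) :=
  QuadraticMap.weightedSumSquares ℝ (sgn m)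

/-- `𝔤 = 𝔰𝔬(m+1,1) = {X | X J + J Xᵀ = 0}`. -/
def 𝔤 (m : ℕ) : Submodule ℝ (Mat m) where
  carrier := {X | X * J m + J m * Xᵀ = 0}
  add_mem' {X Y} hX hY := by
    have : (X + Y) * J m + J m * (X + Y)ᵀ
        = (X * J m + J m * Xᵀ) + (Y * J m + J m * Yᵀ) := by
      rw [transpose_add]; noncomm_ring
    simp only [Set.mem_ofPred_eq] at *
    rw [this, hX, hY, add_zero]
  zero_mem' := by simp
  smul_mem' c X hX := by
    simp only [Set.mem_ofPred_eq] at *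
    rw [transpose_smul, smul_mul_assoc, mul_smul_comm, ← smul_add, hX, smul_zero]

/-- `G = Spin(m+1,1)`: the even products of vectors in the Clifford algebra whose spinor norm
`x⋆ x` is `1`. In this signature it is the connected double covering of `SO_e(m+1,1)`. -/
abbrev G (m : ℕ) : Type := spinGroup (Q m)

theorem mem_𝔤 {m : ℕ} {X : Mat m} :
    X ∈ 𝔤 m ↔ ∀ i j, X i j * sgn m j + sgn m i * X j i = 0 := by
  change X * J m + J m * Xᵀ = 0 ↔ _
  rw [← Matrix.ext_iff]
  simp [J, Matrix.mul_diagonal, Matrix.diagonal_mul]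

/-! ### The covering `G → SO_e(m+1,1)` and the adjoint action -/

theorem ι_injective (m : ℕ) : Function.Injective (CliffordAlgebra.ι (Q m)) := by
  intro x y h
  have h' := congrArg (CliffordAlgebra.equivExterior (Q m)) h
  simpa [CliffordAlgebra.equivExterior] using h'

theorem conj_mem {m : ℕ} (x : G m) (v : Fin (m + 2) → ℝ) :
    (x : CliffordAlgebra (Q m)) * CliffordAlgebra.ι (Q m) v * (↑x⁻¹ : CliffordAlgebra (Q m)) ∈
      LinearMap.range (CliffordAlgebra.ι (Q m)) := by
  have := spinGroup.conjAct_smul_ι_mem_range_ι (Q := Q m) (x := spinGroup.toUnits x) x.2 v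
  simpa [ConjAct.units_smul_def] using this

/-- The vector representation of `G`: `x · v = x v x⁻¹` inside the Clifford algebra. -/
noncomputable def vec {m : ℕ} (x : G m) : (Fin (m + 2) → ℝ) →ₗ[ℝ] (Fin (m + 2) → ℝ) :=
  (LinearEquiv.ofInjective (CliffordAlgebra.ι (Q m)) (ι_injective m)).symm.toLinearMap ∘ₗ
    LinearMap.codRestrict (LinearMap.range (CliffordAlgebra.ι (Q m)))
      (LinearMap.mulRight ℝ (↑x⁻¹ : CliffordAlgebra (Q m)) ∘ₗ
        LinearMap.mulLeft ℝ (x : CliffordAlgebra (Q m)) ∘ₗ CliffordAlgebra.ι (Q m))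
      (conj_mem x)

theorem ι_vec {m : ℕ} (x : G m) (v : Fin (m + 2) → ℝ) :
    CliffordAlgebra.ι (Q m) (vec x v) =
      (x : CliffordAlgebra (Q m)) * CliffordAlgebra.ι (Q m) v *
        (↑x⁻¹ : CliffordAlgebra (Q m)) :=
  congrArg Subtype.val
    ((LinearEquiv.ofInjective (CliffordAlgebra.ι (Q m)) (ι_injective m)).apply_symm_apply
      ⟨_, conj_mem x v⟩)

theorem Q_vec {m : ℕ} (x : G m) (v : Fin (m + 2) → ℝ) : Q m (vec x v) = Q m v := by
  have hx : (↑x⁻¹ : CliffordAlgebra (Q m)) * ↑x = 1 := spinGroup.star_mul_self_of_mem x.2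
  have hx' : (x : CliffordAlgebra (Q m)) * ↑x⁻¹ = 1 := spinGroup.mul_star_self_of_mem x.2
  apply (algebraMap ℝ (CliffordAlgebra (Q m))).injective
  rw [← CliffordAlgebra.ι_sq_scalar, ι_vec]
  calc _ = (x : CliffordAlgebra (Q m)) * CliffordAlgebra.ι (Q m) v * (↑x⁻¹ * ↑x) *
        CliffordAlgebra.ι (Q m) v * ↑x⁻¹ := by simp only [mul_assoc]
    _ = (x : CliffordAlgebra (Q m)) * (CliffordAlgebra.ι (Q m) v *
        CliffordAlgebra.ι (Q m) v) * ↑x⁻¹ := by rw [hx]; simp only [mul_assoc, one_mul]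
    _ = _ := by
      rw [CliffordAlgebra.ι_sq_scalar, ← Algebra.commutes, mul_assoc, hx', mul_one]

/-- The covering homomorphism `G → SO_e(m+1,1)`, with values in the invertible matrices. -/
noncomputable def ρ (m : ℕ) : G m →* GL (Fin (m + 2)) ℝ :=
  MonoidHom.toHomUnits
    { toFun := fun x => LinearMap.toMatrix' (vec x)
      map_one' := by
        have : vec (1 : G m) = LinearMap.id := by
          ext1 v
          refine LinearMap.ext fun t => ι_injective m ?_
          simp [ι_vec]
        rw [this, LinearMap.toMatrix'_id]
      map_mul' := fun x y => by
        have : vec (x * y) = vec x ∘ₗ vec y := by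
          refine LinearMap.ext fun t => ι_injective m ?_
          rw [LinearMap.comp_apply, ι_vec, ι_vec, ι_vec, _root_.mul_inv_rev]
          simp [mul_assoc]
        rw [this, LinearMap.toMatrix'_comp] }

theorem ρ_mulVec {m : ℕ} (x : G m) (v : Fin (m + 2) → ℝ) :
    (ρ m x : Mat m) *ᵥ v = vec x v := by
  change LinearMap.toMatrix' (vec x) *ᵥ v = _
  rw [← Matrix.toLin'_apply, Matrix.toLin'_toMatrix']

theorem ρ_orthogonal {m : ℕ} (x : G m) :
    (ρ m x : Mat m)ᵀ * J m * (ρ m x : Mat m) = J m := by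
  have hQ : ∀ v, Q m v = v ⬝ᵥ (J m *ᵥ v) := by
    intro v
    simp only [Q, QuadraticMap.weightedSumSquares_apply, J, dotProduct, mulVec_diagonal,
      smul_eq_mul]
    exact Finset.sum_congr rfl fun i _ => by ring
  have hs : ∀ v w, v ⬝ᵥ (J m *ᵥ w) = w ⬝ᵥ (J m *ᵥ v) := by
    intro v w
    simp only [J, dotProduct, mulVec_diagonal]
    exact Finset.sum_congr rfl fun i _ => by ring
  have hB : ∀ v w, (vec x v) ⬝ᵥ (J m *ᵥ vec x w) = v ⬝ᵥ (J m *ᵥ w) := by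
    intro v w
    have h1 := Q_vec x (v + w)
    have h2 := Q_vec x v
    have h3 := Q_vec x w
    rw [map_add] at h1
    simp only [hQ, mulVec_add, dotProduct_add, add_dotProduct] at h1 h2 h3
    have h4 := hs (vec x w) (vec x v)
    have h5 := hs w v
    linarith
  apply Matrix.ext_of_mulVec_single
  intro j
  funext i
  have h := hB (Pi.single i 1) (Pi.single j 1)
  rw [← ρ_mulVec, ← ρ_mulVec, single_one_dotProduct] at h
  rw [← h, ← mulVec_mulVec, ← mulVec_mulVec, ← single_one_dotProduct i ((ρ m x : Mat m)ᵀ *ᵥ _),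
    dotProduct_mulVec, vecMul_transpose]

theorem conj_mem_𝔤 {m : ℕ} (x : G m) {X : Mat m} (hX : X ∈ 𝔤 m) :
    (ρ m x : Mat m) * X * (↑(ρ m x)⁻¹ : Mat m) ∈ 𝔤 m := by
  change X * J m + J m * Xᵀ = 0 at hX
  change _ * J m + J m * _ = 0
  set R : Mat m := (ρ m x : Mat m) with hR
  set S : Mat m := (↑(ρ m x)⁻¹ : Mat m) with hS
  have hRS : R * S = 1 := (ρ m x).mul_inv
  have hSR : S * R = 1 := (ρ m x).inv_mul
  have hJJ : J m * J m = 1 := by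
    rw [J, diagonal_mul_diagonal, ← diagonal_one]
    congr 1
    funext i
    by_cases h : i = iz m <;> simp [sgn, h]
  have h0 : Rᵀ * J m * R = J m := ρ_orthogonal x
  have h1 : J m * Rᵀ * J m * R = 1 := by
    rw [mul_assoc, mul_assoc, ← mul_assoc Rᵀ, h0, hJJ]
  have h2 : J m * Rᵀ * J m = S := by
    calc J m * Rᵀ * J m = J m * Rᵀ * J m * (R * S) := by rw [hRS, mul_one]
      _ = J m * Rᵀ * J m * R * S := by simp only [mul_assoc]
      _ = S := by rw [h1, one_mul]
  have h3 : S * J m = J m * Rᵀ := by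
    rw [← h2, mul_assoc, hJJ, mul_one]
  have h4 : J m * Sᵀ = R * J m := by
    have := congrArg Matrix.transpose h3
    simpa [J, transpose_mul] using this
  calc R * X * S * J m + J m * (R * X * S)ᵀ
      = R * X * (S * J m) + (J m * Sᵀ) * Xᵀ * Rᵀ := by
        simp only [transpose_mul, mul_assoc]
    _ = R * (X * J m + J m * Xᵀ) * Rᵀ := by rw [h3, h4]; noncomm_ring
    _ = 0 := by rw [hX, mul_zero, zero_mul]

/-- The adjoint action `Ad(x) X = ρ(x) X ρ(x)⁻¹` of `G` on `𝔤`. -/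
noncomputable def Ad {m : ℕ} (x : G m) : 𝔤 m →ₗ[ℝ] 𝔤 m :=
  (LinearMap.mulLeft ℝ (ρ m x : Mat m) ∘ₗ LinearMap.mulRight ℝ (↑(ρ m x)⁻¹ : Mat m)).restrict
    fun X hX => by simpa [mul_assoc] using conj_mem_𝔤 x hX

theorem coe_Ad {m : ℕ} (x : G m) (X : 𝔤 m) :
    (Ad x X : Mat m) = (ρ m x : Mat m) * (X : Mat m) * (↑(ρ m x)⁻¹ : Mat m) := by
  simp [Ad, mul_assoc]

theorem Ad_one {m : ℕ} (X : 𝔤 m) : Ad (1 : G m) X = X := by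
  apply Subtype.ext; simp [coe_Ad]

theorem Ad_mul {m : ℕ} (x y : G m) (X : 𝔤 m) : Ad (x * y) X = Ad x (Ad y X) := by
  apply Subtype.ext; simp only [coe_Ad, map_mul, Units.val_mul, _root_.mul_inv_rev, mul_assoc]

/-- The dual `𝔤*`. -/
abbrev 𝔤Dual (m : ℕ) : Type := StrongDual ℝ (𝔤 m)

/-- The coadjoint action of `G` on `𝔤*`: `(x · φ)(X) = φ(Ad(x⁻¹) X)`. -/
noncomputable instance coadjoint (m : ℕ) : MulAction (G m) (𝔤Dual m) where
  smul x φ := φ ∘L (Ad x⁻¹).toContinuousLinearMap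
  one_smul φ := by
    ext X
    change φ (Ad (1 : G m)⁻¹ X) = φ X
    rw [inv_one, Ad_one]
  mul_smul x y φ := by
    ext X
    change φ (Ad (x * y)⁻¹ X) = φ (Ad y⁻¹ (Ad x⁻¹ X))
    rw [_root_.mul_inv_rev, Ad_mul]

theorem coadjoint_apply {m : ℕ} (x : G m) (φ : 𝔤Dual m) (X : 𝔤 m) :
    (x • φ) X = φ (Ad x⁻¹ X) := rfl

/-! ### The parabolic subalgebra `𝔭 = 𝔪 + 𝔞 + 𝔫` -/

/-- The generator `H₀` of `𝔞`. -/
def H₀ (m : ℕ) : Mat m := single (ip m) (iz m) 1 + single (iz m) (ip m) 1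

/-- The matrix `X_α` with rows `(0, -αᵗ, αᵗ)`, `(α, 0, 0)`, `(α, 0, 0)`. -/
def nil {m : ℕ} (α : Fin m → ℝ) : Mat m :=
  ∑ i, α i • (single (ip m) (ic i) 1 + single (iz m) (ic i) 1 -
    single (ic i) (ip m) 1 + single (ic i) (iz m) 1)

/-- `𝔪 = {diag (Y, 0, 0) | Y ∈ 𝔰𝔬(m)}`, the centralizer of `𝔞` in `𝔨`. -/
def 𝔪 (m : ℕ) : Submodule ℝ (Mat m) where
  carrier := {X | X ∈ 𝔤 m ∧ ∀ i, X i (ip m) = 0 ∧ X (ip m) i = 0 ∧ X i (iz m) = 0 ∧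
    X (iz m) i = 0}
  add_mem' {X Y} hX hY := ⟨add_mem hX.1 hY.1, fun i => by simp [hX.2 i, hY.2 i]⟩
  zero_mem' := ⟨zero_mem _, fun i => by simp⟩
  smul_mem' c X hX := ⟨Submodule.smul_mem _ c hX.1, fun i => by simp [hX.2 i]⟩

/-- `𝔞 = ℝ H₀`. -/
def 𝔞 (m : ℕ) : Submodule ℝ (Mat m) := Submodule.span ℝ {H₀ m}

/-- `𝔫 = {X_α | α ∈ ℝ^m}`. -/
def 𝔫 (m : ℕ) : Submodule ℝ (Mat m) where
  carrier := {X | ∃ α : Fin m → ℝ, X = nil α}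
  add_mem' := by
    rintro _ _ ⟨s, rfl⟩ ⟨t, rfl⟩
    exact ⟨s + t, by simp only [nil, Pi.add_apply, add_smul, Finset.sum_add_distrib]⟩
  zero_mem' := ⟨0, by simp [nil]⟩
  smul_mem' := by
    rintro c _ ⟨s, rfl⟩
    exact ⟨c • s, by simp only [nil, Pi.smul_apply, smul_assoc, Finset.smul_sum]⟩

/-- The parabolic subalgebra `𝔭 = 𝔪 + 𝔞 + 𝔫`. -/
def 𝔭 (m : ℕ) : Submodule ℝ (Mat m) := 𝔪 m ⊔ 𝔞 m ⊔ 𝔫 m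

/-- The isotropic vector `(0, …, 0, 1, 1)`. -/
def v₀ (m : ℕ) : Fin (m + 2) → ℝ := Pi.single (ip m) 1 + Pi.single (iz m) 1

theorem cases_index {m : ℕ} {p : Fin (m + 2) → Prop} (hc : ∀ i : Fin m, p (ic i))
    (hp : p (ip m)) (hz : p (iz m)) (i : Fin (m + 2)) : p i :=
  Fin.lastCases hz (fun i => Fin.lastCases hp hc i) i

theorem ic_ne_ip {m : ℕ} (i : Fin m) : ic i ≠ ip m := by
  simp [Fin.ext_iff]; omega

theorem ic_ne_iz {m : ℕ} (i : Fin m) : ic i ≠ iz m := by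
  simp [Fin.ext_iff]; omega

theorem ip_ne_iz (m : ℕ) : ip m ≠ iz m := by
  simp [Fin.ext_iff]

theorem ic_inj {m : ℕ} {i j : Fin m} : ic i = ic j ↔ i = j := by
  simp [Fin.ext_iff]

theorem mulVec_v₀ {m : ℕ} (X : Mat m) (i : Fin (m + 2)) :
    (X *ᵥ v₀ m) i = X i (ip m) + X i (iz m) := by
  simp [v₀, mulVec_add]

theorem nil_apply {m : ℕ} (α : Fin m → ℝ) :
    (∀ i j : Fin m, nil α (ic i) (ic j) = 0) ∧
    (∀ i : Fin m, nil α (ic i) (ip m) = -α i) ∧ (∀ i : Fin m, nil α (ic i) (iz m) = α i) ∧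
    (∀ i : Fin m, nil α (ip m) (ic i) = α i) ∧ (∀ i : Fin m, nil α (iz m) (ic i) = α i) ∧
    nil α (ip m) (ip m) = 0 ∧ nil α (ip m) (iz m) = 0 ∧ nil α (iz m) (ip m) = 0 ∧
    nil α (iz m) (iz m) = 0 := by
  have a := @ic_ne_ip m
  have b := @ic_ne_iz m
  have c := ip_ne_iz m
  refine ⟨?_, ?_, ?_, ?_, ?_, ?_, ?_, ?_, ?_⟩ <;> intros <;>
    simp [-Fin.castSucc_inj, nil, Matrix.sum_apply, single_apply, ic_inj, a, b, c, c.symm,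
      fun i => (a i).symm, fun i => (b i).symm]

theorem H₀_apply {m : ℕ} :
    (∀ i j : Fin m, H₀ m (ic i) (ic j) = 0) ∧
    (∀ i : Fin m, H₀ m (ic i) (ip m) = 0) ∧ (∀ i : Fin m, H₀ m (ic i) (iz m) = 0) ∧
    (∀ i : Fin m, H₀ m (ip m) (ic i) = 0) ∧ (∀ i : Fin m, H₀ m (iz m) (ic i) = 0) ∧
    H₀ m (ip m) (ip m) = 0 ∧ H₀ m (ip m) (iz m) = 1 ∧ H₀ m (iz m) (ip m) = 1 ∧
    H₀ m (iz m) (iz m) = 0 := by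
  have a := @ic_ne_ip m
  have b := @ic_ne_iz m
  have c := ip_ne_iz m
  refine ⟨?_, ?_, ?_, ?_, ?_, ?_, ?_, ?_, ?_⟩ <;> intros <;>
    simp [-Fin.castSucc_inj, H₀, single_apply, a, b, c, c.symm,
      fun i => (a i).symm, fun i => (b i).symm]

theorem sgn_ic {m : ℕ} (i : Fin m) : sgn m (ic i) = 1 := if_neg (ic_ne_iz i)
theorem sgn_ip (m : ℕ) : sgn m (ip m) = 1 := if_neg (ip_ne_iz m)
theorem sgn_iz (m : ℕ) : sgn m (iz m) = -1 := if_pos rfl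

theorem nil_mem {m : ℕ} (α : Fin m → ℝ) : nil α ∈ 𝔤 m := by
  obtain ⟨h1, h2, h3, h4, h5, h6, h7, h8, h9⟩ := nil_apply α
  rw [mem_𝔤]
  refine cases_index (fun i => ?_) ?_ ?_ <;> refine cases_index (fun j => ?_) ?_ ?_ <;>
    simp only [h1, h2, h3, h4, h5, h6, h7, h8, h9, sgn_ic, sgn_ip, sgn_iz] <;> ring

theorem H₀_mem (m : ℕ) : H₀ m ∈ 𝔤 m := by
  obtain ⟨h1, h2, h3, h4, h5, h6, h7, h8, h9⟩ := @H₀_apply m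
  rw [mem_𝔤]
  refine cases_index (fun i => ?_) ?_ ?_ <;> refine cases_index (fun j => ?_) ?_ ?_ <;>
    simp only [h1, h2, h3, h4, h5, h6, h7, h8, h9, sgn_ic, sgn_ip, sgn_iz] <;> ring

theorem H₀_mulVec_v₀ (m : ℕ) : H₀ m *ᵥ v₀ m = v₀ m := by
  obtain ⟨h1, h2, h3, h4, h5, h6, h7, h8, h9⟩ := @H₀_apply m
  funext i
  rw [mulVec_v₀]
  revert i
  refine cases_index (fun i => ?_) ?_ ?_ <;>
    simp [-Fin.castSucc_inj, h1, h2, h3, h4, h5, h6, h7, h8, h9, v₀, Pi.single_apply, ic_ne_ip,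
      ic_ne_iz, ip_ne_iz, (ip_ne_iz m).symm]

theorem nil_mulVec_v₀ {m : ℕ} (α : Fin m → ℝ) : nil α *ᵥ v₀ m = 0 := by
  obtain ⟨h1, h2, h3, h4, h5, h6, h7, h8, h9⟩ := nil_apply α
  funext i
  rw [mulVec_v₀]
  revert i
  refine cases_index (fun i => ?_) ?_ ?_ <;> simp [h1, h2, h3, h4, h5, h6, h7, h8, h9]

theorem 𝔭_le_𝔤 (m : ℕ) : 𝔭 m ≤ 𝔤 m := by
  refine sup_le (sup_le (fun X hX => hX.1) ?_) ?_
  · exact (Submodule.span_singleton_le_iff_mem _ _).2 (H₀_mem m)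
  · rintro _ ⟨α, rfl⟩
    exact nil_mem α

theorem mem_𝔭 {m : ℕ} {X : Mat m} :
    X ∈ 𝔭 m ↔ X ∈ 𝔤 m ∧ ∃ c : ℝ, X *ᵥ v₀ m = c • v₀ m := by
  constructor
  · intro h
    refine ⟨𝔭_le_𝔤 m h, ?_⟩
    obtain ⟨Y, hY, N, ⟨α, hα⟩, rfl⟩ := Submodule.mem_sup.1 h
    obtain ⟨M, hM, A, hA, rfl⟩ := Submodule.mem_sup.1 hY
    obtain ⟨t, rfl⟩ := Submodule.mem_span_singleton.1 hA
    refine ⟨t, ?_⟩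
    have : M *ᵥ v₀ m = 0 := by
      funext i
      rw [mulVec_v₀]
      simp [hM.2 i]
    simp [add_mulVec, this, hα, nil_mulVec_v₀, smul_mulVec, H₀_mulVec_v₀]
  · rintro ⟨hXg, c, hc⟩
    have hX := mem_𝔤.1 hXg
    let α : Fin m → ℝ := fun i => X (ic i) (iz m)
    let A : Mat m := c • H₀ m
    let N : Mat m := nil α
    have hA : A ∈ 𝔞 m := Submodule.smul_mem _ _ (Submodule.mem_span_singleton_self _)
    have hM : X - A - N ∈ 𝔪 m := by
      refine ⟨sub_mem (sub_mem hXg (Submodule.smul_mem _ _ (H₀_mem m))) (nil_mem α), ?_⟩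
      obtain ⟨h1, h2, h3, h4, h5, h6, h7, h8, h9⟩ := nil_apply α
      obtain ⟨k1, k2, k3, k4, k5, k6, k7, k8, k9⟩ := @H₀_apply m
      have hv : ∀ i, X i (ip m) + X i (iz m) = c * v₀ m i := by
        intro i
        rw [← mulVec_v₀, hc]; rfl
      have vc : ∀ i : Fin m, v₀ m (ic i) = 0 := fun i => by
        simp [-Fin.castSucc_inj, v₀, Pi.single_apply, ic_ne_ip, ic_ne_iz]
      have vp : v₀ m (ip m) = 1 := by
        simp [v₀, Pi.single_apply, ip_ne_iz]
      have vz : v₀ m (iz m) = 1 := by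
        simp [v₀, Pi.single_apply, (ip_ne_iz m).symm]
      have hpp := hX (ip m) (ip m)
      have hzz := hX (iz m) (iz m)
      have hpz := hX (ip m) (iz m)
      have gp := hv (ip m)
      have gz := hv (iz m)
      rw [vp] at gp
      rw [vz] at gz
      simp only [sgn_ip, sgn_iz] at hpp hzz hpz
      have key : ∀ i j, (X - A - N) i j
          = X i j - c * H₀ m i j - nil α i j := fun i j => rfl
      refine cases_index (fun i => ?_) ?_ ?_
      · have gi := hv (ic i)
        have hip := hX (ic i) (ip m)
        have hiz := hX (ic i) (iz m)
        simp only [vc, sgn_ic, sgn_ip, sgn_iz] at gi hip hiz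
        simp only [key, h2, h3, h4, h5, k2, k3, k4, k5, α]
        refine ⟨?_, ?_, ?_, ?_⟩ <;> linarith
      · simp only [key, h6, h7, h8, h9, k6, k7, k8, k9]
        refine ⟨?_, ?_, ?_, ?_⟩ <;> linarith
      · simp only [key, h6, h7, h8, h9, k6, k7, k8, k9]
        refine ⟨?_, ?_, ?_, ?_⟩ <;> linarith
    have : X = X - A - N + A + N := by abel
    rw [this]
    exact Submodule.add_mem_sup (Submodule.add_mem_sup hM hA) ⟨α, rfl⟩

/-! ### The parabolic subgroup `P = M A N` -/

/-- `M₁ = Z_{K₁}(𝔞)`, where `K₁ = {diag (Y, 1) | Y ∈ SO(m+1)}`. -/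
def M₁ (m : ℕ) : Set (GL (Fin (m + 2)) ℝ) :=
  {k | (k : Mat m) * (k : Mat m)ᵀ = 1 ∧ (k : Mat m).det = 1 ∧ (k : Mat m) (iz m) (iz m) = 1 ∧
    (∀ i, i ≠ iz m → (k : Mat m) i (iz m) = 0 ∧ (k : Mat m) (iz m) i = 0) ∧
    (k : Mat m) * H₀ m = H₀ m * (k : Mat m)}

/-- `A₁ = exp 𝔞`: the matrices `diag (I_m, (r, s; s, r))` with `r² - s² = 1`, `r > 0`. -/
def A₁ (m : ℕ) : Set (GL (Fin (m + 2)) ℝ) :=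
  {a | ∃ r s : ℝ, r ^ 2 - s ^ 2 = 1 ∧ 0 < r ∧
    (a : Mat m) = 1 + (r - 1) • (single (ip m) (ip m) 1 + single (iz m) (iz m) 1) + s • H₀ m}

/-- `N₁ = exp 𝔫`: the matrices `n_α = exp X_α = I + X_α + X_α² / 2` (here `X_α³ = 0`). -/
def N₁ (m : ℕ) : Set (GL (Fin (m + 2)) ℝ) :=
  {n | ∃ α : Fin m → ℝ, (n : Mat m) = 1 + nil α + (1 / 2 : ℝ) • (nil α * nil α)}

/-- `P₁ = M₁ A₁ N₁`, as the group generated by `M₁`, `A₁` and `N₁`. -/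
def P₁ (m : ℕ) : Subgroup (GL (Fin (m + 2)) ℝ) := Subgroup.closure (M₁ m ∪ A₁ m ∪ N₁ m)

/-- `P = M A N ⊆ G`. Since `M` contains the kernel of `G → SO_e(m+1,1)`, this is the full inverse
image of `P₁ = M₁ A₁ N₁`. -/
noncomputable def P (m : ℕ) : Subgroup (G m) := (P₁ m).comap (ρ m)

theorem v₀_ne_zero (m : ℕ) : v₀ m ≠ 0 := by
  intro h
  have := congrFun h (ip m)
  simp [v₀, ip_ne_iz] at this

theorem P₁_mulVec_v₀ {m : ℕ} {g : GL (Fin (m + 2)) ℝ} (hg : g ∈ P₁ m) :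
    ∃ c : ℝ, c ≠ 0 ∧ (g : Mat m) *ᵥ v₀ m = c • v₀ m := by
  have hne : ∀ (g : GL (Fin (m + 2)) ℝ) (c : ℝ), (g : Mat m) *ᵥ v₀ m = c • v₀ m → c ≠ 0 := by
    rintro g c h rfl
    apply v₀_ne_zero m
    have h2 := congrArg (fun w => (↑g⁻¹ : Mat m) *ᵥ w) h
    have h3 : (↑g⁻¹ : Mat m) * (g : Mat m) = 1 := g.inv_mul
    simpa only [mulVec_mulVec, h3, one_mulVec, zero_smul, mulVec_zero] using h2
  suffices ∃ c : ℝ, (g : Mat m) *ᵥ v₀ m = c • v₀ m by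
    obtain ⟨c, hc⟩ := this
    exact ⟨c, hne g c hc, hc⟩
  induction hg using Subgroup.closure_induction with
  | mem g hg =>
    rcases hg with (hg | ⟨r, s, -, -, hg⟩) | ⟨α, hg⟩
    · obtain ⟨-, -, -, -, hg⟩ := hg
      obtain ⟨h1, h2, h3, h4, h5, h6, h7, h8, h9⟩ := @H₀_apply m
      set w := (g : Mat m) *ᵥ v₀ m with hw
      have hH : H₀ m *ᵥ w = w := by
        rw [hw, mulVec_mulVec, ← hg, ← mulVec_mulVec, H₀_mulVec_v₀]
      have hw' : ∀ i, w i = (if i = ip m then 1 else 0) * w (iz m) +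
          (if i = iz m then 1 else 0) * w (ip m) := by
        intro i
        conv_lhs => rw [← hH]
        simp [H₀, add_mulVec, single_mulVec, Function.update_apply]
      refine ⟨w (iz m), funext fun i => ?_⟩
      have hpz := hw' (ip m)
      rw [if_pos rfl, if_neg (ip_ne_iz m)] at hpz
      rw [hw' i, hpz]
      simp [v₀, Pi.single_apply]
      split_ifs <;> ring
    · refine ⟨r + s, ?_⟩
      have : (single (ip m) (ip m) 1 + single (iz m) (iz m) 1 : Mat m) *ᵥ v₀ m = v₀ m := by
        funext i
        rw [mulVec_v₀]
        simp [v₀, single_apply, Pi.single_apply, ip_ne_iz, (ip_ne_iz m).symm, eq_comm]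
      rw [hg, add_mulVec, add_mulVec, smul_mulVec, smul_mulVec, this, H₀_mulVec_v₀, one_mulVec]
      module
    · refine ⟨1, ?_⟩
      rw [hg, add_mulVec, add_mulVec, smul_mulVec, ← mulVec_mulVec, nil_mulVec_v₀]
      simp
  | one => exact ⟨1, by simp⟩
  | mul x y _ _ hx hy =>
    obtain ⟨a, ha⟩ := hx
    obtain ⟨b, hb⟩ := hy
    exact ⟨b * a, by rw [Units.val_mul, ← mulVec_mulVec, hb, mulVec_smul, ha, smul_smul]⟩
  | inv x _ hx =>
    obtain ⟨a, ha⟩ := hx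
    have ha0 := hne x a ha
    refine ⟨a⁻¹, ?_⟩
    have h2 := congrArg (fun w => a⁻¹ • ((↑x⁻¹ : Mat m) *ᵥ w)) ha
    have h3 : (↑x⁻¹ : Mat m) * (x : Mat m) = 1 := x.inv_mul
    simp only [mulVec_mulVec, h3, one_mulVec, mulVec_smul, smul_smul, inv_mul_cancel₀ ha0,
      one_smul] at h2
    exact h2.symm

theorem Ad_mem_𝔭 {m : ℕ} (x : P m) {X : Mat m} (hX : X ∈ 𝔭 m) :
    (ρ m x : Mat m) * X * (↑(ρ m x)⁻¹ : Mat m) ∈ 𝔭 m := by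
  obtain ⟨hXg, c, hc⟩ := mem_𝔭.1 hX
  obtain ⟨a, -, ha⟩ := P₁_mulVec_v₀ (x.2 : ρ m x ∈ P₁ m)
  obtain ⟨b, -, hb⟩ := P₁_mulVec_v₀ (inv_mem (x.2 : ρ m x ∈ P₁ m))
  refine mem_𝔭.2 ⟨conj_mem_𝔤 _ hXg, b * c * a, ?_⟩
  rw [← mulVec_mulVec, ← mulVec_mulVec, hb, mulVec_smul, mulVec_smul, hc, mulVec_smul, ha,
    smul_smul, smul_smul]

/-- The adjoint action of `P` on `𝔭`. -/
noncomputable def AdP {m : ℕ} (x : P m) : 𝔭 m →ₗ[ℝ] 𝔭 m :=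
  (LinearMap.mulLeft ℝ (ρ m x : Mat m) ∘ₗ LinearMap.mulRight ℝ (↑(ρ m x)⁻¹ : Mat m)).restrict
    fun X hX => by simpa [mul_assoc] using Ad_mem_𝔭 x hX

theorem coe_AdP {m : ℕ} (x : P m) (X : 𝔭 m) :
    (AdP x X : Mat m) = (ρ m x : Mat m) * (X : Mat m) * (↑(ρ m x)⁻¹ : Mat m) := by
  simp [AdP, mul_assoc]

theorem AdP_one {m : ℕ} (X : 𝔭 m) : AdP (1 : P m) X = X := by
  apply Subtype.ext; simp [coe_AdP]

theorem AdP_mul {m : ℕ} (x y : P m) (X : 𝔭 m) : AdP (x * y) X = AdP x (AdP y X) := by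
  apply Subtype.ext
  simp only [coe_AdP, Subgroup.coe_mul, map_mul, Units.val_mul, _root_.mul_inv_rev, mul_assoc]

/-- The dual `𝔭*`. -/
abbrev 𝔭Dual (m : ℕ) : Type := StrongDual ℝ (𝔭 m)

/-- The coadjoint action of `P` on `𝔭*`. -/
noncomputable instance coadjointP (m : ℕ) : MulAction (P m) (𝔭Dual m) where
  smul x φ := φ ∘L (AdP x⁻¹).toContinuousLinearMap
  one_smul φ := by
    ext X
    change φ (AdP (1 : P m)⁻¹ X) = φ X
    rw [inv_one, AdP_one]
  mul_smul x y φ := by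
    ext X
    change φ (AdP (x * y)⁻¹ X) = φ (AdP y⁻¹ (AdP x⁻¹ X))
    rw [_root_.mul_inv_rev, AdP_mul]

theorem coadjointP_apply {m : ℕ} (x : P m) (φ : 𝔭Dual m) (X : 𝔭 m) :
    (x • φ) X = φ (AdP x⁻¹ X) := rfl

/-! ### Depth -/

/-- `𝔩* ⊆ 𝔭*`, embedded by means of the projection `𝔭 → 𝔭 / 𝔫 = 𝔩 = 𝔪 + 𝔞`: the functionals that
vanish on `𝔫`. -/
def 𝔩Dual (m : ℕ) : Set (𝔭Dual m) := {φ | ∀ X : 𝔭 m, (X : Mat m) ∈ 𝔫 m → φ X = 0}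

/-- An element of `𝔭*` has depth one if its coadjoint `P`-orbit is not contained in `𝔩*`
(otherwise it has depth zero). -/
def DepthOne {m : ℕ} (φ : 𝔭Dual m) : Prop := ¬ MulAction.orbit (P m) φ ⊆ 𝔩Dual m

/-! ### Coadjoint orbits, moment map and reduced spaces -/

/-- The map `𝔤 → 𝔤*`, `X ↦ (Y ↦ tr (X Y) / 2)`. -/
noncomputable def toDual {m : ℕ} (X : 𝔤 m) : 𝔤Dual m :=
  ((1 / 2 : ℝ) • (Matrix.traceLinearMap (Fin (m + 2)) ℝ ℝ ∘ₗ
    LinearMap.mulLeft ℝ (X : Mat m) ∘ₗ (𝔤 m).subtype)).toContinuousLinearMap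

theorem toDual_apply {m : ℕ} (X Y : 𝔤 m) :
    toDual X Y = 1 / 2 * ((X : Mat m) * (Y : Mat m)).trace := rfl

/-- The coadjoint orbit `G · f`. -/
abbrev Orb {m : ℕ} (f : 𝔤Dual m) : Set (𝔤Dual m) := MulAction.orbit (G m) f

/-- Restriction of functionals `𝔤* → 𝔭*`, dual to the inclusion `𝔭 ⊆ 𝔤`. -/
noncomputable def res {m : ℕ} (φ : 𝔤Dual m) : 𝔭Dual m :=
  φ ∘L (Submodule.inclusion (𝔭_le_𝔤 m)).toContinuousLinearMap

/-- The moment map `q : G · f → 𝔭*`, restriction of functionals from `𝔤` to `𝔭`. -/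
noncomputable def q {m : ℕ} (f : 𝔤Dual m) (φ : Orb f) : 𝔭Dual m := res (φ : 𝔤Dual m)

theorem q_apply {m : ℕ} (f : 𝔤Dual m) (φ : Orb f) (X : 𝔭 m) :
    q f φ X = (φ : 𝔤Dual m) ⟨X, 𝔭_le_𝔤 m X.2⟩ := rfl

theorem q_smul {m : ℕ} (f : 𝔤Dual m) (x : P m) (φ : Orb f) :
    q f ((x : G m) • φ) = x • q f φ := rfl

/-- The fibre `q⁻¹(φ)`. -/
abbrev Fib {m : ℕ} (f : 𝔤Dual m) (φ : 𝔭Dual m) : Type := q f ⁻¹' {φ}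

/-- The action of `Stab_P(φ)` on `q⁻¹(φ)`. -/
noncomputable instance stabAction {m : ℕ} (f : 𝔤Dual m) (φ : 𝔭Dual m) :
    MulAction (MulAction.stabilizer (P m) φ) (Fib f φ) where
  smul x ψ := ⟨((x : P m) : G m) • (ψ : Orb f), by
    have hx : (x : P m) • φ = φ := x.2
    have hψ : q f ψ = φ := ψ.2
    change q f _ = φ
    rw [q_smul, hψ, hx]⟩
  one_smul ψ := Subtype.ext (one_smul (G m) (ψ : Orb f))
  mul_smul x y ψ := Subtype.ext
    (mul_smul ((x : P m) : G m) ((y : P m) : G m) (ψ : Orb f))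

/-- The reduced space `q⁻¹(φ) / Stab_P(φ)`. -/
abbrev ReducedSpace {m : ℕ} (f : 𝔤Dual m) (φ : 𝔭Dual m) : Type :=
  MulAction.orbitRel.Quotient (MulAction.stabilizer (P m) φ) (Fib f φ)

/-! ### Elliptic elements -/

/-- The matrix `t_a`, block diagonal with blocks `(0, a_i; -a_i, 0)` in the coordinates
`2i, 2i+1` for `i = 0, …, n-1`, and zero elsewhere. -/
def tMat (m : ℕ) {n : ℕ} (a : Fin n → ℝ) : Mat m := Matrix.of fun j k =>
  ∑ i : Fin n, ((if (j : ℕ) = 2 * i ∧ (k : ℕ) = 2 * i + 1 then a i else 0) -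
    (if (j : ℕ) = 2 * i + 1 ∧ (k : ℕ) = 2 * i then a i else 0))

theorem tMat_mem (m : ℕ) {n : ℕ} (h : 2 * n ≤ m + 1) (a : Fin n → ℝ) : tMat m a ∈ 𝔤 m := by
  rw [mem_𝔤]
  intro j k
  simp only [tMat, of_apply, Finset.sum_mul, Finset.mul_sum, ← Finset.sum_add_distrib]
  refine Finset.sum_eq_zero fun i _ => ?_
  have hi := i.2
  have hs : ∀ l : Fin (m + 2), (l : ℕ) < m + 1 → sgn m l = 1 := fun l hl =>
    if_neg (by rintro rfl; simp at hl)
  by_cases h1 : (j : ℕ) = 2 * i ∧ (k : ℕ) = 2 * i + 1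
  · rw [hs j (by omega), hs k (by omega), if_pos h1, if_neg (by omega), if_neg (by omega),
      if_pos (by omega)]
    ring
  · by_cases h2 : (j : ℕ) = 2 * i + 1 ∧ (k : ℕ) = 2 * i
    · rw [hs j (by omega), hs k (by omega), if_neg h1, if_pos h2, if_pos (by omega),
        if_neg (by omega)]
      ring
    · rw [if_neg h1, if_neg h2, if_neg (by omega), if_neg (by omega)]
      ring

/-- The elliptic element `f_a ∈ 𝔤*` corresponding to `t_a`. -/
noncomputable def fElliptic (m : ℕ) {n : ℕ} (h : 2 * n ≤ m + 1) (a : Fin n → ℝ) : 𝔤Dual m :=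
  toDual ⟨tMat m a, tMat_mem m h a⟩

end SpinM1

namespace SpinM1

open Matrix

/-! Under the trace form the annihilator of `𝔭` in `𝔤` is `𝔫` (`exists_eq_nil_of_toPDual`), so `q`
sends an orbit element `X = R t R⁻¹`, with `t` the given elliptic matrix and `R` in `SO_e`, to its
class modulo `𝔫`. Since `𝔫` kills the isotropic vector `v₀`, the vector `X v₀` depends only on `q`;
the value lies in `𝔩*` exactly when `v₀` is an eigenvector of `X`. Everything is expressed through
`w = R⁻¹ v₀`.

Depth: if `q` took a value in `𝔩*`, then `w` would be an isotropic eigenvector of `t`. Its time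
component is nonzero, so the eigenvalue is `0`; but all `a i ≠ 0`, so the kernel of `t` is the
timelike axis, a contradiction (`tMat_mulVec_ne_smul`).

Fibres: let `X' = X + N` with `N ∈ 𝔫`. The determinant of `λ - X` bordered by `v₀` and its dual
covector does not see `N`, and it equals `-B(w, (λ - t)⁻¹ w) det(λ - t)`; hence `w` and `w'` have
the same resolvent function. Partial fractions in `λ²` then give equal norms of `w` and `w'` on
every eigenspace of `t²` with nonzero eigenvalue (`fiber_sums_eq`), and isotropy with time
orientation gives equal time components. The centralizer of `t` contains a product of unitary
groups, transitive on such vectors (`exists_commuting_mulVec_eq`), so some `K` commutes with `t` and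
has `K w = w'`. A lift `k` of `K` makes `x' k x⁻¹` fix `v₀`. It therefore lies in `P`, and it
carries one point of the fibre to the other (`exists_P_smul_eq`).

Weak properness: an orbit element is controlled by the time component of `u = R e₀`, where `e₀` is
the timelike basis vector. Off `𝔩*` this is bounded by a continuous function of the value of `q`
(`sq_le_boostBound`), so the matrices `R` lying over a compact set form a compact set.

Non-properness: the boosts in `A` expand `𝔫` by `l` and contract its transpose by `l⁻¹`. As `l → ∞`
the conjugates of `t` diverge, but only along `𝔫`, which `q` does not see; their images converge to
a point of `𝔩*`.

The passage between `G` and matrices is Cartan–Dieudonné for surjectivity onto `SO_e`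
(`exists_ρ_eq`), and a comparison of spinor norm with time orientation for the converse
(`lipschitz_orientation`). -/

/-! ### The bilinear form and its orthogonal group -/

/-- The symmetric bilinear form `x₁ y₁ + ⋯ + x_{m+1} y_{m+1} - x₀ y₀`. -/
noncomputable def B (m : ℕ) : LinearMap.BilinForm ℝ (Fin (m + 2) → ℝ) :=
  Matrix.toLinearMap₂' ℝ (J m)

theorem B_eq_dotProduct {m : ℕ} (x y : Fin (m + 2) → ℝ) : B m x y = x ⬝ᵥ (J m *ᵥ y) :=
  Matrix.toLinearMap₂'_apply' _ _ _

theorem B_apply {m : ℕ} (x y : Fin (m + 2) → ℝ) : B m x y = ∑ i, sgn m i * x i * y i := by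
  simp only [B_eq_dotProduct, J, dotProduct, mulVec_diagonal]
  exact Finset.sum_congr rfl fun i _ => by ring

theorem B_comm {m : ℕ} (x y : Fin (m + 2) → ℝ) : B m x y = B m y x := by
  simp only [B_apply]
  exact Finset.sum_congr rfl fun i _ => by ring

theorem Q_eq_B {m : ℕ} (x : Fin (m + 2) → ℝ) : Q m x = B m x x := by
  simp only [Q, QuadraticMap.weightedSumSquares_apply, B_apply, smul_eq_mul]
  exact Finset.sum_congr rfl fun i _ => by ring

theorem polar_Q {m : ℕ} (x y : Fin (m + 2) → ℝ) : QuadraticMap.polar (Q m) x y = 2 * B m x y := by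
  simp only [QuadraticMap.polar, Q_eq_B, map_add, LinearMap.add_apply, B_comm y x]
  ring

theorem sum_index {m : ℕ} (F : Fin (m + 2) → ℝ) :
    ∑ i, F i = ∑ i : Fin m, F (ic i) + F (ip m) + F (iz m) := by
  rw [Fin.sum_univ_castSucc, Fin.sum_univ_castSucc]

theorem B_split {m : ℕ} (x y : Fin (m + 2) → ℝ) :
    B m x y = ∑ i : Fin m, x (ic i) * y (ic i) + x (ip m) * y (ip m) - x (iz m) * y (iz m) := by
  rw [B_apply, sum_index]
  simp only [sgn_ic, sgn_ip, sgn_iz]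
  ring_nf

theorem B_split_last {m : ℕ} (x y : Fin (m + 2) → ℝ) :
    B m x y = ∑ i : Fin (m + 1), x i.castSucc * y i.castSucc - x (iz m) * y (iz m) := by
  rw [B_split, Fin.sum_univ_castSucc]

theorem sgn_castSucc {m : ℕ} (i : Fin (m + 1)) : sgn m i.castSucc = 1 :=
  if_neg (Fin.castSucc_lt_last i).ne

theorem sgn_mul_self {m : ℕ} (i : Fin (m + 2)) : sgn m i * sgn m i = 1 := by
  unfold sgn; split_ifs <;> norm_num

theorem J_mul_J (m : ℕ) : J m * J m = 1 := by
  rw [J, diagonal_mul_diagonal, ← diagonal_one]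
  exact congrArg _ (funext sgn_mul_self)

theorem B_single {m : ℕ} (i : Fin (m + 2)) (x : Fin (m + 2) → ℝ) :
    B m (Pi.single i 1) x = sgn m i * x i := by
  rw [B_apply, Finset.sum_eq_single i] <;> simp +contextual

theorem B_single_right {m : ℕ} (i : Fin (m + 2)) (x : Fin (m + 2) → ℝ) :
    B m x (Pi.single i 1) = sgn m i * x i := by
  rw [B_comm, B_single]

theorem eq_of_B_eq {m : ℕ} {x y : Fin (m + 2) → ℝ} (h : ∀ z, B m z x = B m z y) : x = y := by
  funext i
  have := h (Pi.single i 1)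
  rw [B_single, B_single] at this
  have hs := sgn_mul_self i
  calc x i = sgn m i * (sgn m i * x i) := by rw [← mul_assoc, hs, one_mul]
    _ = y i := by rw [this, ← mul_assoc, hs, one_mul]

theorem B_transpose {m : ℕ} (X : Mat m) (x y : Fin (m + 2) → ℝ) :
    B m (X *ᵥ x) y = B m x ((J m * Xᵀ * J m) *ᵥ y) := by
  simp only [B_eq_dotProduct, mulVec_mulVec]
  rw [← mul_assoc, ← mul_assoc, J_mul_J, one_mul, dotProduct_comm, dotProduct_mulVec,
    ← mulVec_transpose, mulVec_mulVec, dotProduct_comm]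

/-- The matrices that preserve the form `B`. -/
def IsOrth {m : ℕ} (R : Mat m) : Prop := Rᵀ * J m * R = J m

theorem B_mulVec_mulVec {m : ℕ} {R : Mat m} (hR : IsOrth R) (x y : Fin (m + 2) → ℝ) :
    B m (R *ᵥ x) (R *ᵥ y) = B m x y := by
  have : J m * Rᵀ * J m * R = 1 := by
    rw [mul_assoc, mul_assoc, ← mul_assoc Rᵀ, hR, J_mul_J]
  rw [B_transpose, mulVec_mulVec, this, one_mulVec]

theorem isOrth_iff {m : ℕ} {R : Mat m} :
    IsOrth R ↔ ∀ x y, B m (R *ᵥ x) (R *ᵥ y) = B m x y := by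
  refine ⟨B_mulVec_mulVec, fun h => ?_⟩
  have h1 : (J m * Rᵀ * J m) * R = 1 := by
    apply Matrix.ext_of_mulVec_single
    intro i
    rw [one_mulVec, ← mulVec_mulVec]
    exact eq_of_B_eq fun z => by rw [← B_transpose, h]
  have h2 := congrArg (J m * ·) h1
  simp only [← mul_assoc, J_mul_J, one_mul, mul_one] at h2
  exact h2

theorem IsOrth.mul {m : ℕ} {R S : Mat m} (hR : IsOrth R) (hS : IsOrth S) : IsOrth (R * S) := by
  rw [isOrth_iff] at *
  intro x y
  rw [← mulVec_mulVec, ← mulVec_mulVec, hR, hS]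

theorem isOrth_one {m : ℕ} : IsOrth (1 : Mat m) := by simp [IsOrth]

/-- The `B`-adjoint of a matrix; the inverse on orthogonal matrices. -/
def adj {m : ℕ} (R : Mat m) : Mat m := J m * Rᵀ * J m

theorem IsOrth.adj_mul {m : ℕ} {R : Mat m} (hR : IsOrth R) : adj R * R = 1 := by
  rw [adj, mul_assoc, mul_assoc, ← mul_assoc Rᵀ, hR, J_mul_J]

theorem IsOrth.mul_adj {m : ℕ} {R : Mat m} (hR : IsOrth R) : R * adj R = 1 :=
  mul_eq_one_comm.1 hR.adj_mul

theorem IsOrth.adj {m : ℕ} {R : Mat m} (hR : IsOrth R) : IsOrth (adj R) := by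
  rw [isOrth_iff]
  intro x y
  rw [← B_mulVec_mulVec hR, mulVec_mulVec, mulVec_mulVec, hR.mul_adj, one_mulVec, one_mulVec]

theorem adj_apply {m : ℕ} (R : Mat m) (i j : Fin (m + 2)) :
    adj R i j = sgn m i * R j i * sgn m j := by
  simp [adj, J, mul_diagonal, diagonal_mul]

theorem B_adj {m : ℕ} (X : Mat m) (x y : Fin (m + 2) → ℝ) :
    B m (X *ᵥ x) y = B m x (adj X *ᵥ y) := B_transpose X x y

theorem IsOrth.det_sq {m : ℕ} {R : Mat m} (hR : IsOrth R) : R.det ^ 2 = 1 := by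
  have h := congrArg Matrix.det hR
  have hJ := congrArg Matrix.det (J_mul_J m)
  rw [det_mul, det_mul, det_transpose] at h
  rw [det_mul, det_one] at hJ
  calc R.det ^ 2 = (R.det * (J m).det * R.det) * (J m).det := by linear_combination -R.det ^ 2 * hJ
    _ = 1 := by rw [h, hJ]

theorem B_mulVec_of_mem {m : ℕ} {X : Mat m} (hX : X ∈ 𝔤 m) (x y : Fin (m + 2) → ℝ) :
    B m (X *ᵥ x) y = -B m x (X *ᵥ y) := by
  have h : X * J m + J m * Xᵀ = 0 := hX
  have : J m * Xᵀ * J m = -X := by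
    rw [eq_neg_of_add_eq_zero_right h, neg_mul, mul_assoc, J_mul_J, mul_one]
  rw [B_transpose, this, neg_mulVec, map_neg]

/-! ### Reflections -/

/-- The reflection in the hyperplane orthogonal to `v`, for `B v v = 1`. -/
noncomputable def refl {m : ℕ} (v : Fin (m + 2) → ℝ) : Mat m :=
  1 - (2 : ℝ) • vecMulVec v (J m *ᵥ v)

theorem refl_mulVec {m : ℕ} (v x : Fin (m + 2) → ℝ) :
    refl v *ᵥ x = x - (2 * B m v x) • v := by
  rw [refl, sub_mulVec, one_mulVec, smul_mulVec, vecMulVec_mulVec, B_comm, B_eq_dotProduct,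
    dotProduct_comm x]
  ext i
  simp
  ring

theorem isOrth_refl {m : ℕ} {v : Fin (m + 2) → ℝ} (hv : B m v v = 1) : IsOrth (refl v) := by
  rw [isOrth_iff]
  intro x y
  simp only [refl_mulVec, map_sub, map_smul, LinearMap.sub_apply, LinearMap.smul_apply,
    smul_eq_mul, hv, B_comm x v]
  ring

theorem det_refl {m : ℕ} {v : Fin (m + 2) → ℝ} (hv : B m v v = 1) : (refl v).det = -1 := by
  have : refl v = 1 + replicateCol Unit ((-2 : ℝ) • v) * replicateRow Unit (J m *ᵥ v) := by
    rw [refl, ← vecMulVec_eq, smul_vecMulVec, neg_smul, sub_eq_add_neg]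
  rw [this, det_one_add_replicateCol_mul_replicateRow, dotProduct_comm, smul_dotProduct,
    ← B_eq_dotProduct, hv]
  norm_num

theorem refl_mul_refl {m : ℕ} {v : Fin (m + 2) → ℝ} (hv : B m v v = 1) :
    refl v * refl v = 1 := by
  apply Matrix.ext_of_mulVec_single
  intro i
  rw [← mulVec_mulVec, one_mulVec]
  simp only [refl_mulVec, map_sub, map_smul, smul_eq_mul, hv]
  module

/-- For vectors of equal norm, `2 B(x - y, x) = B(x - y, x - y)`, so the reflection in `x - y`
subtracts exactly `x - y` from `x`. Positivity lets `x - y` be normalised to a unit spacelike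
vector. -/
theorem exists_refl_mulVec {m : ℕ} {x y : Fin (m + 2) → ℝ} (h : B m x x = B m y y)
    (hxy : 0 < B m (x - y) (x - y)) :
    ∃ v, B m v v = 1 ∧ refl v *ᵥ x = y ∧ ∀ z, B m (x - y) z = 0 → refl v *ᵥ z = z := by
  set d := x - y with hd
  set s := √(B m d d) with hs
  have hs0 : s ≠ 0 := (Real.sqrt_pos.2 hxy).ne'
  have hss : s * s = B m d d := Real.mul_self_sqrt hxy.le
  refine ⟨s⁻¹ • d, ?_, ?_, ?_⟩
  · simp only [map_smul, LinearMap.smul_apply, smul_eq_mul, ← hss]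
    field_simp
  · have h2 : 2 * B m d x = s * s := by
      rw [hss, hd]
      simp only [map_sub, LinearMap.sub_apply, h, B_comm y x]
      ring
    rw [refl_mulVec, map_smul, LinearMap.smul_apply, smul_eq_mul, smul_smul]
    have : 2 * (s⁻¹ * B m d x) * s⁻¹ = 1 := by
      calc _ = s⁻¹ * s⁻¹ * (2 * B m d x) := by ring
        _ = 1 := by rw [h2]; field_simp
    rw [this, one_smul, hd, sub_sub_cancel]
  · intro z hz
    simp [refl_mulVec, hz]

/-- Products of reflections in unit spacelike vectors. -/
def IsReflProd {m : ℕ} (R : Mat m) : Prop :=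
  ∃ l : List (Fin (m + 2) → ℝ), (∀ v ∈ l, B m v v = 1) ∧ R = (l.map refl).prod

theorem IsReflProd.of_refl_mul {m : ℕ} {R : Mat m} {v : Fin (m + 2) → ℝ} (hv : B m v v = 1)
    (h : IsReflProd (refl v * R)) : IsReflProd R := by
  obtain ⟨l, hl, h⟩ := h
  refine ⟨v :: l, by simpa [hv] using hl, ?_⟩
  rw [List.map_cons, List.prod_cons, ← h, ← mul_assoc, refl_mul_refl hv, one_mul]

/-- Cartan–Dieudonné for maps fixing the time axis: as `k ≤ m + 1`, the timelike basis vector is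
always among the fixed ones. Each difference `R e - e` is then purely spatial, and the reflection in
it leaves the vectors already fixed in place. -/
theorem isReflProd_of_fixed {m : ℕ} (k : ℕ) (hk : k ≤ m + 1) {R : Mat m} (hR : IsOrth R)
    (h : ∀ j : Fin (m + 2), k ≤ j → R *ᵥ Pi.single j 1 = Pi.single j 1) : IsReflProd R := by
  induction k generalizing R with
  | zero =>
    refine ⟨[], by simp, ?_⟩
    apply Matrix.ext_of_mulVec_single
    intro j
    rw [h j (Nat.zero_le _), List.map_nil, List.prod_nil, one_mulVec]
  | succ k ih =>
    set e : Fin (m + 2) → ℝ := Pi.single ⟨k, by omega⟩ 1 with he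
    have hlt : ∀ j : Fin (m + 2), k ≤ j → ¬ k + 1 ≤ j → j = ⟨k, by omega⟩ := fun j h1 h2 =>
      Fin.ext (by simp; omega)
    by_cases hRe : R *ᵥ e = e
    · refine ih (by omega) hR fun j hj => ?_
      by_cases hj' : k + 1 ≤ j
      · exact h j hj'
      · rw [hlt j hj hj']; exact hRe
    · have horth : ∀ j : Fin (m + 2), k + 1 ≤ j → B m (R *ᵥ e - e) (Pi.single j 1) = 0 := by
        intro j hj
        rw [map_sub, LinearMap.sub_apply]
        nth_rewrite 1 [← h j hj]
        rw [B_mulVec_mulVec hR, sub_self]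
      have hz : (R *ᵥ e - e) (iz m) = 0 := by
        have := horth (iz m) (by simpa using hk)
        rw [B_single_right, sgn_iz] at this
        linarith
      have hpos : 0 < B m (R *ᵥ e - e) (R *ᵥ e - e) := by
        rw [B_split_last, hz, mul_zero, sub_zero]
        refine (Finset.sum_nonneg fun i _ => mul_self_nonneg _).lt_of_ne fun h0 => hRe ?_
        have h1 := (Finset.sum_eq_zero_iff_of_nonneg fun i _ => mul_self_nonneg _).1 h0.symm
        refine sub_eq_zero.1 (funext fun i => ?_)
        refine Fin.lastCases hz (fun i => ?_) i
        simpa using h1 i (Finset.mem_univ _)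
      obtain ⟨v, hv, hve, hvo⟩ := exists_refl_mulVec (B_mulVec_mulVec hR e e) hpos
      refine IsReflProd.of_refl_mul hv (ih (by omega) ((isOrth_refl hv).mul hR) fun j hj => ?_)
      rw [← mulVec_mulVec]
      by_cases hj' : k + 1 ≤ j
      · rw [h j hj', hvo _ (horth j hj')]
      · rw [hlt j hj hj']; exact hve

/-- Two distinct unit timelike vectors on the same sheet of the hyperboloid differ by a spacelike
vector, so one spacelike reflection reduces to the case of a fixed time axis. -/
theorem IsOrth.isReflProd {m : ℕ} {R : Mat m} (hR : IsOrth R) (h0 : 0 < R (iz m) (iz m)) :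
    IsReflProd R := by
  set e : Fin (m + 2) → ℝ := Pi.single (iz m) 1 with he
  have hiz : ∀ j : Fin (m + 2), m + 1 ≤ j → j = iz m := fun j hj => Fin.ext (by simp; omega)
  by_cases hRe : R *ᵥ e = e
  · exact isReflProd_of_fixed (m + 1) le_rfl hR fun j hj => by rw [hiz j hj]; exact hRe
  · have hBe : B m e e = -1 := by rw [he, B_single, sgn_iz]; simp
    have hBR : B m (R *ᵥ e) (R *ᵥ e) = -1 := by rw [B_mulVec_mulVec hR, hBe]
    have hBz : B m (R *ᵥ e) e = -R (iz m) (iz m) := by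
      rw [he, B_single_right, sgn_iz]; simp
    have hd : B m (R *ᵥ e - e) (R *ᵥ e - e) = -2 + 2 * R (iz m) (iz m) := by
      simp only [map_sub, LinearMap.sub_apply, hBe, hBR, hBz, B_comm e]
      ring
    have hpos : 0 < B m (R *ᵥ e - e) (R *ᵥ e - e) := by
      rw [hd]
      rw [B_split_last] at hBR
      have hz : (R *ᵥ e) (iz m) = R (iz m) (iz m) := by simp [he]
      rw [hz] at hBR
      have hs : 0 ≤ ∑ i : Fin (m + 1), (R *ᵥ e) i.castSucc * (R *ᵥ e) i.castSucc :=
        Finset.sum_nonneg fun i _ => mul_self_nonneg _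
      by_contra! hle
      have h1 : R (iz m) (iz m) = 1 := by nlinarith
      have hs0 : ∑ i : Fin (m + 1), (R *ᵥ e) i.castSucc * (R *ᵥ e) i.castSucc = 0 := by
        rw [h1] at hBR; linarith
      have h2 := (Finset.sum_eq_zero_iff_of_nonneg fun i _ => mul_self_nonneg _).1 hs0
      refine hRe (funext fun i => ?_)
      refine Fin.lastCases ?_ (fun i => ?_) i
      · rw [hz, h1]; simp [he]
      · have := mul_self_eq_zero.1 (h2 i (Finset.mem_univ _))
        rw [this, he, Pi.single_apply, if_neg (Fin.castSucc_lt_last i).ne]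
    obtain ⟨v, hv, hve, -⟩ := exists_refl_mulVec (B_mulVec_mulVec hR e e) hpos
    refine IsReflProd.of_refl_mul hv
      (isReflProd_of_fixed (m + 1) le_rfl ((isOrth_refl hv).mul hR) fun j hj => ?_)
    rw [hiz j hj, ← mulVec_mulVec]
    exact hve

/-! ### Surjectivity of the covering -/

theorem ι_mul_ι_refl {m : ℕ} {v : Fin (m + 2) → ℝ} (hv : B m v v = 1) (x : Fin (m + 2) → ℝ) :
    CliffordAlgebra.ι (Q m) v * CliffordAlgebra.ι (Q m) x =
      -(CliffordAlgebra.ι (Q m) (refl v *ᵥ x) * CliffordAlgebra.ι (Q m) v) := by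
  have h1 := CliffordAlgebra.ι_mul_ι_add_swap (Q := Q m) v x
  rw [polar_Q] at h1
  rw [refl_mulVec, map_sub, map_smul, sub_mul, smul_mul_assoc, CliffordAlgebra.ι_sq_scalar, Q_eq_B,
    hv, map_one, eq_sub_of_add_eq h1, Algebra.algebraMap_eq_smul_one]
  abel

/-- Untwisted conjugation by a unit spacelike vector is minus the reflection, and its spinor norm is
`-1`. Both signs depend only on the parity of the number of factors and disappear for even products.
-/
theorem exists_lipschitz_of_list {m : ℕ} (l : List (Fin (m + 2) → ℝ))
    (hl : ∀ v ∈ l, B m v v = 1) :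
    ∃ x : (CliffordAlgebra (Q m))ˣ, x ∈ lipschitzGroup (Q m) ∧
      star (x : CliffordAlgebra (Q m)) * x = (-1) ^ l.length ∧
      (x : CliffordAlgebra (Q m)) ∈ CliffordAlgebra.evenOdd (Q m) (l.length : ZMod 2) ∧
      ∀ u, (x : CliffordAlgebra (Q m)) * CliffordAlgebra.ι (Q m) u =
        (-1) ^ l.length * (CliffordAlgebra.ι (Q m) ((l.map refl).prod *ᵥ u) * x) := by
  induction l with
  | nil =>
    refine ⟨1, one_mem _, by simp, ?_, by simp⟩
    simpa using SetLike.one_mem_graded (CliffordAlgebra.evenOdd (Q m))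
  | cons v l ih =>
    obtain ⟨x, hx, hs, he, hc⟩ := ih fun w hw => hl w (List.mem_cons_of_mem _ hw)
    have hv : B m v v = 1 := hl v List.mem_cons_self
    have hvv : CliffordAlgebra.ι (Q m) v * CliffordAlgebra.ι (Q m) v = 1 := by
      rw [CliffordAlgebra.ι_sq_scalar, Q_eq_B, hv, map_one]
    let y : (CliffordAlgebra (Q m))ˣ := ⟨_, _, hvv, hvv⟩
    have hy : (y : CliffordAlgebra (Q m)) = CliffordAlgebra.ι (Q m) v := rfl
    refine ⟨y * x, mul_mem (Subgroup.subset_closure ⟨v, rfl⟩) hx, ?_, ?_, ?_⟩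
    · rw [Units.val_mul, star_mul, hy, CliffordAlgebra.star_ι, mul_assoc,
        ← mul_assoc (-CliffordAlgebra.ι (Q m) v), neg_mul, hvv, neg_mul, one_mul, mul_neg, hs,
        List.length_cons, pow_succ, mul_neg, mul_one]
    · rw [List.length_cons, Nat.cast_add, Nat.cast_one, add_comm (l.length : ZMod 2)]
      exact SetLike.mul_mem_graded (CliffordAlgebra.ι_mem_evenOdd_one _ v) he
    · intro u
      have hcomm : ∀ z : CliffordAlgebra (Q m), z * (-1) ^ l.length = (-1) ^ l.length * z :=
        fun z => ((Commute.neg_one_right z).pow_right _).eq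
      rw [Units.val_mul, hy, mul_assoc, hc, ← mul_assoc, hcomm, mul_assoc,
        ← mul_assoc _ _ (x : CliffordAlgebra (Q m)), ι_mul_ι_refl hv, List.map_cons,
        List.prod_cons, ← mulVec_mulVec, List.length_cons, pow_succ]
      simp only [mul_assoc, neg_mul, mul_neg, one_mul]

theorem exists_ρ_eq {m : ℕ} {R : Mat m} (hR : IsOrth R) (hdet : R.det = 1)
    (h0 : 0 < R (iz m) (iz m)) : ∃ x : G m, (ρ m x : Mat m) = R := by
  obtain ⟨l, hl, rfl⟩ := hR.isReflProd h0
  have hlen : Even l.length := by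
    have : ∀ l : List (Fin (m + 2) → ℝ), (∀ v ∈ l, B m v v = 1) →
        ((l.map refl).prod : Mat m).det = (-1) ^ l.length := by
      intro l hl
      induction l with
      | nil => simp
      | cons v l ih =>
        rw [List.map_cons, List.prod_cons, det_mul, det_refl (hl v List.mem_cons_self),
          ih fun w hw => hl w (List.mem_cons_of_mem _ hw), List.length_cons, pow_succ']
    rw [this l hl] at hdet
    exact (neg_one_pow_eq_one_iff_even (by norm_num)).1 hdet
  obtain ⟨x, hx, hs, he, hc⟩ := exists_lipschitz_of_list l hl
  rw [hlen.neg_one_pow] at hs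
  have hs' : star (x : CliffordAlgebra (Q m)) = ↑x⁻¹ := (Units.inv_eq_of_mul_eq_one_left hs).symm
  have hmem : (x : CliffordAlgebra (Q m)) ∈ spinGroup (Q m) := by
    refine ⟨⟨⟨x, hx, rfl⟩, hs, by rw [hs', Units.mul_inv]⟩, ?_⟩
    have : (l.length : ZMod 2) = 0 := (ZMod.natCast_eq_zero_iff_even).2 hlen
    rw [this] at he
    exact he
  refine ⟨⟨x, hmem⟩, ?_⟩
  apply Matrix.ext_of_mulVec_single
  intro i
  rw [ρ_mulVec]
  apply ι_injective m
  have hinv : (↑(⟨x, hmem⟩ : G m)⁻¹ : CliffordAlgebra (Q m)) = ↑x⁻¹ := hs'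
  rw [ι_vec, hinv, hc, hlen.neg_one_pow, one_mul, mul_assoc, Units.mul_inv, mul_one]

/-! ### The image of the covering lies in the identity component -/

theorem IsOrth.sum_sq_col {m : ℕ} {R : Mat m} (hR : IsOrth R) :
    ∑ i : Fin (m + 1), R i.castSucc (iz m) ^ 2 = R (iz m) (iz m) ^ 2 - 1 := by
  have h := B_mulVec_mulVec hR (Pi.single (iz m) 1) (Pi.single (iz m) 1)
  rw [B_split_last, B_single, sgn_iz] at h
  simp only [mulVec_single_one, col_apply, Pi.single_eq_same, mul_one] at h
  simp only [pow_two]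
  linarith

theorem IsOrth.sum_sq_row {m : ℕ} {R : Mat m} (hR : IsOrth R) :
    ∑ i : Fin (m + 1), R (iz m) i.castSucc ^ 2 = R (iz m) (iz m) ^ 2 - 1 := by
  have h := hR.adj.sum_sq_col
  simpa [adj_apply, sgn_iz, sgn_castSucc] using h

/-- Multiplicativity of time orientation: by Cauchy–Schwarz the spatial part of the corner entry of
`R * S` is strictly smaller in absolute value than the product of the two corner entries. -/
theorem IsOrth.mul_apply_last_pos {m : ℕ} {R S : Mat m} (hR : IsOrth R) (hS : IsOrth S) :
    0 < R (iz m) (iz m) * S (iz m) (iz m) * (R * S) (iz m) (iz m) := by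
  have h1 := hR.sum_sq_row
  have h2 := hS.sum_sq_col
  have h3 := Finset.sum_mul_sq_le_sq_mul_sq Finset.univ
    (fun i : Fin (m + 1) => R (iz m) i.castSucc) (fun i => S i.castSucc (iz m))
  have h5 : 0 ≤ ∑ i : Fin (m + 1), R (iz m) i.castSucc ^ 2 :=
    Finset.sum_nonneg fun i _ => sq_nonneg _
  have h6 : 0 ≤ ∑ i : Fin (m + 1), S i.castSucc (iz m) ^ 2 :=
    Finset.sum_nonneg fun i _ => sq_nonneg _
  rw [mul_apply, Fin.sum_univ_castSucc]
  rw [h1, h2] at h3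
  rw [h1] at h5
  rw [h2] at h6
  set s := ∑ i : Fin (m + 1), R (iz m) i.castSucc * S i.castSucc (iz m)
  set a := R (iz m) (iz m)
  set b := S (iz m) (iz m)
  have h4 : s ^ 2 < (a * b) ^ 2 := by nlinarith
  have h7 := sq_lt_sq.1 h4
  have h8 : 0 < |a * b| := (abs_nonneg _).trans_lt h7
  have h9 : |a * b * s| < |a * b| * |a * b| := by rw [abs_mul]; gcongr
  have h10 := (abs_lt.1 h9).1
  rw [abs_mul_abs_self] at h10
  nlinarith

theorem vector_conj_mulVec {m : ℕ} (v u : Fin (m + 2) → ℝ) :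
    ((2 / B m v v) • vecMulVec v (J m *ᵥ v) - 1) *ᵥ u = (2 * B m v u / B m v v) • v - u := by
  rw [sub_mulVec, one_mulVec, smul_mulVec, vecMulVec_mulVec, B_comm v u, B_eq_dotProduct u,
    dotProduct_comm u]
  ext i
  simp
  ring

theorem ι_mul_ι_eq {m : ℕ} {v : Fin (m + 2) → ℝ} (hv : B m v v ≠ 0) (u : Fin (m + 2) → ℝ) :
    CliffordAlgebra.ι (Q m) v * CliffordAlgebra.ι (Q m) u =
      CliffordAlgebra.ι (Q m) (((2 / B m v v) • vecMulVec v (J m *ᵥ v) - 1) *ᵥ u) *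
        CliffordAlgebra.ι (Q m) v := by
  have h1 := CliffordAlgebra.ι_mul_ι_add_swap (Q := Q m) v u
  rw [polar_Q] at h1
  rw [vector_conj_mulVec, map_sub, map_smul, sub_mul, smul_mul_assoc,
    CliffordAlgebra.ι_sq_scalar, Q_eq_B, eq_sub_of_add_eq h1, Algebra.algebraMap_eq_smul_one,
    Algebra.algebraMap_eq_smul_one, smul_smul, div_mul_cancel₀ _ hv]

/-- The spinor norm `c` is carried along because its sign is the time orientation of `R`, so `c = 1`
forces `R` into the identity component. On a generator `v`, `R` is minus a reflection, of
determinant one because `m + 2` is odd. -/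
theorem lipschitz_orientation {m : ℕ} (hm : Odd m) {x : (CliffordAlgebra (Q m))ˣ}
    (hx : x ∈ lipschitzGroup (Q m)) :
    ∃ (c : ℝ) (R : Mat m), IsOrth R ∧ R.det = 1 ∧ 0 < c * R (iz m) (iz m) ∧
      star (x : CliffordAlgebra (Q m)) * x = algebraMap ℝ _ c ∧
      ∀ u, (x : CliffordAlgebra (Q m)) * CliffordAlgebra.ι (Q m) u =
        CliffordAlgebra.ι (Q m) (R *ᵥ u) * x := by
  unfold lipschitzGroup at hx
  induction hx using Subgroup.closure_induction with
  | one =>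
    refine ⟨1, 1, isOrth_one, det_one, by simp, by simp, by simp⟩
  | mem x hx =>
    obtain ⟨v, hv⟩ := hx
    have hsq : (x : CliffordAlgebra (Q m)) * x = algebraMap ℝ _ (B m v v) := by
      rw [← hv, CliffordAlgebra.ι_sq_scalar, Q_eq_B]
    have h0 : B m v v ≠ 0 := by
      intro h
      rw [h, map_zero] at hsq
      exact (x * x).ne_zero hsq
    set R : Mat m := (2 / B m v v) • vecMulVec v (J m *ᵥ v) - 1 with hR
    have hRu : ∀ u, R *ᵥ u = (2 * B m v u / B m v v) • v - u := vector_conj_mulVec v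
    refine ⟨-B m v v, R, ?_, ?_, ?_, ?_, ?_⟩
    · rw [isOrth_iff]
      intro y z
      simp only [hRu, map_sub, map_smul, LinearMap.sub_apply, LinearMap.smul_apply, smul_eq_mul,
        B_comm y v]
      field_simp
      ring
    · have : R = -(1 + replicateCol Unit ((-2 / B m v v) • v) *
          replicateRow Unit (J m *ᵥ v)) := by
        rw [hR, ← vecMulVec_eq, smul_vecMulVec, neg_div, neg_smul]
        abel
      rw [this, det_neg, det_one_add_replicateCol_mul_replicateRow, dotProduct_comm,
        smul_dotProduct, ← B_eq_dotProduct, Fintype.card_fin, (hm.add_even even_two).neg_one_pow,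
        smul_eq_mul, div_mul_cancel₀ _ h0]
      norm_num
    · have : R (iz m) (iz m) = -(2 * v (iz m) ^ 2 / B m v v) - 1 := by
        simp [hR, vecMulVec_apply, J, mulVec_diagonal, sgn_iz]
        ring
      -- The right-hand side is the Euclidean square norm of `v`, positive whether `v` is spacelike
      -- or timelike.
      have h1 : -B m v v * R (iz m) (iz m) = 2 * v (iz m) ^ 2 + B m v v := by
        rw [this]; field_simp; ring
      rw [h1]
      have h2 := B_split_last v v
      have h3 : 0 ≤ ∑ i : Fin (m + 1), v i.castSucc * v i.castSucc :=
        Finset.sum_nonneg fun i _ => mul_self_nonneg _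
      refine lt_of_le_of_ne (by nlinarith) fun h => h0 ?_
      nlinarith
    · rw [← hv, CliffordAlgebra.star_ι, neg_mul, CliffordAlgebra.ι_sq_scalar, Q_eq_B, map_neg]
    · intro u
      rw [← hv]
      exact ι_mul_ι_eq h0 u
  | mul x y _ _ hx hy =>
    obtain ⟨c, R, h1, h2, h3, h4, h5⟩ := hx
    obtain ⟨d, S, k1, k2, k3, k4, k5⟩ := hy
    refine ⟨c * d, R * S, h1.mul k1, by rw [det_mul, h2, k2, one_mul], ?_, ?_, ?_⟩
    · have := h1.mul_apply_last_pos k1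
      have h6 := mul_pos h3 k3
      have h7 : 0 < (R (iz m) (iz m) * S (iz m) (iz m)) ^ 2 *
          (c * d * (R * S) (iz m) (iz m)) := by nlinarith [mul_pos this h6]
      exact pos_of_mul_pos_right h7 (sq_nonneg _)
    · rw [Units.val_mul, star_mul, mul_assoc, ← mul_assoc _ (x : CliffordAlgebra (Q m)), h4,
        Algebra.commutes, ← mul_assoc, k4, ← map_mul, mul_comm d]
    · intro u
      rw [Units.val_mul, mul_assoc, k5, ← mul_assoc, h5, mul_assoc, mulVec_mulVec]
  | inv x _ hx =>
    obtain ⟨c, R, h1, h2, h3, h4, h5⟩ := hx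
    have hc : c ≠ 0 := by rintro rfl; simp at h3
    refine ⟨c⁻¹, adj R, h1.adj, ?_, ?_, ?_, ?_⟩
    · have := congrArg Matrix.det h1.adj_mul
      rwa [det_mul, h2, mul_one, det_one] at this
    · have : adj R (iz m) (iz m) = R (iz m) (iz m) := by simp [adj_apply, sgn_iz]
      rw [this]
      have h6 : 0 < c ^ 2 := by positivity
      have h7 : c⁻¹ * R (iz m) (iz m) = c * R (iz m) (iz m) / c ^ 2 := by field_simp
      rw [h7]
      positivity
    · have h6 : star (x : CliffordAlgebra (Q m)) = algebraMap ℝ _ c * ↑x⁻¹ := by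
        rw [← h4, mul_assoc, Units.mul_inv, mul_one]
      have h7 : (x : CliffordAlgebra (Q m)) * star (x : CliffordAlgebra (Q m)) =
          algebraMap ℝ _ c := by
        rw [h6, ← mul_assoc, ← Algebra.commutes, mul_assoc, Units.mul_inv, mul_one]
      have h8 : (star (↑x⁻¹ : CliffordAlgebra (Q m)) * ↑x⁻¹) * algebraMap ℝ _ c = 1 := by
        rw [← h7, mul_assoc, ← mul_assoc _ (x : CliffordAlgebra (Q m)), Units.inv_mul, one_mul,
          ← star_mul, Units.mul_inv, star_one]
      calc star (↑x⁻¹ : CliffordAlgebra (Q m)) * ↑x⁻¹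
          = (star (↑x⁻¹ : CliffordAlgebra (Q m)) * ↑x⁻¹) * (algebraMap ℝ _ c *
            algebraMap ℝ _ c⁻¹) := by rw [← map_mul, mul_inv_cancel₀ hc, map_one, mul_one]
        _ = algebraMap ℝ _ c⁻¹ := by rw [← mul_assoc, h8, one_mul]
    · intro u
      have h6 := h5 (adj R *ᵥ u)
      rw [mulVec_mulVec, h1.mul_adj, one_mulVec] at h6
      calc (↑x⁻¹ : CliffordAlgebra (Q m)) * CliffordAlgebra.ι (Q m) u
          = ↑x⁻¹ * (CliffordAlgebra.ι (Q m) u * x) * ↑x⁻¹ := by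
            rw [mul_assoc, mul_assoc, Units.mul_inv, mul_one]
        _ = _ := by rw [← h6, ← mul_assoc, Units.inv_mul, one_mul]

theorem ρ_isOrth {m : ℕ} (x : G m) : IsOrth (ρ m x : Mat m) := ρ_orthogonal x

theorem ρ_det_and_orientation {m : ℕ} (hm : Odd m) (x : G m) :
    (ρ m x : Mat m).det = 1 ∧ 0 < (ρ m x : Mat m) (iz m) (iz m) := by
  obtain ⟨c, R, h1, h2, h3, h4, h5⟩ :=
    lipschitz_orientation hm (spinGroup.units_mem_lipschitzGroup (x := spinGroup.toUnits x) x.2)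
  have hs : star (x : CliffordAlgebra (Q m)) * x = 1 := spinGroup.star_mul_self_of_mem x.2
  have hc : c = 1 := by
    apply (algebraMap ℝ (CliffordAlgebra (Q m))).injective
    rw [map_one, ← hs]
    exact h4.symm
  have hR : (ρ m x : Mat m) = R := by
    apply Matrix.ext_of_mulVec_single
    intro i
    rw [ρ_mulVec]
    apply ι_injective m
    have hxx : (x : CliffordAlgebra (Q m)) * ↑x⁻¹ = 1 := spinGroup.mul_star_self_of_mem x.2
    have h6 : (x : CliffordAlgebra (Q m)) * CliffordAlgebra.ι (Q m) (Pi.single i 1) =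
        CliffordAlgebra.ι (Q m) (R *ᵥ Pi.single i 1) * x := h5 _
    rw [ι_vec, h6, mul_assoc, hxx, mul_one]
  rw [hR]
  refine ⟨h2, ?_⟩
  rwa [hc, one_mul] at h3

theorem ρ_inv {m : ℕ} (x : G m) : (↑(ρ m x)⁻¹ : Mat m) = adj (ρ m x : Mat m) := by
  have h := (ρ_isOrth x).adj_mul
  calc (↑(ρ m x)⁻¹ : Mat m) = adj (ρ m x : Mat m) * (ρ m x : Mat m) * (↑(ρ m x)⁻¹ : Mat m) := by
        rw [h, one_mul]
    _ = _ := by rw [mul_assoc, Units.mul_inv, mul_one]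

/-! ### The nilradical and the subgroup `M N` -/

/-- A vector of `ℝ^m`, extended by zero. -/
def pad {m : ℕ} (α : Fin m → ℝ) : Fin (m + 2) → ℝ :=
  Fin.snoc (α := fun _ => ℝ) (Fin.snoc (α := fun _ => ℝ) α 0) 0

theorem pad_ic {m : ℕ} (α : Fin m → ℝ) (i : Fin m) : pad α (ic i) = α i := by
  simp [pad]

theorem pad_ip {m : ℕ} (α : Fin m → ℝ) : pad α (ip m) = 0 := by
  rw [pad, ip, Fin.snoc_castSucc, Fin.snoc_last]

theorem pad_iz {m : ℕ} (α : Fin m → ℝ) : pad α (iz m) = 0 := by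
  simp [pad]

theorem v₀_ic {m : ℕ} (i : Fin m) : v₀ m (ic i) = 0 := by
  simp [-Fin.castSucc_inj, v₀, ic_ne_ip]

theorem v₀_ip (m : ℕ) : v₀ m (ip m) = 1 := by
  simp [v₀]

theorem v₀_iz (m : ℕ) : v₀ m (iz m) = 1 := by
  simp [v₀, (ip_ne_iz m).symm]

theorem B_v₀ {m : ℕ} (x : Fin (m + 2) → ℝ) : B m (v₀ m) x = x (ip m) - x (iz m) := by
  simp [B_split, v₀_ic, v₀_ip, v₀_iz]

theorem B_v₀_v₀ (m : ℕ) : B m (v₀ m) (v₀ m) = 0 := by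
  rw [B_v₀, v₀_ip, v₀_iz, sub_self]

theorem B_pad {m : ℕ} (α : Fin m → ℝ) (x : Fin (m + 2) → ℝ) :
    B m (pad α) x = ∑ i, α i * x (ic i) := by
  simp [-Fin.castSucc_inj, B_split, pad_ic, pad_ip, pad_iz]

theorem B_v₀_pad {m : ℕ} (α : Fin m → ℝ) : B m (v₀ m) (pad α) = 0 := by
  rw [B_v₀, pad_ip, pad_iz, sub_self]

theorem nil_mulVec {m : ℕ} (α : Fin m → ℝ) (x : Fin (m + 2) → ℝ) :
    nil α *ᵥ x = B m (pad α) x • v₀ m - B m (v₀ m) x • pad α := by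
  obtain ⟨h1, h2, h3, h4, h5, h6, h7, h8, h9⟩ := nil_apply α
  funext i
  rw [mulVec, dotProduct, sum_index, B_pad, B_v₀]
  revert i
  refine cases_index (fun i => ?_) ?_ ?_
  · simp only [h1, h2, h3, Pi.sub_apply, Pi.smul_apply, v₀_ic, pad_ic, smul_eq_mul, zero_mul,
      Finset.sum_const_zero]
    ring
  · simp only [h4, h6, h7, Pi.sub_apply, Pi.smul_apply, v₀_ip, pad_ip, smul_eq_mul]
    ring
  · simp only [h5, h8, h9, Pi.sub_apply, Pi.smul_apply, v₀_iz, pad_iz, smul_eq_mul]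
    ring

/-- The unipotent matrix `exp X_α`. -/
noncomputable def unip {m : ℕ} (α : Fin m → ℝ) : Mat m :=
  1 + nil α + (1 / 2 : ℝ) • (nil α * nil α)

theorem unip_mulVec {m : ℕ} (α : Fin m → ℝ) (x : Fin (m + 2) → ℝ) :
    unip α *ᵥ x = x + B m (pad α) x • v₀ m - B m (v₀ m) x • pad α -
      (1 / 2 * B m (v₀ m) x * B m (pad α) (pad α)) • v₀ m := by
  rw [unip, add_mulVec, add_mulVec, one_mulVec, smul_mulVec, ← mulVec_mulVec]
  simp only [nil_mulVec, map_sub, map_smul, B_comm (pad α) (v₀ m), B_v₀_pad, B_v₀_v₀, smul_eq_mul]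
  module

theorem isOrth_unip {m : ℕ} (α : Fin m → ℝ) : IsOrth (unip α) := by
  rw [isOrth_iff]
  intro x y
  simp only [unip_mulVec, map_sub, map_add, map_smul, LinearMap.sub_apply, LinearMap.add_apply,
    LinearMap.smul_apply, smul_eq_mul, B_comm (pad α) (v₀ m), B_v₀_pad, B_v₀_v₀,
    B_comm x (v₀ m), B_comm x (pad α)]
  ring

theorem pad_smul {m : ℕ} (c : ℝ) (α : Fin m → ℝ) : pad (c • α) = c • pad α := by
  funext i
  revert i
  refine cases_index (fun i => ?_) ?_ ?_ <;> simp [-Fin.castSucc_inj, pad_ic, pad_ip, pad_iz]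

theorem unip_smul_mul {m : ℕ} (s t : ℝ) (α : Fin m → ℝ) :
    unip (s • α) * unip (t • α) = unip ((s + t) • α) := by
  apply Matrix.ext_of_mulVec_single
  intro i
  rw [← mulVec_mulVec]
  simp only [unip_mulVec, pad_smul, map_sub, map_add, map_smul, LinearMap.smul_apply, smul_eq_mul,
    B_comm (pad α) (v₀ m), B_v₀_pad, B_v₀_v₀]
  module

theorem unip_zero {m : ℕ} : unip (0 : Fin m → ℝ) = 1 := by
  simp [unip, nil]

/-- A unipotent is the square of an orthogonal matrix, namely of the one with half the parameter. -/
theorem det_unip {m : ℕ} (α : Fin m → ℝ) : (unip α).det = 1 := by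
  have h := unip_smul_mul (1 / 2) (1 / 2) α
  norm_num at h
  rw [← h, det_mul, ← pow_two, (isOrth_unip _).det_sq]

/-- `N` fixes `v₀` and acts transitively on the isotropic vectors whose product with `v₀` is `2`.
One unipotent therefore matches `p` on the opposite isotropic vector `v₁`; the quotient fixes the
hyperbolic plane of `v₀` and `v₁` pointwise, hence lies in `M`. -/
theorem mem_P₁_of_mulVec_v₀ {m : ℕ} {p : GL (Fin (m + 2)) ℝ} (hp : IsOrth (p : Mat m))
    (hdet : (p : Mat m).det = 1) (hv : (p : Mat m) *ᵥ v₀ m = v₀ m) : p ∈ P₁ m := by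
  set v₁ : Fin (m + 2) → ℝ := Pi.single (ip m) 1 - Pi.single (iz m) 1 with hv₁
  have hv₁c : ∀ i : Fin m, v₁ (ic i) = 0 := fun i => by
    simp [-Fin.castSucc_inj, v₁, ic_ne_ip]
  have hv₁p : v₁ (ip m) = 1 := by simp [v₁]
  have hv₁z : v₁ (iz m) = -1 := by simp [v₁, (ip_ne_iz m).symm]
  set y := (p : Mat m) *ᵥ v₁ with hy
  have hy0 : y (ip m) - y (iz m) = 2 := by
    rw [← B_v₀, ← hv, hy, B_mulVec_mulVec hp, B_v₀, hv₁p, hv₁z]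
    norm_num
  have hyy : ∑ i : Fin m, y (ic i) * y (ic i) + y (ip m) * y (ip m) - y (iz m) * y (iz m) = 0 := by
    rw [← B_split, hy, B_mulVec_mulVec hp, B_split]
    simp [-Fin.castSucc_inj, hv₁c, hv₁p, hv₁z]
  -- As `B(v₀, v₁) = 2`, the unipotent with parameter `α` sends `v₁` to a vector with spatial part
  -- `-2 α`.
  set α : Fin m → ℝ := fun i => -(1 / 2) * y (ic i) with hα
  have hn : unip α *ᵥ v₁ = y := by
    have h1 : B m (pad α) v₁ = 0 := by rw [B_pad]; simp [-Fin.castSucc_inj, hv₁c]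
    have h2 : B m (v₀ m) v₁ = 2 := by rw [B_v₀, hv₁p, hv₁z]; norm_num
    have h3 : B m (pad α) (pad α) = 1 / 4 * ∑ i : Fin m, y (ic i) * y (ic i) := by
      rw [B_pad, Finset.mul_sum]
      refine Finset.sum_congr rfl fun i _ => ?_
      rw [pad_ic, hα]
      ring
    rw [unip_mulVec, h1, h2, h3]
    funext i
    revert i
    refine cases_index (fun i => ?_) ?_ ?_
    · simp only [Pi.sub_apply, Pi.add_apply, Pi.smul_apply, v₀_ic, pad_ic, hv₁c, smul_eq_mul, hα]
      ring
    · simp only [Pi.sub_apply, Pi.add_apply, Pi.smul_apply, v₀_ip, pad_ip, hv₁p, smul_eq_mul]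
      nlinarith
    · simp only [Pi.sub_apply, Pi.add_apply, Pi.smul_apply, v₀_iz, pad_iz, hv₁z, smul_eq_mul]
      nlinarith
  have hinv : unip α * unip (-α) = 1 ∧ unip (-α) * unip α = 1 := by
    have h1 := unip_smul_mul 1 (-1) α
    have h2 := unip_smul_mul (-1) 1 α
    norm_num [unip_zero] at h1 h2
    exact ⟨h1, h2⟩
  let n : GL (Fin (m + 2)) ℝ := ⟨unip α, unip (-α), hinv.1, hinv.2⟩
  let k : GL (Fin (m + 2)) ℝ := n⁻¹ * p
  have hpk : p = n * k := by simp [k]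
  have hkm : (k : Mat m) = unip (-α) * (p : Mat m) := rfl
  have hk : IsOrth (k : Mat m) := (isOrth_unip _).mul hp
  have hkdet : (k : Mat m).det = 1 := by rw [hkm, det_mul, det_unip, hdet, one_mul]
  have hkv₀ : (k : Mat m) *ᵥ v₀ m = v₀ m := by
    rw [hkm, ← mulVec_mulVec, hv, unip_mulVec, B_v₀_v₀, B_comm, B_v₀_pad]
    simp
  have hkv₁ : (k : Mat m) *ᵥ v₁ = v₁ := by
    rw [hkm, ← mulVec_mulVec, ← hy, ← hn, mulVec_mulVec, hinv.2, one_mulVec]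
  have hep : (Pi.single (ip m) 1 : Fin (m + 2) → ℝ) = (1 / 2 : ℝ) • (v₀ m + v₁) := by
    rw [v₀, hv₁]; module
  have hez : (Pi.single (iz m) 1 : Fin (m + 2) → ℝ) = (1 / 2 : ℝ) • (v₀ m - v₁) := by
    rw [v₀, hv₁]; module
  have hkp : (k : Mat m) *ᵥ Pi.single (ip m) 1 = Pi.single (ip m) 1 := by
    rw [hep, mulVec_smul, mulVec_add, hkv₀, hkv₁]
  have hkz : (k : Mat m) *ᵥ Pi.single (iz m) 1 = Pi.single (iz m) 1 := by
    rw [hez, mulVec_smul, mulVec_sub, hkv₀, hkv₁]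
  have hxp : ∀ x, ((k : Mat m) *ᵥ x) (ip m) = x (ip m) := by
    intro x
    have := B_mulVec_mulVec hk (Pi.single (ip m) 1) x
    rwa [hkp, B_single, B_single, sgn_ip, one_mul, one_mul] at this
  have hxz : ∀ x, ((k : Mat m) *ᵥ x) (iz m) = x (iz m) := by
    intro x
    have := B_mulVec_mulVec hk (Pi.single (iz m) 1) x
    rw [hkz, B_single, B_single, sgn_iz] at this
    linarith
  have hcol : ∀ i, (k : Mat m) i (iz m) = (Pi.single (iz m) 1 : Fin (m + 2) → ℝ) i := by
    intro i
    rw [← hkz]; simp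
  have hrow : ∀ i, (k : Mat m) (iz m) i = (Pi.single (iz m) 1 : Fin (m + 2) → ℝ) i := by
    intro i
    have := hxz (Pi.single i 1)
    rw [mulVec_single_one, col_apply] at this
    rw [this, Pi.single_apply, Pi.single_apply]
    simp only [eq_comm]
  have hadj : adj (k : Mat m) = (k : Mat m)ᵀ := by
    ext i j
    rw [adj_apply, transpose_apply]
    by_cases hi : i = iz m
    · rw [hi, hcol]
      by_cases hj : j = iz m <;> simp [hj, sgn_iz]
    · by_cases hj : j = iz m
      · rw [hj, hrow]; simp [hi]
      · simp [sgn, hi, hj]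
  have hkM : k ∈ M₁ m := by
    refine ⟨by rw [← hadj, hk.mul_adj], hkdet, by rw [hcol]; simp, fun i hi => ?_, ?_⟩
    · rw [hcol, hrow]; simp [hi]
    · have hH : ∀ x, H₀ m *ᵥ x = x (iz m) • Pi.single (ip m) 1 + x (ip m) • Pi.single (iz m) 1 := by
        intro x
        ext i
        simp [H₀, add_mulVec, single_mulVec, Function.update_apply, Pi.single_apply]
      apply Matrix.ext_of_mulVec_single
      intro i
      rw [← mulVec_mulVec, ← mulVec_mulVec, hH, hH, mulVec_add, mulVec_smul, mulVec_smul, hkp, hkz,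
        hxp, hxz]
  rw [hpk]
  exact mul_mem (Subgroup.subset_closure (Or.inr ⟨α, rfl⟩))
    (Subgroup.subset_closure (Or.inl (Or.inl hkM)))

/-! ### Duality -/

/-- The pairing of `X` with `𝔫` sees only `X v₀`; this is what turns membership in `𝔩*` into a
condition on `X v₀`. -/
theorem trace_mul_nil {m : ℕ} {X : Mat m} (hX : X ∈ 𝔤 m) (α : Fin m → ℝ) :
    1 / 2 * (X * nil α).trace = ∑ i, α i * (X *ᵥ v₀ m) (ic i) := by
  obtain ⟨h1, h2, h3, h4, h5, h6, h7, h8, h9⟩ := nil_apply α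
  have hg := mem_𝔤.1 hX
  simp only [Matrix.trace, diag_apply, mul_apply]
  simp only [sum_index, h1, h2, h3, h4, h5, h6, h7, h8, h9, mul_zero, Finset.sum_const_zero,
    zero_add, add_zero]
  rw [add_assoc, ← Finset.sum_add_distrib, ← Finset.sum_add_distrib, Finset.mul_sum]
  refine Finset.sum_congr rfl fun i _ => ?_
  have hp := hg (ic i) (ip m)
  have hz := hg (ic i) (iz m)
  rw [sgn_ic, sgn_ip] at hp
  rw [sgn_ic, sgn_iz] at hz
  rw [mulVec_v₀]
  linear_combination (-α i / 2) * hp + (α i / 2) * hz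

/-- The linear map `X ↦ tr (X ·) / 2` to the dual of `𝔭`. -/
noncomputable def toPDual (m : ℕ) : 𝔤 m →ₗ[ℝ] 𝔭Dual m where
  toFun X := res (toDual X)
  map_add' X Y := by
    ext Z
    change 1 / 2 * (((X : Mat m) + Y) * (Z : Mat m)).trace =
      1 / 2 * ((X : Mat m) * (Z : Mat m)).trace + 1 / 2 * ((Y : Mat m) * (Z : Mat m)).trace
    rw [add_mul, trace_add, mul_add]
  map_smul' c X := by
    ext Z
    change 1 / 2 * ((c • (X : Mat m)) * (Z : Mat m)).trace =
      c * (1 / 2 * ((X : Mat m) * (Z : Mat m)).trace)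
    rw [smul_mul_assoc, trace_smul, smul_eq_mul]
    ring

theorem toPDual_apply {m : ℕ} (X : 𝔤 m) (Z : 𝔭 m) :
    toPDual m X Z = 1 / 2 * ((X : Mat m) * (Z : Mat m)).trace := rfl

theorem nil_mem_𝔭 {m : ℕ} (α : Fin m → ℝ) : nil α ∈ 𝔭 m :=
  Submodule.mem_sup_right ⟨α, rfl⟩

theorem H₀_mem_𝔭 (m : ℕ) : H₀ m ∈ 𝔭 m :=
  Submodule.mem_sup_left (Submodule.mem_sup_right (Submodule.mem_span_singleton_self _))

theorem rot_mem_𝔭 {m : ℕ} (i j : Fin m) :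
    (single (ic i) (ic j) 1 - single (ic j) (ic i) 1 : Mat m) ∈ 𝔭 m := by
  refine Submodule.mem_sup_left (Submodule.mem_sup_left ⟨?_, fun k => ?_⟩)
  · rw [mem_𝔤]
    intro k l
    have hs : ∀ (a : Fin m) (k : Fin (m + 2)), ic a = k → sgn m k = 1 := by
      rintro a k rfl; exact sgn_ic a
    simp only [Matrix.sub_apply, single_apply]
    by_cases h1 : ic i = k ∧ ic j = l
    · rw [hs i k h1.1, hs j l h1.2]
      simp only [h1, and_self, if_true, and_comm]
      ring
    · by_cases h2 : ic j = k ∧ ic i = l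
      · rw [hs j k h2.1, hs i l h2.2]
        simp only [h2, and_self, if_true, and_comm]
        ring
      · have h3 : ¬ (ic i = l ∧ ic j = k) := fun h => h2 h.symm
        have h4 : ¬ (ic j = l ∧ ic i = k) := fun h => h1 h.symm
        rw [if_neg h1, if_neg h2, if_neg h3, if_neg h4]
        ring
  · simp [-Fin.castSucc_inj, ic_ne_ip]

/-- The annihilator of `𝔭` is its nilradical. Testing against `𝔫`, `H₀` and the rotations of `𝔪`
kills, in turn, the components of `X` opposite to `𝔫`, along `𝔞` and along `𝔪`. -/
theorem exists_eq_nil_of_toPDual {m : ℕ} {X : 𝔤 m} (h : toPDual m X = 0) :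
    ∃ β, (X : Mat m) = nil β := by
  have hZ : ∀ Z ∈ 𝔭 m, ((X : Mat m) * Z).trace = 0 := by
    intro Z hZ
    have := DFunLike.congr_fun h ⟨Z, hZ⟩
    rw [toPDual_apply] at this
    simpa using this
  have hg := mem_𝔤.1 X.2
  have hv : ∀ i, ((X : Mat m) *ᵥ v₀ m) (ic i) = 0 := by
    intro i
    have := trace_mul_nil X.2 (Pi.single i 1)
    rw [hZ _ (nil_mem_𝔭 _)] at this
    simpa [-Fin.castSucc_inj, Pi.single_apply] using this.symm
  simp only [mulVec_v₀] at hv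
  have hH : (X : Mat m) (iz m) (ip m) + (X : Mat m) (ip m) (iz m) = 0 := by
    have := hZ _ (H₀_mem_𝔭 m)
    rw [H₀, mul_add, trace_add] at this
    simpa [trace_mul_single] using this
  have hij : ∀ i j : Fin m, (X : Mat m) (ic j) (ic i) - (X : Mat m) (ic i) (ic j) = 0 := by
    intro i j
    have := hZ _ (rot_mem_𝔭 i j)
    rw [mul_sub, trace_sub] at this
    simpa [trace_mul_single] using this
  refine ⟨fun i => (X : Mat m) (ip m) (ic i), ?_⟩
  obtain ⟨h1, h2, h3, h4, h5, h6, h7, h8, h9⟩ :=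
    nil_apply fun i => (X : Mat m) (ip m) (ic i)
  ext i j
  revert i j
  have hpp := hg (ip m) (ip m)
  have hzz := hg (iz m) (iz m)
  have hpz := hg (ip m) (iz m)
  rw [sgn_ip] at hpp hpz
  rw [sgn_iz] at hzz hpz
  refine cases_index (fun i => cases_index (fun j => ?_) ?_ ?_)
    (cases_index (fun j => ?_) ?_ ?_) (cases_index (fun j => ?_) ?_ ?_)
  · have a := hij i j
    have b := hg (ic i) (ic j)
    rw [sgn_ic, sgn_ic] at b
    rw [h1]; linarith
  · have b := hg (ic i) (ip m)
    rw [sgn_ic, sgn_ip] at b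
    rw [h2]; linarith
  · have a := hv i
    have b := hg (ic i) (ip m)
    rw [sgn_ic, sgn_ip] at b
    rw [h3]; linarith
  · rw [h4]
  · rw [h6]; linarith
  · rw [h7]; linarith
  · have a := hv j
    have b := hg (ic j) (ip m)
    have c := hg (ic j) (iz m)
    rw [sgn_ic, sgn_ip] at b
    rw [sgn_ic, sgn_iz] at c
    rw [h5]; linarith
  · rw [h8]; linarith
  · rw [h9]; linarith

theorem transpose_mem_𝔤 {m : ℕ} {X : Mat m} (hX : X ∈ 𝔤 m) : Xᵀ ∈ 𝔤 m := by
  rw [mem_𝔤] at *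
  intro i j
  have := hX i j
  simp only [transpose_apply]
  have hi := sgn_mul_self i
  have hj := sgn_mul_self j
  linear_combination sgn m i * sgn m j * this - sgn m i * X i j * hj - sgn m j * X j i * hi

/-- `𝔤` is stable under transposition, and pairing a matrix with its own transpose gives a positive
definite form. -/
theorem toDual_injective (m : ℕ) : Function.Injective (toDual : 𝔤 m → 𝔤Dual m) := by
  intro X Y h
  have hd : (X : Mat m) - (Y : Mat m) ∈ 𝔤 m := sub_mem X.2 Y.2
  have h1 := DFunLike.congr_fun h ⟨_, transpose_mem_𝔤 hd⟩
  simp only [toDual_apply] at h1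
  have h2 : (((X : Mat m) - (Y : Mat m)) * ((X : Mat m) - (Y : Mat m))ᵀ).trace = 0 := by
    rw [sub_mul, trace_sub]; linarith
  have h3 := trace_mul_conjTranspose_self_eq_zero_iff (A := (X : Mat m) - (Y : Mat m))
  rw [conjTranspose_eq_transpose_of_trivial] at h3
  exact Subtype.ext (sub_eq_zero.1 (h3.1 h2))

/-- This supplies the linear section `𝔭* → 𝔤` from which the bound in the proof of weak properness
is computed. -/
theorem toPDual_surjective (m : ℕ) : Function.Surjective (toPDual m) := by
  let T : 𝔤 m →ₗ[ℝ] Module.Dual ℝ (𝔤 m) :=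
    { toFun := fun X => (toDual X : 𝔤 m →ₗ[ℝ] ℝ)
      map_add' := fun X Y => by
        ext Z
        change 1 / 2 * (((X : Mat m) + Y) * (Z : Mat m)).trace =
          1 / 2 * ((X : Mat m) * (Z : Mat m)).trace + 1 / 2 * ((Y : Mat m) * (Z : Mat m)).trace
        rw [add_mul, trace_add, mul_add]
      map_smul' := fun c X => by
        ext Z
        change 1 / 2 * ((c • (X : Mat m)) * (Z : Mat m)).trace =
          c * (1 / 2 * ((X : Mat m) * (Z : Mat m)).trace)
        rw [smul_mul_assoc, trace_smul, smul_eq_mul]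
        ring }
  have hT : Function.Surjective T := by
    refine (LinearMap.injective_iff_surjective_of_finrank_eq_finrank
      Subspace.dual_finrank_eq.symm).1 fun X Y h => toDual_injective m ?_
    exact ContinuousLinearMap.coe_injective h
  intro φ
  obtain ⟨r, hr⟩ := LinearMap.exists_leftInverse_of_injective
    (Submodule.inclusion (𝔭_le_𝔤 m)) (LinearMap.ker_eq_bot.2 (Submodule.inclusion_injective _))
  obtain ⟨X, hX⟩ := hT ((φ : 𝔭 m →ₗ[ℝ] ℝ) ∘ₗ r)
  refine ⟨X, ?_⟩
  ext Z
  have h1 := LinearMap.congr_fun hX (Submodule.inclusion (𝔭_le_𝔤 m) Z)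
  have h2 := LinearMap.congr_fun hr Z
  change toDual X (Submodule.inclusion (𝔭_le_𝔤 m) Z) =
    φ (r (Submodule.inclusion (𝔭_le_𝔤 m) Z)) at h1
  change r (Submodule.inclusion (𝔭_le_𝔤 m) Z) = Z at h2
  rw [h2] at h1
  exact h1

theorem smul_toDual {m : ℕ} (x : G m) (X : 𝔤 m) : x • toDual X = toDual (Ad x X) := by
  ext Y
  rw [coadjoint_apply, toDual_apply, toDual_apply, coe_Ad, coe_Ad, map_inv, inv_inv]
  congr 1
  rw [mul_assoc (ρ m x : Mat m), mul_assoc (ρ m x : Mat m), trace_mul_comm (ρ m x : Mat m)]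
  simp only [mul_assoc]

theorem mem_𝔩Dual_iff {m : ℕ} (X : 𝔤 m) :
    toPDual m X ∈ 𝔩Dual m ↔ ∀ i, ((X : Mat m) *ᵥ v₀ m) (ic i) = 0 := by
  constructor
  · intro h i
    have h1 := h ⟨nil (Pi.single i 1), nil_mem_𝔭 _⟩ ⟨_, rfl⟩
    rw [toPDual_apply, trace_mul_nil X.2] at h1
    simpa [-Fin.castSucc_inj, Pi.single_apply] using h1
  · rintro h Z ⟨α, hα⟩
    rw [toPDual_apply, hα, trace_mul_nil X.2]
    exact Finset.sum_eq_zero fun i _ => by rw [h, mul_zero]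

theorem depthOne_of_notMem {m : ℕ} {φ : 𝔭Dual m} (h : φ ∉ 𝔩Dual m) : DepthOne φ :=
  fun hs => h (hs (MulAction.mem_orbit_self φ))

/-! ### The matrix `t_a` -/

section Elliptic

variable {m n : ℕ} (h : 2 * n = m + 1) (a : Fin n → ℝ)

/-- The first coordinate of the `i`-th coordinate plane. -/
def ev (i : Fin n) : Fin (m + 2) := ⟨2 * i, by omega⟩

/-- The second coordinate of the `i`-th coordinate plane. -/
def od (i : Fin n) : Fin (m + 2) := ⟨2 * i + 1, by omega⟩

theorem plane_cases {p : Fin (m + 2) → Prop} (h0 : ∀ i, p (ev h i)) (h1 : ∀ i, p (od h i))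
    (hz : p (iz m)) (k : Fin (m + 2)) : p k := by
  by_cases hk : (k : ℕ) = m + 1
  · rwa [show k = iz m from Fin.ext hk]
  · rcases Nat.even_or_odd' (k : ℕ) with ⟨i, hi | hi⟩
    · rw [show k = ev h ⟨i, by omega⟩ from Fin.ext hi]; exact h0 _
    · rw [show k = od h ⟨i, by omega⟩ from Fin.ext hi]; exact h1 _

theorem ev_inj {i j : Fin n} : ev h i = ev h j ↔ i = j := by
  simp only [ev, Fin.ext_iff]; omega

theorem od_inj {i j : Fin n} : od h i = od h j ↔ i = j := by
  simp only [od, Fin.ext_iff]; omega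

theorem ev_ne_od (i j : Fin n) : ev h i ≠ od h j := by
  simp only [ev, od, ne_eq, Fin.ext_iff]; omega

theorem ev_ne_iz (i : Fin n) : ev h i ≠ iz m := by
  simp only [ev, ne_eq, Fin.ext_iff, Fin.val_last]; omega

theorem od_ne_iz (i : Fin n) : od h i ≠ iz m := by
  simp only [od, ne_eq, Fin.ext_iff, Fin.val_last]; omega

theorem sum_planes (F : Fin (m + 2) → ℝ) :
    ∑ k, F k = ∑ i, (F (ev h i) + F (od h i)) + F (iz m) := by
  let e : (Fin n ⊕ Fin n) ⊕ Unit → Fin (m + 2) :=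
    Sum.elim (Sum.elim (ev h) (od h)) fun _ => iz m
  have he : Function.Bijective e := by
    constructor
    · rintro ((i | i) | i) ((j | j) | j) hij
      · rw [(ev_inj h).1 hij]
      · exact absurd hij (ev_ne_od h i j)
      · exact absurd hij (ev_ne_iz h i)
      · exact absurd hij.symm (ev_ne_od h j i)
      · rw [(od_inj h).1 hij]
      · exact absurd hij (od_ne_iz h i)
      · exact absurd hij.symm (ev_ne_iz h j)
      · exact absurd hij.symm (od_ne_iz h j)
      · rfl
    · exact plane_cases h (fun i => ⟨.inl (.inl i), rfl⟩) (fun i => ⟨.inl (.inr i), rfl⟩)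
        ⟨.inr (), rfl⟩
  rw [← (Equiv.ofBijective e he).sum_comp, Fintype.sum_sum_type, Fintype.sum_sum_type,
    Finset.sum_add_distrib]
  simp [e]

theorem sgn_ev (i : Fin n) : sgn m (ev h i) = 1 := if_neg (ev_ne_iz h i)

theorem sgn_od (i : Fin n) : sgn m (od h i) = 1 := if_neg (od_ne_iz h i)

theorem B_planes (x y : Fin (m + 2) → ℝ) :
    B m x y = ∑ i, (x (ev h i) * y (ev h i) + x (od h i) * y (od h i)) -
      x (iz m) * y (iz m) := by
  rw [B_apply, sum_planes h]
  simp only [sgn_ev, sgn_od, sgn_iz]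
  ring_nf

theorem tMat_apply (j k : Fin (m + 2)) :
    tMat m a j k = ∑ i : Fin n, ((if (j : ℕ) = 2 * i ∧ (k : ℕ) = 2 * i + 1 then a i else 0) -
      (if (j : ℕ) = 2 * i + 1 ∧ (k : ℕ) = 2 * i then a i else 0)) := rfl

theorem tMat_mulVec_ev (x : Fin (m + 2) → ℝ) (i : Fin n) :
    (tMat m a *ᵥ x) (ev h i) = a i * x (od h i) := by
  have hz : tMat m a (ev h i) (iz m) = 0 := by
    rw [tMat_apply]
    refine Finset.sum_eq_zero fun k _ => ?_
    rw [if_neg (by simp [ev]; omega), if_neg (by simp [ev]; omega), sub_zero]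
  have he : ∀ j, tMat m a (ev h i) (ev h j) = 0 := by
    intro j
    rw [tMat_apply]
    refine Finset.sum_eq_zero fun k _ => ?_
    rw [if_neg (by simp [ev]; omega), if_neg (by simp [ev]; omega), sub_zero]
  have ho : ∀ j, tMat m a (ev h i) (od h j) = if j = i then a i else 0 := by
    intro j
    have : ∀ k : Fin n,
        ((if (ev h i : ℕ) = 2 * (k : ℕ) ∧ (od h j : ℕ) = 2 * k + 1 then a k else 0) -
        (if (ev h i : ℕ) = 2 * (k : ℕ) + 1 ∧ (od h j : ℕ) = 2 * k then a k else 0)) =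
        if k = i then (if j = i then a i else 0) else 0 := by
      intro k
      rw [if_neg (c := _ ∧ (od h j : ℕ) = 2 * k) (by simp [ev, od]; omega), sub_zero]
      by_cases hk : k = i
      · subst hk
        simp [ev, od, Fin.ext_iff]
      · rw [if_neg hk, if_neg]
        simp only [ev, Fin.ext_iff] at hk ⊢
        omega
    rw [tMat_apply]
    rw [Finset.sum_congr rfl fun k _ => this k]
    simp
  rw [mulVec, dotProduct, sum_planes h, hz]
  simp [he, ho]

theorem tMat_mulVec_od (x : Fin (m + 2) → ℝ) (i : Fin n) :
    (tMat m a *ᵥ x) (od h i) = -a i * x (ev h i) := by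
  -- Skewness moves the matrix onto the basis vector, whose image is given by the coordinates
  -- already computed.
  have h1 := B_mulVec_of_mem (tMat_mem m h.le a) (Pi.single (od h i) 1) x
  have h2 : ∀ y, B m (Pi.single (od h i) 1) y = y (od h i) := fun y => by
    rw [B_single, sgn_od, one_mul]
  rw [h2, B_planes h] at h1
  have h3 : (tMat m a *ᵥ Pi.single (od h i) 1) (iz m) = 0 := by
    rw [mulVec_single_one, col_apply]
    rw [tMat_apply]
    refine Finset.sum_eq_zero fun k _ => ?_
    rw [if_neg (by simp; omega), if_neg (by simp; omega), sub_zero]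
  have h4 : ∀ j, (tMat m a *ᵥ Pi.single (od h i) 1) (od h j) = 0 := by
    intro j
    rw [mulVec_single_one, col_apply]
    rw [tMat_apply]
    refine Finset.sum_eq_zero fun k _ => ?_
    rw [if_neg (by simp [od]; omega), if_neg (by simp [od]; omega), sub_zero]
  simp only [tMat_mulVec_ev, h3, h4, zero_mul, add_zero, sub_zero, Pi.single_apply, od_inj] at h1
  simp only [mul_ite, mul_one, mul_zero, ite_mul, zero_mul, Finset.sum_ite_eq', Finset.mem_univ,
    if_true] at h1
  linarith

theorem tMat_mulVec_iz (h : 2 * n = m + 1) (a : Fin n → ℝ) (x : Fin (m + 2) → ℝ) :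
    (tMat m a *ᵥ x) (iz m) = 0 := by
  rw [mulVec, dotProduct]
  refine Finset.sum_eq_zero fun l _ => ?_
  have : tMat m a (iz m) l = 0 := by
    rw [tMat_apply]
    refine Finset.sum_eq_zero fun k _ => ?_
    rw [if_neg (by simp; omega), if_neg (by simp; omega), sub_zero]
  rw [this, zero_mul]

theorem tMat_mulVec_single_iz (h : 2 * n = m + 1) (a : Fin n → ℝ) :
    tMat m a *ᵥ Pi.single (iz m) 1 = 0 := by
  funext k
  revert k
  refine plane_cases h (fun i => ?_) (fun i => ?_) ?_
  · rw [tMat_mulVec_ev, Pi.single_eq_of_ne (od_ne_iz h i), mul_zero, Pi.zero_apply]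
  · rw [tMat_mulVec_od, Pi.single_eq_of_ne (ev_ne_iz h i), mul_zero, Pi.zero_apply]
  · rw [tMat_mulVec_iz h, Pi.zero_apply]

theorem B_tMat_tMat (x : Fin (m + 2) → ℝ) :
    B m (tMat m a *ᵥ x) (tMat m a *ᵥ x) =
      ∑ i, a i ^ 2 * (x (ev h i) ^ 2 + x (od h i) ^ 2) := by
  rw [B_planes h, tMat_mulVec_iz h, mul_zero, sub_zero]
  refine Finset.sum_congr rfl fun i _ => ?_
  rw [tMat_mulVec_ev, tMat_mulVec_od]
  ring

theorem tMat_mulVec_ne_smul (h : 2 * n = m + 1) {a : Fin n → ℝ} (ha0 : ∀ i, a i ≠ 0)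
    {w : Fin (m + 2) → ℝ} (hw : B m w w = 0)
    (hw0 : w (iz m) ≠ 0) (c : ℝ) : tMat m a *ᵥ w ≠ c • w := by
  intro hc
  have h1 := congrFun hc (iz m)
  rw [tMat_mulVec_iz h, Pi.smul_apply, smul_eq_mul, eq_comm, mul_eq_zero, or_iff_left hw0] at h1
  rw [h1, zero_smul] at hc
  have h2 : ∀ i, w (od h i) = 0 := fun i => by
    have := congrFun hc (ev h i)
    rw [tMat_mulVec_ev] at this
    exact (mul_eq_zero.1 this).resolve_left (ha0 i)
  have h3 : ∀ i, w (ev h i) = 0 := fun i => by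
    have := congrFun hc (od h i)
    rw [tMat_mulVec_od] at this
    exact (mul_eq_zero.1 this).resolve_left (neg_ne_zero.2 (ha0 i))
  rw [B_planes h] at hw
  simp only [h2, h3, mul_zero, add_zero, Finset.sum_const_zero, zero_sub, neg_eq_zero,
    mul_self_eq_zero] at hw
  exact hw0 hw

/-! ### The resolvent of `t_a` -/

/-- On each coordinate plane the inverse is the transposed block divided by `l² + a i ²`. Its skew
part drops out of `B(w, y)`, so `l * B(w, y)` is a function of `l²` alone. -/
theorem exists_resolvent {l : ℝ} (hl : l ≠ 0) (w : Fin (m + 2) → ℝ) :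
    ∃ y, (l • (1 : Mat m) - tMat m a) *ᵥ y = w ∧
      l * B m w y = ∑ i, l ^ 2 / (l ^ 2 + a i ^ 2) * (w (ev h i) ^ 2 + w (od h i) ^ 2) -
        w (iz m) ^ 2 := by
  have hpos : ∀ i, l ^ 2 + a i ^ 2 ≠ 0 := fun i => by positivity
  have hex : ∃ y : Fin (m + 2) → ℝ,
      (∀ i, y (ev h i) = (l * w (ev h i) + a i * w (od h i)) / (l ^ 2 + a i ^ 2)) ∧
      (∀ i, y (od h i) = (l * w (od h i) - a i * w (ev h i)) / (l ^ 2 + a i ^ 2)) ∧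
      y (iz m) = w (iz m) / l := by
    refine ⟨∑ i, ((l * w (ev h i) + a i * w (od h i)) / (l ^ 2 + a i ^ 2)) • Pi.single (ev h i) 1 +
      ∑ i, ((l * w (od h i) - a i * w (ev h i)) / (l ^ 2 + a i ^ 2)) • Pi.single (od h i) 1 +
      (w (iz m) / l) • Pi.single (iz m) 1, fun i => ?_, fun i => ?_, ?_⟩
    · simp [Finset.sum_apply, Pi.single_apply, ev_inj, ev_ne_od, ev_ne_iz]
    · simp [Finset.sum_apply, Pi.single_apply, od_inj, (ev_ne_od h _ _).symm, od_ne_iz]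
    · simp [Finset.sum_apply, (ev_ne_iz h _).symm, (od_ne_iz h _).symm]
  obtain ⟨y, h1, h2, h3⟩ := hex
  refine ⟨y, ?_, ?_⟩
  · rw [sub_mulVec, smul_mulVec, one_mulVec]
    funext k
    rw [Pi.sub_apply, Pi.smul_apply, smul_eq_mul]
    revert k
    refine plane_cases h (fun i => ?_) (fun i => ?_) ?_
    · rw [tMat_mulVec_ev, h1, h2]
      have := hpos i
      field_simp
      ring
    · rw [tMat_mulVec_od, h1, h2]
      have := hpos i
      field_simp
      ring
    · rw [tMat_mulVec_iz h, h3]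
      field_simp
      ring
  · rw [B_planes h, mul_sub, Finset.mul_sum, h3]
    congr 1
    · refine Finset.sum_congr rfl fun i _ => ?_
      rw [h1, h2]
      have := hpos i
      field_simp
      ring
    · field_simp

theorem det_resolvent_ne_zero (h : 2 * n = m + 1) (a : Fin n → ℝ) {l : ℝ} (hl : l ≠ 0) :
    (l • (1 : Mat m) - tMat m a).det ≠ 0 := by
  have hs : Function.Surjective (l • (1 : Mat m) - tMat m a).mulVec := fun w =>
    (exists_resolvent h a hl w).imp fun y hy => hy.1
  exact ((isUnit_iff_isUnit_det _).1 (mulVec_surjective_iff_isUnit.1 hs)).ne_zero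

end Elliptic

/-! ### Bordered determinants -/

section Bordered

variable {k : Type*} [Fintype k] [DecidableEq k]

/-- The determinant of `M` bordered by the row `r` and the column `v`. -/
noncomputable def bordered (r v : k → ℝ) (M : Matrix k k ℝ) : ℝ :=
  (fromBlocks (0 : Matrix Unit Unit ℝ) (replicateRow Unit r) (replicateCol Unit v) M).det

/-- Column operations with `-y` clear the bordering column and leave `-(r ⬝ᵥ y)` in the corner. -/
theorem bordered_eq {r v y : k → ℝ} {M : Matrix k k ℝ} (hy : M *ᵥ y = v) :
    bordered r v M = -(r ⬝ᵥ y) * M.det := by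
  have h : fromBlocks (0 : Matrix Unit Unit ℝ) (replicateRow Unit r) (replicateCol Unit v) M *
      fromBlocks 1 0 (replicateCol Unit (-y)) 1 =
      fromBlocks (of fun _ _ => -(r ⬝ᵥ y)) (replicateRow Unit r) 0 M := by
    rw [fromBlocks_multiply]
    congr 1
    · ext i j
      simp [mul_apply, dotProduct]
    · simp
    · ext i j
      have := congrFun hy i
      rw [mulVec, dotProduct] at this
      simp [mul_apply, this]
    · simp
  have h2 := congrArg Matrix.det h
  rw [det_mul, det_fromBlocks_zero₁₂, det_fromBlocks_zero₂₁, det_one, det_one, mul_one,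
    mul_one] at h2
  rw [bordered, h2]
  simp

/-- The added terms are multiples of the bordering row and of the bordering column. -/
theorem bordered_add (r v b c : k → ℝ) (M : Matrix k k ℝ) :
    bordered r v (M + vecMulVec b r + vecMulVec v c) = bordered r v M := by
  have h : fromBlocks 1 0 (replicateCol Unit b) 1 *
      fromBlocks (0 : Matrix Unit Unit ℝ) (replicateRow Unit r) (replicateCol Unit v) M *
      fromBlocks 1 (replicateRow Unit c) 0 1 =
      fromBlocks (0 : Matrix Unit Unit ℝ) (replicateRow Unit r) (replicateCol Unit v)
        (M + vecMulVec b r + vecMulVec v c) := by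
    rw [fromBlocks_multiply, fromBlocks_multiply]
    congr 1
    · simp
    · simp
    · simp
    · ext i j
      simp [mul_apply, vecMulVec_apply]
      ring
  have h2 := congrArg Matrix.det h
  rw [det_mul, det_mul, det_fromBlocks_zero₁₂, det_fromBlocks_zero₂₁, det_one, det_one,
    mul_one, one_mul, mul_one] at h2
  exact h2.symm

end Bordered

/-- Each summand involves `v₀` or its dual covector, so a border by these two absorbs all of `𝔫`. -/
theorem nil_eq_vecMulVec {m : ℕ} (α : Fin m → ℝ) :
    nil α = vecMulVec (-pad α) (J m *ᵥ v₀ m) + vecMulVec (v₀ m) (J m *ᵥ pad α) := by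
  apply Matrix.ext_of_mulVec_single
  intro i
  rw [nil_mulVec, add_mulVec, vecMulVec_mulVec, vecMulVec_mulVec, B_comm, B_comm (v₀ m),
    B_eq_dotProduct, B_eq_dotProduct, dotProduct_comm, dotProduct_comm _ (J m *ᵥ v₀ m)]
  funext j
  simp
  ring

/-! ### Partial fractions -/

/-- Clearing denominators over the distinct poles gives a polynomial with infinitely many roots. Its
value at `-c` is the sum of the numerators over the pole `c`, up to a nonzero factor. -/
theorem sum_fiber_eq_zero_of_partial_fractions {ι : Type*} [Fintype ι] [DecidableEq ι]
    (b d : ι → ℝ) (hb : ∀ i, 0 < b i) (h : ∀ x : ℝ, 0 < x → ∑ i, d i / (x + b i) = 0) (c : ℝ) :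
    ∑ i with b i = c, d i = 0 := by
  classical
  by_cases hc : c ∈ Finset.univ.image b
  swap
  · refine Finset.sum_eq_zero fun i hi => absurd ?_ hc
    rw [← (Finset.mem_filter.1 hi).2]
    exact Finset.mem_image_of_mem _ (Finset.mem_univ i)
  set S := Finset.univ.image b with hS
  let p : Polynomial ℝ := ∑ i, Polynomial.C (d i) *
    ∏ e ∈ S.erase (b i), (Polynomial.X + Polynomial.C e)
  have heval : ∀ x, p.eval x = ∑ i, d i * ∏ e ∈ S.erase (b i), (x + e) := by
    intro x
    simp [p, Polynomial.eval_finsetSum, Polynomial.eval_prod]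
  have hp : p = 0 := by
    refine Polynomial.eq_zero_of_infinite_isRoot p ((Set.Ioi_infinite (0 : ℝ)).mono fun x hx => ?_)
    have hx : 0 < x := hx
    have hterm : ∀ i, d i * ∏ e ∈ S.erase (b i), (x + e) =
        (∏ e ∈ S, (x + e)) * (d i / (x + b i)) := by
      intro i
      have hi : b i ∈ S := Finset.mem_image_of_mem _ (Finset.mem_univ i)
      have := hb i
      rw [← Finset.mul_prod_erase S _ hi]
      field_simp
    change p.eval x = 0
    rw [heval, Finset.sum_congr rfl fun i _ => hterm i, ← Finset.mul_sum, h x hx, mul_zero]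
  have h1 := heval (-c)
  rw [hp, Polynomial.eval_zero] at h1
  have hterm : ∀ i, d i * ∏ e ∈ S.erase (b i), (-c + e) =
      if b i = c then d i * ∏ e ∈ S.erase c, (-c + e) else 0 := by
    intro i
    split_ifs with hi
    · rw [hi]
    · rw [Finset.prod_eq_zero (Finset.mem_erase.2 ⟨Ne.symm hi, hc⟩) (neg_add_cancel c), mul_zero]
  rw [Finset.sum_congr rfl fun i _ => hterm i, ← Finset.sum_filter, ← Finset.sum_mul] at h1
  refine (mul_eq_zero.1 h1.symm).resolve_right (Finset.prod_ne_zero_iff.2 fun e he => ?_)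
  rw [neg_add_eq_sub]
  exact sub_ne_zero.2 (Finset.ne_of_mem_erase he)

/-! ### Invariants of the pair of an orbit element and the isotropic line -/

/-- Both sides are read off from the determinant bordered by `v₀` and its dual covector, which the
change by `nil β` does not affect. The common factor is the determinant of `l - t`. -/
theorem resolvent_form_eq {m n : ℕ} (h : 2 * n = m + 1) (a : Fin n → ℝ) {R R' : Mat m}
    (hR : IsOrth R) (hR' : IsOrth R') {β : Fin m → ℝ}
    (hX : R' * tMat m a * adj R' = R * tMat m a * adj R + nil β) {l : ℝ} (hl : l ≠ 0)
    {y y' : Fin (m + 2) → ℝ} (hy : (l • (1 : Mat m) - tMat m a) *ᵥ y = adj R *ᵥ v₀ m)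
    (hy' : (l • (1 : Mat m) - tMat m a) *ᵥ y' = adj R' *ᵥ v₀ m) :
    B m (adj R *ᵥ v₀ m) y = B m (adj R' *ᵥ v₀ m) y' := by
  have key : ∀ {S : Mat m} (hS : IsOrth S) {z : Fin (m + 2) → ℝ},
      (l • (1 : Mat m) - tMat m a) *ᵥ z = adj S *ᵥ v₀ m →
      bordered (J m *ᵥ v₀ m) (v₀ m) (l • (1 : Mat m) - S * tMat m a * adj S) =
        -B m (adj S *ᵥ v₀ m) z * (l • (1 : Mat m) - tMat m a).det := by
    intro S hS z hz
    have hM : l • (1 : Mat m) - S * tMat m a * adj S =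
        S * (l • (1 : Mat m) - tMat m a) * adj S := by
      rw [mul_sub, sub_mul, mul_smul_comm, mul_one, smul_mul_assoc, hS.mul_adj]
    have hdet : (l • (1 : Mat m) - S * tMat m a * adj S).det =
        (l • (1 : Mat m) - tMat m a).det := by
      have := congrArg Matrix.det hS.mul_adj
      rw [det_mul, det_one] at this
      rw [hM, det_mul, det_mul]
      linear_combination (l • (1 : Mat m) - tMat m a).det * this
    rw [bordered_eq (y := S *ᵥ z), hdet, dotProduct_comm, ← B_eq_dotProduct, B_adj,
      B_comm]
    · rw [hM, mulVec_mulVec, mul_assoc, hS.adj_mul, mul_one, ← mulVec_mulVec, hz, mulVec_mulVec,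
        hS.mul_adj, one_mulVec]
  have h1 := key hR hy
  have h2 := key hR' hy'
  have h3 : l • (1 : Mat m) - R' * tMat m a * adj R' =
      l • (1 : Mat m) - R * tMat m a * adj R + vecMulVec (pad β) (J m *ᵥ v₀ m) +
        vecMulVec (v₀ m) (-(J m *ᵥ pad β)) := by
    rw [hX, nil_eq_vecMulVec, neg_vecMulVec, vecMulVec_neg]
    abel
  rw [h3, bordered_add, h1] at h2
  exact neg_injective (mul_right_cancel₀ (det_resolvent_ne_zero h a hl) h2)

/-- The invariants that separate the relevant pairs: the a priori weaker equality of resolvent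
functions already determines the norm of `w` on each eigenspace of `t²`. -/
theorem fiber_sums_eq {m n : ℕ} (h : 2 * n = m + 1) {a : Fin n → ℝ} (ha0 : ∀ i, a i ≠ 0)
    {R R' : Mat m} (hR : IsOrth R) (hR' : IsOrth R') {β : Fin m → ℝ}
    (hX : R' * tMat m a * adj R' = R * tMat m a * adj R + nil β)
    {w w' : Fin (m + 2) → ℝ} (hw : w = adj R *ᵥ v₀ m) (hw' : w' = adj R' *ᵥ v₀ m) :
    (∀ c, ∑ i with a i ^ 2 = c, ((w' (ev h i) ^ 2 + w' (od h i) ^ 2) -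
      (w (ev h i) ^ 2 + w (od h i) ^ 2)) = 0) ∧ w' (iz m) ^ 2 = w (iz m) ^ 2 := by
  set d : Fin n → ℝ := fun i => (w' (ev h i) ^ 2 + w' (od h i) ^ 2) -
      (w (ev h i) ^ 2 + w (od h i) ^ 2) with hd
  have hiso : ∀ {S : Mat m} (hS : IsOrth S), B m (adj S *ᵥ v₀ m) (adj S *ᵥ v₀ m) = 0 :=
    fun hS => by rw [B_mulVec_mulVec hS.adj, B_v₀_v₀]
  have hBw : ∀ u : Fin (m + 2) → ℝ, B m u u = 0 →
      ∑ i, (u (ev h i) ^ 2 + u (od h i) ^ 2) = u (iz m) ^ 2 := by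
    intro u hu
    rw [B_planes h] at hu
    simp only [pow_two]
    linarith
  have hs := hBw w (hw ▸ hiso hR)
  have hs' := hBw w' (hw' ▸ hiso hR')
  have hfib : ∀ c, ∑ i with a i ^ 2 = c, d i = 0 := by
    intro c
    have h1 := sum_fiber_eq_zero_of_partial_fractions (fun i => a i ^ 2) (fun i => d i * a i ^ 2)
      (fun i => by have := ha0 i; positivity) (fun x hx => ?_) c
    · have h2 : c * ∑ i with a i ^ 2 = c, d i = 0 := by
        rw [← h1, Finset.mul_sum]
        refine Finset.sum_congr rfl fun i hi => ?_
        rw [(Finset.mem_filter.1 hi).2, mul_comm]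
      rcases mul_eq_zero.1 h2 with rfl | h2
      · refine Finset.sum_eq_zero fun i hi => absurd (Finset.mem_filter.1 hi).2 ?_
        exact pow_ne_zero 2 (ha0 i)
      · exact h2
    -- Take `λ = √x`. Isotropy rewrites the time term as a sum over the planes, and `λ² / (λ² + a²)
    -- - 1 = -a² / (x + a²)` produces the numerators `d i * a i ^ 2`.
    · have hl : √x ≠ 0 := (Real.sqrt_pos.2 hx).ne'
      obtain ⟨y, hy, hy2⟩ := exists_resolvent h a hl w
      obtain ⟨y', hy', hy2'⟩ := exists_resolvent h a hl w'
      have h3 := resolvent_form_eq h a hR hR' hX hl (hw ▸ hy) (hw' ▸ hy')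
      rw [← hw, ← hw'] at h3
      rw [h3, hy2', Real.sq_sqrt hx.le, ← hs, ← hs', ← Finset.sum_sub_distrib,
        ← Finset.sum_sub_distrib] at hy2
      rw [← sub_eq_zero, ← Finset.sum_sub_distrib, ← neg_eq_zero, ← Finset.sum_neg_distrib] at hy2
      rw [← hy2]
      refine Finset.sum_congr rfl fun i _ => ?_
      have : x + a i ^ 2 ≠ 0 := by positivity
      simp only [hd]
      field_simp
      ring
  refine ⟨hfib, ?_⟩
  rw [← hs, ← hs', ← sub_eq_zero, ← Finset.sum_sub_distrib,
    ← Finset.sum_fiberwise_of_maps_to (g := fun i => a i ^ 2)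
      (fun i _ => Finset.mem_image_of_mem _ (Finset.mem_univ i))]
  exact Finset.sum_eq_zero fun c _ => hfib c

/-! ### Transitivity of the centralizer of `t_a` -/

open ComplexConjugate in
/-- A unitary matrix, block diagonal with respect to the fibres of `b`, that moves `x` to `y`. -/
theorem exists_unitary_mulVec_eq {ι : Type*} [Fintype ι] [DecidableEq ι] (b : ι → ℝ) (x y : ι → ℂ)
    (h : ∀ c, ∑ i with b i = c, (Complex.normSq (y i) - Complex.normSq (x i)) = 0) :
    ∃ U : Matrix ι ι ℂ, Uᴴ * U = 1 ∧ U *ᵥ x = y ∧ ∀ i j, b i ≠ b j → U i j = 0 := by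
  set u : ι → ℂ := x - y with hu
  set p : ℝ → ℂ := fun c => ∑ i with b i = c, conj (u i) * x i with hp
  set S : ℝ → ℂ := fun c => ∑ i with b i = c, conj (u i) * u i with hS
  have hpS : ∀ c, p c + conj (p c) = S c := by
    intro c
    have h1 : ((∑ i with b i = c, (Complex.normSq (y i) - Complex.normSq (x i)) : ℝ) : ℂ) = 0 := by
      rw [h, Complex.ofReal_zero]
    rw [Complex.ofReal_sum] at h1
    simp only [hp, hS, map_sum]
    rw [← Finset.sum_add_distrib, ← sub_eq_zero, ← Finset.sum_sub_distrib, ← neg_eq_zero, ← h1,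
      ← Finset.sum_neg_distrib]
    -- For equal norms, `2 Re ⟨u, x⟩ = ⟨u, u⟩` on each block, where `u = x - y`.
    refine Finset.sum_congr rfl fun i _ => ?_
    simp only [hu, Pi.sub_apply, map_mul, map_sub, Complex.conj_conj, Complex.ofReal_sub,
      Complex.normSq_eq_conj_mul_self]
    ring
  have hu0 : ∀ i, p (b i) = 0 → u i = 0 := by
    intro i hi
    have h1 := hpS (b i)
    rw [hi, map_zero, add_zero] at h1
    have h2 : ∑ j with b j = b i, Complex.normSq (u j) = 0 := by
      have : ((∑ j with b j = b i, Complex.normSq (u j) : ℝ) : ℂ) = 0 := by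
        rw [h1, Complex.ofReal_sum]
        exact Finset.sum_congr rfl fun j _ => Complex.normSq_eq_conj_mul_self
      exact_mod_cast this
    have h3 := (Finset.sum_eq_zero_iff_of_nonneg fun j _ => Complex.normSq_nonneg _).1 h2 i
      (by simp)
    exact Complex.normSq_eq_zero.1 h3
  -- On each block `1 - W` is a complex reflection: `W x = u` gives the image `y`, and the identity
  -- `p + conj p = S` makes it unitary. If `p` vanishes on a block then so does `u`, and the
  -- convention `0⁻¹ = 0` gives the identity there.
  let W : Matrix ι ι ℂ := of fun i j =>
    if b i = b j then u i * conj (u j) * (p (b i))⁻¹ else 0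
  have hW : Wᴴ * W = Wᴴ + W := by
    ext i j
    rw [mul_apply, Matrix.add_apply]
    simp only [conjTranspose_apply, W, of_apply]
    by_cases hij : b i = b j
    · have h1 : ∀ k, star (if b k = b i then u k * conj (u i) * (p (b k))⁻¹ else 0) *
          (if b k = b j then u k * conj (u j) * (p (b k))⁻¹ else 0) =
          if b k = b i then (conj (u k) * u k) * (u i * conj (u j) * conj (p (b i))⁻¹ *
            (p (b i))⁻¹) else 0 := by
        intro k
        rw [← hij]
        split_ifs with hk
        · simp only [Complex.star_def, map_mul, Complex.conj_conj, hk]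
          ring
        · simp
      rw [Finset.sum_congr rfl fun k _ => h1 k, ← Finset.sum_filter, ← Finset.sum_mul,
        if_pos hij.symm, if_pos hij, ← hij]
      change S (b i) * _ = _
      rw [← hpS]
      simp only [Complex.star_def, map_mul, Complex.conj_conj, map_inv₀]
      by_cases hpi : p (b i) = 0
      · simp [hpi]
      · have : conj (p (b i)) ≠ 0 := by simpa using hpi
        field_simp
    · rw [if_neg (Ne.symm hij), if_neg hij, star_zero, add_zero]
      refine Finset.sum_eq_zero fun k _ => ?_
      by_cases hk : b k = b i
      · rw [if_neg (hk ▸ hij : b k ≠ b j), mul_zero]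
      · rw [if_neg hk, star_zero, zero_mul]
  refine ⟨1 - W, ?_, ?_, ?_⟩
  · rw [conjTranspose_sub, conjTranspose_one, sub_mul, mul_sub, mul_sub, hW]
    simp
  · rw [sub_mulVec, one_mulVec]
    funext i
    have h1 : (W *ᵥ x) i = u i * (p (b i))⁻¹ * p (b i) := by
      rw [mulVec, dotProduct, hp]
      simp only [W, of_apply, ite_mul, zero_mul]
      rw [← Finset.sum_filter, Finset.mul_sum]
      refine Finset.sum_congr ?_ fun j _ => by ring
      ext j
      simp [eq_comm]
    rw [Pi.sub_apply, h1]
    by_cases hpi : p (b i) = 0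
    · have := hu0 i hpi
      rw [this, zero_mul, zero_mul, sub_zero]
      exact sub_eq_zero.1 this
    · rw [inv_mul_cancel_right₀ hpi, hu, Pi.sub_apply, sub_sub_cancel]
  · intro i j hij
    have : i ≠ j := fun h => hij (congrArg b h)
    simp [W, hij, this]

section Complexify

variable {m n : ℕ} (h : 2 * n = m + 1) (s : Fin n → ℝ)

/-- The coordinates `(x_{2j} + i s_j x_{2j+1})_j` and `x₀`. -/
def toCplx : (Fin (m + 2) → ℝ) →ₗ[ℝ] (Fin n → ℂ) × ℝ where
  toFun x := (fun j => ⟨x (ev h j), s j * x (od h j)⟩, x (iz m))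
  map_add' x y := by
    refine Prod.ext (funext fun j => Complex.ext ?_ ?_) ?_ <;> simp [mul_add]
  map_smul' c x := by
    refine Prod.ext (funext fun j => Complex.ext ?_ ?_) ?_ <;> simp [mul_left_comm]

theorem toCplx_injective (hs : ∀ j, s j ≠ 0) : Function.Injective (toCplx h s) := by
  rw [← LinearMap.ker_eq_bot, LinearMap.ker_eq_bot']
  intro x hx
  funext k
  revert k
  refine plane_cases h (fun j => ?_) (fun j => ?_) ?_
  · exact congrArg (fun q : (Fin n → ℂ) × ℝ => (q.1 j).re) hx
  · have : s j * x (od h j) = 0 := congrArg (fun q : (Fin n → ℂ) × ℝ => (q.1 j).im) hx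
    exact (mul_eq_zero.1 this).resolve_left (hs j)
  · exact congrArg Prod.snd hx

theorem finrank_cplx (h : 2 * n = m + 1) :
    Module.finrank ℝ (Fin (m + 2) → ℝ) = Module.finrank ℝ ((Fin n → ℂ) × ℝ) := by
  rw [Module.finrank_fintype_fun_eq_card, Fintype.card_fin, Module.finrank_prod,
    Module.finrank_pi_fintype]
  simp [Complex.finrank_real_complex]
  omega

/-- In suitable complex coordinates `t` acts by the scalars `-i |a j|`, so every unitary matrix that
preserves the blocks of constant `a j ^ 2` commutes with it; such matrices act transitively on each
product of spheres. -/
theorem exists_commuting_mulVec_eq {a : Fin n → ℝ} (ha0 : ∀ i, a i ≠ 0)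
    {w w' : Fin (m + 2) → ℝ}
    (hsum : ∀ c, ∑ i with a i ^ 2 = c, ((w' (ev h i) ^ 2 + w' (od h i) ^ 2) -
      (w (ev h i) ^ 2 + w (od h i) ^ 2)) = 0) (hz : w' (iz m) = w (iz m)) :
    ∃ K : Mat m, IsOrth K ∧ K.det = 1 ∧ 0 < K (iz m) (iz m) ∧
      K * tMat m a = tMat m a * K ∧ K *ᵥ w = w' := by
  -- The sign of `a i` selects the complex structure on the plane, so that planes with opposite `a
  -- i` fall in the same eigenspace.
  set s : Fin n → ℝ := fun i => a i / |a i| with hs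
  have habs : ∀ i, |a i| ≠ 0 := fun i => abs_ne_zero.2 (ha0 i)
  have hs0 : ∀ i, s i ≠ 0 := fun i => div_ne_zero (ha0 i) (habs i)
  have hss : ∀ i, s i * s i = 1 := fun i => by
    rw [hs]
    have := habs i
    field_simp
    rw [sq_abs]
  have hsa : ∀ i, s i * a i = |a i| := fun i => by
    rw [hs]
    have := habs i
    field_simp
    rw [sq_abs]
  let Φ : (Fin (m + 2) → ℝ) ≃ₗ[ℝ] (Fin n → ℂ) × ℝ :=
    LinearEquiv.ofInjectiveOfFinrankEq (toCplx h s) (toCplx_injective h s hs0) (finrank_cplx h)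
  have hΦ : ∀ x, Φ x = (fun j => ⟨x (ev h j), s j * x (od h j)⟩, x (iz m)) := fun x => rfl
  have hnorm : ∀ (x : Fin (m + 2) → ℝ) j,
      Complex.normSq ((Φ x).1 j) = x (ev h j) ^ 2 + x (od h j) ^ 2 := by
    intro x j
    rw [hΦ, Complex.normSq_mk]
    linear_combination x (od h j) ^ 2 * hss j
  obtain ⟨U, hU, hUx, hUb⟩ := exists_unitary_mulVec_eq (fun i => a i ^ 2) (Φ w).1 (Φ w').1
    (fun c => by simp only [hnorm]; exact hsum c)
  let F : ((Fin n → ℂ) × ℝ) →ₗ[ℝ] ((Fin n → ℂ) × ℝ) :=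
    LinearMap.prodMap (U.mulVecLin.restrictScalars ℝ) LinearMap.id
  let L : (Fin (m + 2) → ℝ) →ₗ[ℝ] (Fin (m + 2) → ℝ) := Φ.symm.toLinearMap ∘ₗ F ∘ₗ Φ.toLinearMap
  have hK : ∀ x, Φ (LinearMap.toMatrix' L *ᵥ x) = (U *ᵥ (Φ x).1, (Φ x).2) := by
    intro x
    rw [LinearMap.toMatrix'_mulVec]
    exact Φ.apply_symm_apply _
  have hB : ∀ x y, B m x y = (star (Φ x).1 ⬝ᵥ (Φ y).1).re - (Φ x).2 * (Φ y).2 := by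
    intro x y
    rw [B_planes h, dotProduct, Complex.re_sum, hΦ, hΦ]
    congr 1
    refine Finset.sum_congr rfl fun j _ => ?_
    simp only [Pi.star_apply, Complex.star_def, Complex.mul_re, Complex.conj_re, Complex.conj_im]
    linear_combination -x (od h j) * y (od h j) * hss j
  have hΦt : ∀ x, Φ (tMat m a *ᵥ x) = (fun j => -Complex.I * (|a j| : ℝ) * (Φ x).1 j, 0) := by
    intro x
    rw [hΦ, hΦ]
    refine Prod.ext (funext fun j => ?_) (tMat_mulVec_iz h a x)
    simp only [tMat_mulVec_ev, tMat_mulVec_od]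
    apply Complex.ext
    · simp
      rw [← hsa]
      linear_combination -a j * x (od h j) * hss j
    · simp
      rw [← hsa]
      ring
  refine ⟨LinearMap.toMatrix' L, ?_, ?_, ?_, ?_, ?_⟩
  · rw [isOrth_iff]
    intro x y
    rw [hB, hB, hK, hK]
    dsimp only
    rw [star_mulVec, ← dotProduct_mulVec, mulVec_mulVec, hU, one_mulVec]
  -- The real determinant of a complex linear map is the square modulus of its complex determinant.
  · rw [LinearMap.det_toMatrix']
    have h1 : LinearMap.det L = LinearMap.det F := LinearMap.det_conj F Φ.symm
    rw [h1, LinearMap.det_prodMap, LinearMap.det_restrictScalars, LinearMap.det_id, mul_one,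
      ← toLin'_apply', LinearMap.det_toLin', Algebra.norm_complex_apply]
    have h2 := congrArg Matrix.det hU
    rw [det_mul, det_conjTranspose, det_one, Complex.star_def, ← Complex.normSq_eq_conj_mul_self]
      at h2
    exact_mod_cast h2
  · have : LinearMap.toMatrix' L *ᵥ Pi.single (iz m) 1 = Pi.single (iz m) 1 := by
      apply Φ.injective
      have h1 : (Φ (Pi.single (iz m) 1)).1 = 0 := by
        rw [hΦ]
        funext j
        apply Complex.ext <;> simp [ev_ne_iz, od_ne_iz]
      rw [hK, h1, mulVec_zero, ← h1]
    have h1 := congrFun this (iz m)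
    rw [mulVec_single_one, col_apply, Pi.single_eq_same] at h1
    rw [h1]
    exact one_pos
  · apply Matrix.ext_of_mulVec_single
    intro k
    rw [← mulVec_mulVec, ← mulVec_mulVec]
    apply Φ.injective
    rw [hK, hΦt, hΦt, hK]
    refine Prod.ext (funext fun i => ?_) rfl
    simp only [mulVec, dotProduct, Finset.mul_sum]
    refine Finset.sum_congr rfl fun j _ => ?_
    by_cases hij : a i ^ 2 = a j ^ 2
    · rw [(sq_eq_sq_iff_abs_eq_abs _ _).1 hij]
      ring
    · rw [hUb i j hij]
      ring
  · apply Φ.injective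
    rw [hK, hUx]
    refine Prod.ext rfl ?_
    exact hz.symm

end Complexify

/-! ### The fibres of the moment map -/

theorem coe_Ad_eq {m : ℕ} (x : G m) (X : 𝔤 m) :
    (Ad x X : Mat m) = (ρ m x : Mat m) * (X : Mat m) * adj (ρ m x : Mat m) := by
  rw [coe_Ad, ρ_inv]

/-- `R⁻¹` preserves the future cone. Positivity removes the sign ambiguity in the equality of
squared time components. -/
theorem adj_mulVec_v₀_pos {m : ℕ} {R : Mat m} (hR : IsOrth R) (h0 : 0 < R (iz m) (iz m)) :
    0 < (adj R *ᵥ v₀ m) (iz m) := by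
  have h1 : (adj R *ᵥ v₀ m) (iz m) = R (iz m) (iz m) - R (ip m) (iz m) := by
    rw [mulVec_v₀, adj_apply, adj_apply, sgn_ip, sgn_iz]
    ring
  have h2 := hR.sum_sq_col
  have h3 : R (ip m) (iz m) ^ 2 ≤ ∑ i : Fin (m + 1), R i.castSucc (iz m) ^ 2 :=
    Finset.single_le_sum (f := fun i : Fin (m + 1) => R i.castSucc (iz m) ^ 2)
      (fun i _ => sq_nonneg _) (Finset.mem_univ (Fin.last m))
  rw [h1]
  nlinarith

theorem exists_P_smul_eq {m n : ℕ} (h : 2 * n = m + 1) {a : Fin n → ℝ} (ha0 : ∀ i, a i ≠ 0)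
    (x x' : G m) (hq : res (x • fElliptic m h.le a) = res (x' • fElliptic m h.le a)) :
    ∃ y : P m, (y : G m) • (x • fElliptic m h.le a) = x' • fElliptic m h.le a := by
  have hm : Odd m := ⟨n - 1, by omega⟩
  set T : 𝔤 m := ⟨tMat m a, tMat_mem m h.le a⟩ with hT
  have hf : fElliptic m h.le a = toDual T := rfl
  have hR := ρ_isOrth x
  have hR' := ρ_isOrth x'
  set R : Mat m := (ρ m x : Mat m) with hRdef
  set R' : Mat m := (ρ m x' : Mat m) with hRdef'
  rw [hf, smul_toDual, smul_toDual] at hq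
  have h1 : toPDual m (Ad x' T - Ad x T) = 0 := by
    rw [map_sub, sub_eq_zero]
    exact hq.symm
  obtain ⟨β, hβ⟩ := exists_eq_nil_of_toPDual h1
  have hX : R' * tMat m a * adj R' = R * tMat m a * adj R + nil β := by
    rw [← hβ, AddSubgroupClass.coe_sub, coe_Ad_eq, coe_Ad_eq]
    abel
  obtain ⟨hsum, hz⟩ := fiber_sums_eq h ha0 hR hR' hX rfl rfl
  have hz' := (sq_eq_sq₀ (adj_mulVec_v₀_pos hR' (ρ_det_and_orientation hm x').2).le
    (adj_mulVec_v₀_pos hR (ρ_det_and_orientation hm x).2).le).1 hz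
  obtain ⟨K, hK, hKdet, hK0, hKt, hKw⟩ := exists_commuting_mulVec_eq h ha0 hsum hz'
  obtain ⟨k, hk⟩ := exists_ρ_eq hK hKdet hK0
  -- It fixes `v₀`: `x⁻¹` takes `v₀` to `w`, `k` takes `w` to `w'`, and `x'` takes `w'` back to
  -- `v₀`.
  have hp : x' * k * x⁻¹ ∈ P m := by
    change ρ m (x' * k * x⁻¹) ∈ P₁ m
    refine mem_P₁_of_mulVec_v₀ (ρ_isOrth _) (ρ_det_and_orientation hm _).1 ?_
    rw [map_mul, map_mul, map_inv, Units.val_mul, Units.val_mul, ρ_inv, hk, ← hRdef, ← hRdef',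
      ← mulVec_mulVec, ← mulVec_mulVec, hKw, mulVec_mulVec, hR'.mul_adj, one_mulVec]
  refine ⟨⟨_, hp⟩, ?_⟩
  have hkf : k • toDual T = toDual T := by
    rw [smul_toDual]
    congr 1
    apply Subtype.ext
    rw [coe_Ad_eq, hk, hT, hKt, mul_assoc, hK.mul_adj, mul_one]
  change (x' * k * x⁻¹) • x • fElliptic m h.le a = _
  rw [hf, mul_smul, inv_smul_smul, mul_smul, hkf]

/-! ### Depth of the image -/

theorem B_v₀_mulVec_v₀ {m : ℕ} {X : Mat m} (hX : X ∈ 𝔤 m) : B m (v₀ m) (X *ᵥ v₀ m) = 0 := by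
  have h := B_mulVec_of_mem hX (v₀ m) (v₀ m)
  rw [B_comm] at h
  linarith

theorem q_smul_fElliptic {m n : ℕ} (h : 2 * n = m + 1) (a : Fin n → ℝ) (x : G m) :
    res (x • fElliptic m h.le a) = toPDual m (Ad x ⟨tMat m a, tMat_mem m h.le a⟩) := by
  rw [fElliptic, smul_toDual]
  rfl

theorem res_smul_fElliptic_notMem {m n : ℕ} (h : 2 * n = m + 1) {a : Fin n → ℝ}
    (ha0 : ∀ i, a i ≠ 0) (x : G m) : res (x • fElliptic m h.le a) ∉ 𝔩Dual m := by
  rw [q_smul_fElliptic h, mem_𝔩Dual_iff]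
  intro hv
  set X := Ad x ⟨tMat m a, tMat_mem m h.le a⟩ with hX
  have hR := ρ_isOrth x
  set R : Mat m := (ρ m x : Mat m) with hRdef
  have hXR : (X : Mat m) = R * tMat m a * adj R := coe_Ad_eq _ _
  have h1 := B_v₀_mulVec_v₀ X.2
  rw [B_v₀] at h1
  have h2 : (X : Mat m) *ᵥ v₀ m = ((X : Mat m) *ᵥ v₀ m) (iz m) • v₀ m := by
    funext k
    revert k
    refine cases_index (fun i => ?_) ?_ ?_
    · rw [hv, Pi.smul_apply, v₀_ic, smul_zero]
    · rw [Pi.smul_apply, v₀_ip, smul_eq_mul]; linarith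
    · rw [Pi.smul_apply, v₀_iz, smul_eq_mul, mul_one]
  refine tMat_mulVec_ne_smul h ha0 (w := adj R *ᵥ v₀ m) (by rw [B_mulVec_mulVec hR.adj, B_v₀_v₀])
    (adj_mulVec_v₀_pos hR (ρ_det_and_orientation ⟨n - 1, by omega⟩ x).2).ne'
    (((X : Mat m) *ᵥ v₀ m) (iz m)) ?_
  rw [← mulVec_smul, ← h2, hXR, mulVec_mulVec, mulVec_mulVec, mul_assoc R, ← mul_assoc (adj R),
    hR.adj_mul, one_mul]

/-! ### Bounds on the boost of an orbit element -/

/-- `B(x, x)` plus the squared time component is the Euclidean square norm of the spatial part, on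
which `t` is invertible; the constants are the extreme values of `a i ^ 2`. -/
theorem exists_tMat_bounds {m n : ℕ} (h : 2 * n = m + 1) {a : Fin n → ℝ} (ha0 : ∀ i, a i ≠ 0) :
    ∃ c C : ℝ, 0 < c ∧ 0 < C ∧ ∀ x : Fin (m + 2) → ℝ,
      c * (B m x x + x (iz m) ^ 2) ≤ B m (tMat m a *ᵥ x) (tMat m a *ᵥ x) ∧
      B m (tMat m a *ᵥ x) (tMat m a *ᵥ x) ≤ C * (B m x x + x (iz m) ^ 2) := by
  have : Nonempty (Fin n) := ⟨⟨0, by omega⟩⟩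
  obtain ⟨i, hi⟩ := Finite.exists_min fun i => a i ^ 2
  obtain ⟨j, hj⟩ := Finite.exists_max fun i => a i ^ 2
  have hi0 := ha0 i
  have hj0 := ha0 j
  have hB : ∀ x : Fin (m + 2) → ℝ, B m x x + x (iz m) ^ 2 =
      ∑ i, (x (ev h i) ^ 2 + x (od h i) ^ 2) := by
    intro x
    rw [B_planes h]
    simp only [pow_two]
    ring
  refine ⟨a i ^ 2, a j ^ 2, by positivity, by positivity, fun x => ⟨?_, ?_⟩⟩
  · rw [B_tMat_tMat h, hB, Finset.mul_sum]
    exact Finset.sum_le_sum fun k _ => mul_le_mul_of_nonneg_right (hi k) (by positivity)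
  · rw [B_tMat_tMat h, hB, Finset.mul_sum]
    exact Finset.sum_le_sum fun k _ => mul_le_mul_of_nonneg_right (hj k) (by positivity)

theorem conj_tMat_bounds {m n : ℕ} {a : Fin n → ℝ} {c C : ℝ}
    (hcC : ∀ x : Fin (m + 2) → ℝ,
      c * (B m x x + x (iz m) ^ 2) ≤ B m (tMat m a *ᵥ x) (tMat m a *ᵥ x) ∧
      B m (tMat m a *ᵥ x) (tMat m a *ᵥ x) ≤ C * (B m x x + x (iz m) ^ 2))
    {R : Mat m} (hR : IsOrth R) (x : Fin (m + 2) → ℝ) :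
    c * (B m x x + B m (R *ᵥ Pi.single (iz m) 1) x ^ 2) ≤
      B m ((R * tMat m a * adj R) *ᵥ x) ((R * tMat m a * adj R) *ᵥ x) ∧
    B m ((R * tMat m a * adj R) *ᵥ x) ((R * tMat m a * adj R) *ᵥ x) ≤
      C * (B m x x + B m (R *ᵥ Pi.single (iz m) 1) x ^ 2) := by
  have h1 := hcC (adj R *ᵥ x)
  have h2 : B m (R *ᵥ Pi.single (iz m) 1) x ^ 2 = (adj R *ᵥ x) (iz m) ^ 2 := by
    rw [B_adj, B_single, sgn_iz]
    ring
  rw [B_mulVec_mulVec hR.adj, ← h2, ← B_mulVec_mulVec hR (tMat m a *ᵥ _)] at h1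
  simpa only [mulVec_mulVec, mul_assoc] using h1

/-- The orthogonal projection of the `i`-th basis vector to the complement of `X v₀`. -/
noncomputable def perpVec {m : ℕ} (X : Mat m) (i : Fin m) : Fin (m + 2) → ℝ :=
  Pi.single (ic i) 1 - (B m (Pi.single (ic i) 1) (X *ᵥ v₀ m) /
    B m (X *ᵥ v₀ m) (X *ᵥ v₀ m)) • (X *ᵥ v₀ m)

/-- A bound for the square of the time component of `R e₀`, in terms of a representative `X` of
`R t_a R⁻¹` modulo `𝔫`. -/
noncomputable def boostBound {m : ℕ} (c C : ℝ) (X : Mat m) : ℝ :=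
  ((1 + (∑ i, B m (X *ᵥ perpVec X i) (X *ᵥ perpVec X i)) / c) ^ 2 * C /
    B m (X *ᵥ v₀ m) (X *ᵥ v₀ m) + B m (X *ᵥ v₀ m) (X *ᵥ v₀ m) / c) / 2

/-- The bounds for `Y = R t R⁻¹` at `v₀` enclose `B(u, v₀)²` between positive multiples of `B(X v₀,
X v₀)`. At the vectors `perpVec X i` they bound the first `m` components of `u`, and `B(u, u) = -1`
controls the remaining one. -/
theorem sq_le_boostBound {m n : ℕ} (h : 2 * n = m + 1) {a : Fin n → ℝ} {c C : ℝ} (hc : 0 < c)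
    (hC : 0 < C) (hcC : ∀ x : Fin (m + 2) → ℝ,
      c * (B m x x + x (iz m) ^ 2) ≤ B m (tMat m a *ᵥ x) (tMat m a *ᵥ x) ∧
      B m (tMat m a *ᵥ x) (tMat m a *ᵥ x) ≤ C * (B m x x + x (iz m) ^ 2))
    {R : Mat m} (hR : IsOrth R) {X : Mat m} {β : Fin m → ℝ}
    (hX : R * tMat m a * adj R = X + nil β) (hg : R * tMat m a * adj R ∈ 𝔤 m)
    (hb : 0 < B m (X *ᵥ v₀ m) (X *ᵥ v₀ m)) :
    R (iz m) (iz m) ^ 2 ≤ boostBound c C X := by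
  have hbd := conj_tMat_bounds hcC hR
  set Y : Mat m := R * tMat m a * adj R with hY
  set u : Fin (m + 2) → ℝ := R *ᵥ Pi.single (iz m) 1 with hu
  have hα : Y *ᵥ v₀ m = X *ᵥ v₀ m := by rw [hX, add_mulVec, nil_mulVec_v₀, add_zero]
  set α := X *ᵥ v₀ m with hαdef
  have hYu : Y *ᵥ u = 0 := by
    rw [hY, hu, mulVec_mulVec, mul_assoc, hR.adj_mul, mul_one, ← mulVec_mulVec,
      tMat_mulVec_single_iz h, mulVec_zero]
  have huα : B m u α = 0 := by
    have := B_mulVec_of_mem hg u (v₀ m)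
    rw [hYu, hα, map_zero, LinearMap.zero_apply] at this
    linarith
  have hv₀α : B m (v₀ m) α = 0 := by rw [← hα]; exact B_v₀_mulVec_v₀ hg
  have hv₀e : ∀ i : Fin m, B m (v₀ m) (Pi.single (ic i) 1) = 0 := fun i => by
    rw [B_single_right, v₀_ic, mul_zero]
  have hv₀x : ∀ i, B m (v₀ m) (perpVec X i) = 0 := fun i => by
    rw [perpVec, map_sub, map_smul, ← hαdef, hv₀e, hv₀α, smul_zero, sub_zero]
  have hαx : ∀ i, B m α (perpVec X i) = 0 := fun i => by
    rw [perpVec, map_sub, map_smul, ← hαdef, smul_eq_mul, div_mul_cancel₀ _ hb.ne', B_comm α,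
      sub_self]
  have hux : ∀ i, B m u (perpVec X i) = u (ic i) := fun i => by
    rw [perpVec, map_sub, map_smul, ← hαdef, huα, smul_zero, sub_zero, B_single_right, sgn_ic,
      one_mul]
  -- `X` and `Y` differ on `perpVec X i` by a multiple of `v₀`, which is isotropic and, as `perpVec
  -- X i` is orthogonal to `X v₀`, also orthogonal to `Y *ᵥ perpVec X i`. So this quantity depends
  -- only on the class modulo `𝔫`.
  have hγ : ∀ i, B m (X *ᵥ perpVec X i) (X *ᵥ perpVec X i) =
      B m (Y *ᵥ perpVec X i) (Y *ᵥ perpVec X i) := by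
    intro i
    have h1 : B m (v₀ m) (Y *ᵥ perpVec X i) = 0 := by
      have := B_mulVec_of_mem hg (v₀ m) (perpVec X i)
      rw [hα, hαx] at this
      linarith
    have h2 : X *ᵥ perpVec X i = Y *ᵥ perpVec X i - B m (pad β) (perpVec X i) • v₀ m := by
      rw [hX, add_mulVec, nil_mulVec, hv₀x, zero_smul, sub_zero, add_sub_cancel_right]
    rw [h2]
    simp only [map_sub, map_smul, LinearMap.sub_apply, LinearMap.smul_apply, h1, B_v₀_v₀,
      B_comm _ (v₀ m), smul_eq_mul]
    ring
  have hxx : ∀ i, 0 ≤ B m (perpVec X i) (perpVec X i) := by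
    intro i
    have h1 := hv₀x i
    rw [B_v₀] at h1
    rw [B_split, sub_eq_zero.1 h1, add_sub_cancel_right]
    exact Finset.sum_nonneg fun j _ => mul_self_nonneg _
  have hui : ∀ i, c * u (ic i) ^ 2 ≤ B m (X *ᵥ perpVec X i) (X *ᵥ perpVec X i) := by
    intro i
    have h1 := (hbd (perpVec X i)).1
    rw [hux, ← hγ] at h1
    have := mul_nonneg hc.le (hxx i)
    linarith
  set K := (∑ i, B m (X *ᵥ perpVec X i) (X *ᵥ perpVec X i)) / c with hK
  have hsum : ∑ i : Fin m, u (ic i) ^ 2 ≤ K := by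
    rw [hK, le_div_iff₀ hc, mul_comm, Finset.mul_sum]
    exact Finset.sum_le_sum fun i _ => hui i
  have hsum0 : 0 ≤ ∑ i : Fin m, u (ic i) ^ 2 := Finset.sum_nonneg fun i _ => sq_nonneg _
  obtain ⟨h1, h2⟩ := hbd (v₀ m)
  rw [hα, B_v₀_v₀, zero_add, B_comm u, B_v₀] at h1 h2
  set b := B m α α with hbdef
  have huu : ∑ i : Fin m, u (ic i) ^ 2 + u (ip m) ^ 2 - u (iz m) ^ 2 = -1 := by
    have : B m u u = -1 := by
      rw [hu, B_mulVec_mulVec hR, B_single, sgn_iz]; simp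
    rw [B_split] at this
    simpa only [pow_two] using this
  have huz : R (iz m) (iz m) = u (iz m) := by rw [hu]; simp
  rw [huz, boostBound, ← hK, ← hαdef, ← hbdef]
  have e1 : (u (ip m) - u (iz m)) ^ 2 ≤ b / c := by
    rw [le_div_iff₀ hc]; linarith
  have e2 : (u (ip m) + u (iz m)) ^ 2 ≤ (1 + K) ^ 2 * C / b := by
    rw [le_div_iff₀ hb]
    have e3 : (1 + ∑ i : Fin m, u (ic i) ^ 2) ^ 2 ≤ (1 + K) ^ 2 := by gcongr
    -- `B(u, u) = -1` fixes the product of the two light-cone coordinates, so a lower bound for one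
    -- bounds the other from above.
    have e4 : (u (ip m) + u (iz m)) ^ 2 * (u (ip m) - u (iz m)) ^ 2 =
        (1 + ∑ i : Fin m, u (ic i) ^ 2) ^ 2 := by
      rw [← mul_pow, ← neg_sq (1 + _)]
      congr 1
      linarith
    calc (u (ip m) + u (iz m)) ^ 2 * b ≤
        (u (ip m) + u (iz m)) ^ 2 * (C * (u (ip m) - u (iz m)) ^ 2) := by gcongr
      _ = (1 + ∑ i : Fin m, u (ic i) ^ 2) ^ 2 * C := by rw [← e4]; ring
      _ ≤ _ := by gcongr
  nlinarith

/-! ### Continuity -/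

theorem continuous_B {m : ℕ} {α : Type*} [TopologicalSpace α] {f g : α → Fin (m + 2) → ℝ}
    (hf : Continuous f) (hg : Continuous g) : Continuous fun p => B m (f p) (g p) := by
  simp only [B_apply]
  fun_prop

theorem continuous_boostBound {m : ℕ} {α : Type*} [TopologicalSpace α] (c C : ℝ) {f : α → Mat m}
    (hf : Continuous f) (h0 : ∀ p, B m (f p *ᵥ v₀ m) (f p *ᵥ v₀ m) ≠ 0) :
    Continuous fun p => boostBound c C (f p) := by
  have h1 : Continuous fun p => f p *ᵥ v₀ m := hf.matrix_mulVec continuous_const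
  have h2 := continuous_B h1 h1
  have h3 : ∀ i, Continuous fun p => perpVec (f p) i := fun i =>
    continuous_const.sub (((continuous_B continuous_const h1).div h2 h0).smul h1)
  have h4 : ∀ i, Continuous fun p => B m (f p *ᵥ perpVec (f p) i) (f p *ᵥ perpVec (f p) i) :=
    fun i => continuous_B (hf.matrix_mulVec (h3 i)) (hf.matrix_mulVec (h3 i))
  have h5 : Continuous fun p => ∑ i, B m (f p *ᵥ perpVec (f p) i) (f p *ᵥ perpVec (f p) i) :=
    continuous_finsetSum _ fun i _ => h4 i
  exact (((((continuous_const.add (h5.div_const c)).pow 2).mul continuous_const).div h2 h0).add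
    (h2.div_const c)).div_const 2

/-- The linear map `X ↦ tr (X ·) / 2` from all matrices to the dual of `𝔤`. -/
noncomputable def traceDual (m : ℕ) : Mat m →ₗ[ℝ] 𝔤Dual m where
  toFun X := ((1 / 2 : ℝ) • (Matrix.traceLinearMap (Fin (m + 2)) ℝ ℝ ∘ₗ
    LinearMap.mulLeft ℝ X ∘ₗ (𝔤 m).subtype)).toContinuousLinearMap
  map_add' X Y := by
    ext Z
    change 1 / 2 * ((X + Y) * (Z : Mat m)).trace =
      1 / 2 * (X * (Z : Mat m)).trace + 1 / 2 * (Y * (Z : Mat m)).trace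
    rw [add_mul, trace_add, mul_add]
  map_smul' c X := by
    ext Z
    change 1 / 2 * ((c • X) * (Z : Mat m)).trace = c * (1 / 2 * (X * (Z : Mat m)).trace)
    rw [smul_mul_assoc, trace_smul, smul_eq_mul]
    ring

theorem traceDual_apply {m : ℕ} (X : Mat m) (Z : 𝔤 m) :
    traceDual m X Z = 1 / 2 * (X * (Z : Mat m)).trace := rfl

/-- Restriction of functionals as a linear map. -/
noncomputable def resₗ (m : ℕ) : 𝔤Dual m →ₗ[ℝ] 𝔭Dual m where
  toFun := res
  map_add' _ _ := rfl
  map_smul' _ _ := rfl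

theorem continuous_traceDual (m : ℕ) : Continuous (traceDual m) :=
  LinearMap.continuous_of_finiteDimensional (E := Mat m) (F' := 𝔤Dual m) (traceDual m)

theorem continuous_res (m : ℕ) : Continuous (res : 𝔤Dual m → 𝔭Dual m) :=
  LinearMap.continuous_of_finiteDimensional (E := 𝔤Dual m) (F' := 𝔭Dual m) (resₗ m)

theorem smul_fElliptic {m n : ℕ} (h : 2 * n = m + 1) (a : Fin n → ℝ) (x : G m) :
    x • fElliptic m h.le a =
      traceDual m ((ρ m x : Mat m) * tMat m a * adj (ρ m x : Mat m)) := by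
  rw [fElliptic, smul_toDual, ← coe_Ad_eq x ⟨tMat m a, tMat_mem m h.le a⟩]
  rfl

theorem continuous_adj (m : ℕ) : Continuous (adj : Mat m → Mat m) :=
  (continuous_const.matrix_mul continuous_id.matrix_transpose).matrix_mul continuous_const

/-! ### Weak properness -/

/-- The corner entry dominates the last row, and each last-row entry then bounds its column through
the norm of that column. -/
theorem IsOrth.abs_apply_le {m : ℕ} {R : Mat m} (hR : IsOrth R) {D : ℝ}
    (hD : R (iz m) (iz m) ^ 2 ≤ D) (i j : Fin (m + 2)) : |R i j| ≤ 1 + D := by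
  have hrow : ∀ j, R (iz m) j ^ 2 ≤ R (iz m) (iz m) ^ 2 := by
    intro j
    refine Fin.lastCases le_rfl (fun j => ?_) j
    have h1 := hR.sum_sq_row
    have h2 := Finset.single_le_sum (f := fun j : Fin (m + 1) => R (iz m) j.castSucc ^ 2)
      (fun i _ => sq_nonneg _) (Finset.mem_univ j)
    beta_reduce at h2
    linarith
  have hcol : R i j ^ 2 ≤ 1 + D := by
    have h1 := B_mulVec_mulVec hR (Pi.single j 1) (Pi.single j 1)
    rw [B_split_last, B_single, mulVec_single_one] at h1
    simp only [col_apply, Pi.single_eq_same, mul_one, ← pow_two] at h1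
    have h3 : sgn m j ≤ 1 := by unfold sgn; split_ifs <;> norm_num
    have h4 := hrow j
    refine Fin.lastCases (by linarith) (fun i => ?_) i
    have h2 := Finset.single_le_sum (f := fun i : Fin (m + 1) => R i.castSucc j ^ 2)
      (fun i _ => sq_nonneg _) (Finset.mem_univ i)
    beta_reduce at h2
    linarith
  have hD0 : 0 ≤ D := (sq_nonneg _).trans hD
  refine abs_le_of_sq_le_sq (hcol.trans ?_) (by linarith)
  nlinarith

theorem isCompact_preimage_q {m n : ℕ} (h : 2 * n = m + 1) {a : Fin n → ℝ} (ha0 : ∀ i, a i ≠ 0)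
    {Ω : Set (𝔭Dual m)} (hΩ : IsCompact Ω) (hΩl : Ω ⊆ (𝔩Dual m)ᶜ) :
    IsCompact (q (fElliptic m h.le a) ⁻¹' Ω) := by
  have hm : Odd m := ⟨n - 1, by omega⟩
  obtain ⟨c, C, hc, hC, hcC⟩ := exists_tMat_bounds h ha0
  have hproj : Module.Projective ℝ (𝔭Dual m) := by
    have := Module.Free.of_divisionRing ℝ (𝔭Dual m)
    exact Module.Projective.of_free
  obtain ⟨σ, hσ⟩ := LinearMap.exists_rightInverse_of_surjective (toPDual m)
    (LinearMap.range_eq_top.2 (toPDual_surjective m))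
  have hσ' : ∀ p, toPDual m (σ p) = p := fun p => LinearMap.congr_fun hσ p
  have hσc : Continuous fun p : Ω => (σ p : Mat m) :=
    (LinearMap.continuous_of_finiteDimensional (E := 𝔭Dual m) (F' := Mat m)
      ((𝔤 m).subtype ∘ₗ σ)).comp continuous_subtype_val
  have hpos : ∀ p ∈ Ω, 0 < B m ((σ p : Mat m) *ᵥ v₀ m) ((σ p : Mat m) *ᵥ v₀ m) := by
    intro p hp
    have h1 := hΩl hp
    rw [Set.mem_compl_iff, ← hσ' p, mem_𝔩Dual_iff] at h1
    have h2 := B_v₀_mulVec_v₀ (σ p).2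
    rw [B_v₀] at h2
    rw [B_split, sub_eq_zero.1 h2, add_sub_cancel_right]
    refine (Finset.sum_nonneg fun i _ => mul_self_nonneg _).lt_of_ne fun h3 => h1 fun i => ?_
    exact mul_self_eq_zero.1 ((Finset.sum_eq_zero_iff_of_nonneg fun i _ => mul_self_nonneg _).1
      h3.symm i (Finset.mem_univ _))
  obtain ⟨D, hD⟩ : ∃ D, ∀ p ∈ Ω, boostBound c C (σ p : Mat m) ≤ D := by
    have : CompactSpace Ω := isCompact_iff_compactSpace.1 hΩ
    obtain ⟨D, hD⟩ := (isCompact_range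
      (continuous_boostBound c C hσc fun p => (hpos p p.2).ne')).bddAbove
    exact ⟨D, fun p hp => hD ⟨⟨p, hp⟩, rfl⟩⟩
  let Ψ : Mat m → 𝔤Dual m := fun R => traceDual m (R * tMat m a * adj R)
  have hΨ : Continuous Ψ := (continuous_traceDual m).comp
    ((continuous_id.matrix_mul continuous_const).matrix_mul (continuous_adj m))
  -- The weak inequality makes `S` closed; nothing is added, since the corner entry of an orthogonal
  -- matrix has square at least one.
  let S : Set (Mat m) := {R | (IsOrth R ∧ R.det = 1 ∧ 0 ≤ R (iz m) (iz m)) ∧ res (Ψ R) ∈ Ω}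
  have hSρ : ∀ {R}, R ∈ S → ∃ x : G m, (ρ m x : Mat m) = R := by
    rintro R ⟨⟨h1, h2, h3⟩, -⟩
    refine exists_ρ_eq h1 h2 (h3.lt_of_ne fun h4 => ?_)
    have h5 := h1.sum_sq_col
    rw [← h4] at h5
    have : 0 ≤ ∑ i : Fin (m + 1), R i.castSucc (iz m) ^ 2 :=
      Finset.sum_nonneg fun i _ => sq_nonneg _
    linarith
  have hSclosed : IsClosed S := by
    refine IsClosed.inter (IsClosed.inter ?_ (IsClosed.inter ?_ ?_))
      (hΩ.isClosed.preimage ((continuous_res m).comp hΨ))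
    · exact isClosed_eq ((continuous_id.matrix_transpose.matrix_mul continuous_const).matrix_mul
        continuous_id) continuous_const
    · exact isClosed_eq continuous_id.matrix_det continuous_const
    · exact isClosed_le continuous_const (continuous_id.matrix_elem _ _)
  have hScompact : IsCompact S := by
    have hbox : IsCompact (X := Mat m) (Set.univ.pi fun _ : Fin (m + 2) =>
        Set.univ.pi fun _ : Fin (m + 2) => Set.Icc (-(1 + D)) (1 + D)) :=
      isCompact_univ_pi fun _ => isCompact_univ_pi fun _ => isCompact_Icc
    refine hbox.of_isClosed_subset hSclosed fun (R : Mat m) hR => ?_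
    obtain ⟨x, hx⟩ := hSρ hR
    set X := Ad x ⟨tMat m a, tMat_mem m h.le a⟩ with hXdef
    have hX : (X : Mat m) = R * tMat m a * adj R := by rw [← hx]; exact coe_Ad_eq _ _
    set p := res (Ψ R) with hp
    have hpX : p = toPDual m X := by
      rw [hp, ← q_smul_fElliptic h, smul_fElliptic h, hx]
    obtain ⟨β, hβ⟩ : ∃ β, ((X - σ p : 𝔤 m) : Mat m) = nil β :=
      exists_eq_nil_of_toPDual (by rw [map_sub, hσ', hpX, sub_self])
    rw [AddSubgroupClass.coe_sub, sub_eq_iff_eq_add', hX] at hβ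
    have h1 := (sq_le_boostBound h hc hC hcC hR.1.1 hβ (hX ▸ X.2) (hpos p hR.2)).trans
      (hD p hR.2)
    exact fun i _ j _ => abs_le.1 (hR.1.1.abs_apply_le h1 i j)
  rw [Subtype.isCompact_iff]
  have himage : (Subtype.val '' (q (fElliptic m h.le a) ⁻¹' Ω)) = Ψ '' S := by
    ext φ
    constructor
    · rintro ⟨⟨_, x, rfl⟩, hx, rfl⟩
      have h1 : x • fElliptic m h.le a = Ψ (ρ m x : Mat m) := smul_fElliptic h a x
      have h2 := ρ_det_and_orientation hm x
      refine ⟨(ρ m x : Mat m), ⟨⟨ρ_isOrth x, h2.1, h2.2.le⟩, ?_⟩, h1.symm⟩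
      rw [← h1]
      exact hx
    · rintro ⟨R, hR, rfl⟩
      obtain ⟨x, rfl⟩ := hSρ hR
      have h1 : x • fElliptic m h.le a = Ψ (ρ m x : Mat m) := smul_fElliptic h a x
      refine ⟨⟨x • fElliptic m h.le a, x, rfl⟩, ?_, h1⟩
      change res (x • fElliptic m h.le a) ∈ Ω
      rw [h1]
      exact hR.2
  rw [himage]
  exact hScompact.image hΨ

/-! ### Boosts -/

/-- The element of `A₁` that scales `v₀` by `l`. -/
noncomputable def boost (m : ℕ) (l : ℝ) : Mat m :=
  1 + ((l + l⁻¹) / 2 - 1) • (single (ip m) (ip m) 1 + single (iz m) (iz m) 1) +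
    ((l - l⁻¹) / 2) • H₀ m

theorem boost_mulVec {m : ℕ} (l : ℝ) (x : Fin (m + 2) → ℝ) :
    (∀ i : Fin m, (boost m l *ᵥ x) (ic i) = x (ic i)) ∧
    (boost m l *ᵥ x) (ip m) = (l + l⁻¹) / 2 * x (ip m) + (l - l⁻¹) / 2 * x (iz m) ∧
    (boost m l *ᵥ x) (iz m) = (l - l⁻¹) / 2 * x (ip m) + (l + l⁻¹) / 2 * x (iz m) := by
  have h : ∀ i, (boost m l *ᵥ x) i = x i + ((l + l⁻¹) / 2 - 1) *
      ((if i = ip m then x (ip m) else 0) + if i = iz m then x (iz m) else 0) +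
      (l - l⁻¹) / 2 * ((if i = ip m then x (iz m) else 0) + if i = iz m then x (ip m) else 0) := by
    intro i
    simp [boost, H₀, add_mulVec, single_mulVec, Function.update_apply]
    split_ifs <;> ring
  refine ⟨fun i => ?_, ?_, ?_⟩
  · rw [h]
    simp only [ic_ne_ip, ic_ne_iz, if_false]
    ring
  · rw [h]
    simp only [ip_ne_iz, if_false, if_true]
    ring
  · rw [h]
    simp only [(ip_ne_iz m).symm, if_false, if_true]
    ring

theorem isOrth_boost {m : ℕ} {l : ℝ} (hl : l ≠ 0) : IsOrth (boost m l) := by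
  rw [isOrth_iff]
  intro x y
  obtain ⟨h1, h2, h3⟩ := boost_mulVec l x
  obtain ⟨k1, k2, k3⟩ := boost_mulVec l y
  rw [B_split, B_split, h2, h3, k2, k3]
  simp only [h1, k1]
  field_simp
  ring

theorem boost_mul_self {m : ℕ} {l : ℝ} (hl : l ≠ 0) : boost m l * boost m l = boost m (l * l) := by
  apply Matrix.ext_of_mulVec_single
  intro j
  rw [← mulVec_mulVec]
  generalize (Pi.single j 1 : Fin (m + 2) → ℝ) = x
  obtain ⟨h1, h2, h3⟩ := boost_mulVec l x
  obtain ⟨k1, k2, k3⟩ := boost_mulVec l (boost m l *ᵥ x)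
  obtain ⟨l1, l2, l3⟩ := boost_mulVec (l * l) x
  funext i
  revert i
  refine cases_index (fun i => ?_) ?_ ?_
  · rw [k1, h1, l1]
  · rw [k2, h2, h3, l2]; field_simp; ring
  · rw [k3, h2, h3, l3]; field_simp; ring

theorem det_boost {m : ℕ} {l : ℝ} (hl : 0 < l) : (boost m l).det = 1 := by
  have h := Real.sqrt_pos.2 hl
  rw [← Real.mul_self_sqrt hl.le, ← boost_mul_self h.ne', det_mul, ← pow_two,
    (isOrth_boost h.ne').det_sq]

theorem boost_apply_iz_pos {m : ℕ} {l : ℝ} (hl : 0 < l) : 0 < boost m l (iz m) (iz m) := by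
  have h := (boost_mulVec (m := m) l (Pi.single (iz m) 1)).2.2
  rw [mulVec_single_one, col_apply, Pi.single_eq_same, Pi.single_eq_of_ne (ip_ne_iz m)] at h
  rw [h]
  have := inv_pos.2 hl
  linarith

theorem boost_transpose {m : ℕ} (l : ℝ) : (boost m l)ᵀ = boost m l := by
  simp [boost, H₀, add_comm (single (iz m) (ip m) _)]

theorem boost_mulVec_v₀ {m : ℕ} (l : ℝ) : boost m l *ᵥ v₀ m = l • v₀ m := by
  obtain ⟨h1, h2, h3⟩ := boost_mulVec l (v₀ m)
  funext i
  revert i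
  refine cases_index (fun i => ?_) ?_ ?_
  · rw [h1, Pi.smul_apply, v₀_ic, smul_zero]
  · rw [h2, Pi.smul_apply, v₀_ip, v₀_iz, smul_eq_mul]; ring
  · rw [h3, Pi.smul_apply, v₀_ip, v₀_iz, smul_eq_mul]; ring

theorem boost_mulVec_eq_self {m : ℕ} (l : ℝ) {x : Fin (m + 2) → ℝ} (hp : x (ip m) = 0)
    (hz : x (iz m) = 0) : boost m l *ᵥ x = x := by
  obtain ⟨h1, h2, h3⟩ := boost_mulVec l x
  funext i
  revert i
  refine cases_index h1 ?_ ?_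
  · rw [h2, hp, hz]; ring
  · rw [h3, hp, hz]; ring

/-- `𝔫` is a root space of `𝔞`, here with the boost acting by `l`; transposing gives the opposite
root space and the factor `l⁻¹`. -/
theorem boost_mul_nil {m : ℕ} {l : ℝ} (hl : l ≠ 0) (α : Fin m → ℝ) :
    boost m l * nil α = l • (nil α * boost m l) := by
  apply Matrix.ext_of_mulVec_single
  intro j
  rw [smul_mulVec, ← mulVec_mulVec, ← mulVec_mulVec]
  generalize (Pi.single j 1 : Fin (m + 2) → ℝ) = x
  obtain ⟨h1, h2, h3⟩ := boost_mulVec l x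
  rw [nil_mulVec, nil_mulVec, mulVec_sub, mulVec_smul, mulVec_smul, boost_mulVec_v₀,
    boost_mulVec_eq_self l (pad_ip α) (pad_iz α), B_v₀, B_v₀, h2, h3, B_pad, B_pad]
  simp only [h1, smul_sub, smul_smul]
  congr 2
  · ring
  · field_simp
    ring

theorem boost_conj_nil {m : ℕ} {l : ℝ} (hl : l ≠ 0) (α : Fin m → ℝ) :
    boost m l * nil α * adj (boost m l) = l • nil α := by
  rw [boost_mul_nil hl, smul_mul_assoc, mul_assoc, (isOrth_boost hl).mul_adj, mul_one]

theorem boost_conj_nil_transpose {m : ℕ} {l : ℝ} (hl : l ≠ 0) (α : Fin m → ℝ) :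
    boost m l * (nil α)ᵀ * adj (boost m l) = l⁻¹ • (nil α)ᵀ := by
  have h := congrArg Matrix.transpose (boost_mul_nil hl α)
  rw [transpose_mul, transpose_smul, transpose_mul, boost_transpose] at h
  have h2 : boost m l * (nil α)ᵀ = l⁻¹ • ((nil α)ᵀ * boost m l) := by
    rw [h, smul_smul, inv_mul_cancel₀ hl, one_smul]
  rw [h2, smul_mul_assoc, mul_assoc, (isOrth_boost hl).mul_adj, mul_one]

theorem boost_conj_of_zero {m : ℕ} {l : ℝ} (hl : l ≠ 0) {Y : Mat m}
    (hY : ∀ i, Y i (ip m) = 0 ∧ Y (ip m) i = 0 ∧ Y i (iz m) = 0 ∧ Y (iz m) i = 0) :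
    boost m l * Y * adj (boost m l) = Y := by
  have h1 : ∀ Z : Mat m, (∀ i, Z (ip m) i = 0 ∧ Z (iz m) i = 0) → boost m l * Z = Z := by
    intro Z hZ
    apply Matrix.ext_of_mulVec_single
    intro j
    rw [← mulVec_mulVec, mulVec_single_one]
    exact boost_mulVec_eq_self l (hZ j).1 (hZ j).2
  have h2 : Y * boost m l = Y := by
    have := congrArg Matrix.transpose (h1 Yᵀ fun i => ⟨(hY i).1, (hY i).2.2.1⟩)
    rwa [transpose_mul, transpose_transpose, boost_transpose] at this
  calc boost m l * Y * adj (boost m l) = Y * boost m l * adj (boost m l) := by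
        rw [h1 Y fun i => ⟨(hY i).2.1, (hY i).2.2.2⟩, h2]
    _ = Y := by rw [mul_assoc, (isOrth_boost hl).mul_adj, mul_one]

/-! ### Failure of properness -/

theorem res_traceDual_nil {m : ℕ} (α : Fin m → ℝ) : res (traceDual m (nil α)) = 0 := by
  ext Z
  change 1 / 2 * (nil α * (Z : Mat m)).trace = 0
  obtain ⟨hZg, c, hc⟩ := mem_𝔭.1 Z.2
  rw [trace_mul_comm, trace_mul_nil hZg, hc]
  exact Finset.sum_eq_zero fun i _ => by rw [Pi.smul_apply, v₀_ic, smul_zero, mul_zero]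

/-- The components of `t` in `𝔫`, in its transpose and in the part fixed by boosts. -/
theorem exists_nil_decomposition {m n : ℕ} (h : 2 * n = m + 1) {a : Fin n → ℝ}
    (ha0 : ∀ i, a i ≠ 0) :
    ∃ (b : Fin m → ℝ) (Y : Mat m), nil b ≠ 0 ∧
      tMat m a = Y + (1 / 2 : ℝ) • nil b - (1 / 2 : ℝ) • (nil b)ᵀ ∧
      ∀ i, Y i (ip m) = 0 ∧ Y (ip m) i = 0 ∧ Y i (iz m) = 0 ∧ Y (iz m) i = 0 := by
  set b : Fin m → ℝ := fun i => tMat m a (ip m) (ic i) with hb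
  obtain ⟨h1, h2, h3, h4, h5, h6, h7, h8, h9⟩ := nil_apply b
  have hskew := mem_𝔤.1 (tMat_mem m h.le a)
  have hrow : ∀ i, tMat m a (iz m) i = 0 := fun i => by
    have := tMat_mulVec_iz h a (Pi.single i 1)
    rwa [mulVec_single_one, col_apply] at this
  have hcol : ∀ i, tMat m a i (iz m) = 0 := fun i => by
    have := congrFun (tMat_mulVec_single_iz h a) i
    rwa [mulVec_single_one, col_apply] at this
  have hpp : tMat m a (ip m) (ip m) = 0 := by
    have := hskew (ip m) (ip m)
    rw [sgn_ip] at this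
    linarith
  have hip : ∀ i : Fin m, tMat m a (ic i) (ip m) = -b i := fun i => by
    have := hskew (ic i) (ip m)
    rw [sgn_ip, sgn_ic] at this
    simp only [hb]
    linarith
  refine ⟨b, tMat m a - (1 / 2 : ℝ) • nil b + (1 / 2 : ℝ) • (nil b)ᵀ, ?_, by abel, ?_⟩
  · intro h0
    -- The last coordinate plane straddles the boundary: its second axis is the axis `ip m`, so `b`
    -- has the last of the `a i`, up to sign, as an entry.
    have e1 : ic (⟨m - 1, by omega⟩ : Fin m) = ev h ⟨n - 1, by omega⟩ :=
      Fin.ext (by simp [ev]; omega)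
    have e2 : ip m = od h ⟨n - 1, by omega⟩ := Fin.ext (by simp [od]; omega)
    have h10 := h4 ⟨m - 1, by omega⟩
    rw [h0, Matrix.zero_apply] at h10
    change 0 = tMat m a (ip m) (ic _) at h10
    have h11 := tMat_mulVec_od h a (Pi.single (ev h ⟨n - 1, by omega⟩) 1) ⟨n - 1, by omega⟩
    rw [mulVec_single_one, col_apply, ← e1, ← e2, ← h10, Pi.single_eq_same] at h11
    exact ha0 ⟨n - 1, by omega⟩ (by linarith)
  · have key : ∀ i j, (tMat m a - (1 / 2 : ℝ) • nil b + (1 / 2 : ℝ) • (nil b)ᵀ : Mat m) i j =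
        tMat m a i j - 1 / 2 * nil b i j + 1 / 2 * nil b j i := fun i j => rfl
    simp only [key, hrow, hcol]
    refine cases_index (fun i => ?_) ?_ ?_
    · simp only [h2, h3, h4, h5, hip]
      refine ⟨by ring, ?_, by ring, by ring⟩
      change b i - _ + _ = 0
      ring
    · simp only [h6, h7, h8, hpp]
      norm_num
    · simp only [h7, h8, h9, hrow, hcol]
      norm_num

theorem exists_isCompact_not_isCompact_preimage_q {m n : ℕ} (h : 2 * n = m + 1)
    {a : Fin n → ℝ} (ha0 : ∀ i, a i ≠ 0) :
    ∃ Ω : Set (𝔭Dual m), IsCompact Ω ∧ ¬ IsCompact (q (fElliptic m h.le a) ⁻¹' Ω) := by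
  obtain ⟨b, Y, hb, hdec, hY⟩ := exists_nil_decomposition h ha0
  -- The images of the boosted elements, with `τ = l⁻¹`; the endpoint `τ = 0` is included to make
  -- the path compact.
  let γ : ℝ → 𝔭Dual m := fun τ =>
    res (traceDual m (Y - τ • ((1 / 2 : ℝ) • (nil b)ᵀ)))
  have hγ : Continuous γ := (continuous_res m).comp ((continuous_traceDual m).comp
    (continuous_const.sub (continuous_id.smul continuous_const)))
  refine ⟨γ '' Set.Icc 0 1, isCompact_Icc.image hγ, fun hcomp => ?_⟩
  let Z : 𝔤 m := ⟨(nil b)ᵀ, transpose_mem_𝔤 (nil_mem b)⟩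
  -- Pairing with the transpose of `nil b` detects the growth along `nil b`, the coefficient being
  -- its positive Frobenius norm squared.
  have hev : Continuous fun φ : Orb (fElliptic m h.le a) => (φ : 𝔤Dual m) Z :=
    (LinearMap.continuous_of_finiteDimensional (E := 𝔤Dual m) (F' := ℝ)
      { toFun := fun φ : 𝔤Dual m => φ Z
        map_add' := fun _ _ => rfl
        map_smul' := fun _ _ => rfl : 𝔤Dual m →ₗ[ℝ] ℝ }).comp continuous_subtype_val
  obtain ⟨D, hD⟩ := (hcomp.image hev).bddAbove
  set κ := (nil b * (nil b)ᵀ).trace with hκ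
  have hκ0 : 0 < κ := by
    have h1 : κ ≠ 0 := fun h0 => hb (by
      have := trace_mul_conjTranspose_self_eq_zero_iff (A := nil b)
      rw [conjTranspose_eq_transpose_of_trivial] at this
      exact this.1 h0)
    refine lt_of_le_of_ne ?_ h1.symm
    simp only [hκ, Matrix.trace, diag_apply, mul_apply, transpose_apply]
    exact Finset.sum_nonneg fun i _ => Finset.sum_nonneg fun j _ => mul_self_nonneg _
  set A := (Y * (nil b)ᵀ).trace with hA
  set E := ((nil b)ᵀ * (nil b)ᵀ).trace with hE
  have hbound : ∀ l : ℝ, 1 ≤ l → 1 / 2 * (A + l / 2 * κ - l⁻¹ / 2 * E) ≤ D := by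
    intro l hl
    have hl0 : 0 < l := one_pos.trans_le hl
    obtain ⟨x, hx⟩ := exists_ρ_eq (isOrth_boost (m := m) hl0.ne') (det_boost hl0)
      (boost_apply_iz_pos hl0)
    have hconj : boost m l * tMat m a * adj (boost m l) =
        Y - l⁻¹ • ((1 / 2 : ℝ) • (nil b)ᵀ) + (l / 2) • nil b := by
      rw [hdec, mul_sub, mul_add, sub_mul, add_mul, mul_smul_comm, mul_smul_comm, smul_mul_assoc,
        smul_mul_assoc, boost_conj_of_zero hl0.ne' hY, boost_conj_nil hl0.ne',
        boost_conj_nil_transpose hl0.ne']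
      module
    have hf := smul_fElliptic h a x
    rw [hx, hconj] at hf
    refine hD ⟨⟨x • fElliptic m h.le a, x, rfl⟩, ⟨l⁻¹, ⟨by positivity, inv_le_one_of_one_le₀ hl⟩,
      ?_⟩, ?_⟩
    · change _ = res (x • fElliptic m h.le a)
      rw [hf, map_add, map_smul]
      change _ = resₗ m (_ + (l / 2) • traceDual m (nil b))
      rw [map_add, map_smul]
      change _ = _ + (l / 2) • res (traceDual m (nil b))
      rw [res_traceDual_nil, smul_zero, add_zero]
      rfl
    · change (x • fElliptic m h.le a) Z = _
      rw [hf, traceDual_apply]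
      change 1 / 2 * ((Y - l⁻¹ • ((1 / 2 : ℝ) • (nil b)ᵀ) + (l / 2) • nil b) * (nil b)ᵀ).trace = _
      rw [add_mul, sub_mul, trace_add, trace_sub, smul_mul_assoc, smul_mul_assoc, smul_mul_assoc,
        trace_smul, trace_smul, trace_smul, ← hA, ← hκ, ← hE]
      simp only [smul_eq_mul]
      ring
  set M := |D| + |A| + |E| with hM
  have hM0 : 0 ≤ M := by positivity
  -- For this `l` the growing term `l / 2 * κ` equals `κ / 2 + 2 * M`, which outweighs `D` and the
  -- bounded terms together.
  have h1 := hbound (1 + 4 * M / κ) (le_add_of_nonneg_right (by positivity))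
  have h2 : (1 + 4 * M / κ) / 2 * κ = κ / 2 + 2 * M := by field_simp; ring
  have h3 : (1 + 4 * M / κ)⁻¹ * E ≤ |E| := by
    have h4 : (1 + 4 * M / κ)⁻¹ ≤ 1 :=
      inv_le_one_of_one_le₀ (le_add_of_nonneg_right (by positivity))
    have h5 : 0 ≤ (1 + 4 * M / κ)⁻¹ := by positivity
    calc _ ≤ (1 + 4 * M / κ)⁻¹ * |E| := mul_le_mul_of_nonneg_left (le_abs_self E) h5
      _ ≤ 1 * |E| := mul_le_mul_of_nonneg_right h4 (abs_nonneg E)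
      _ = |E| := one_mul _
  have h6 := le_abs_self D
  have h7 := neg_abs_le A
  have h8 := abs_nonneg E
  have h9 := abs_nonneg A
  rw [h2] at h1
  generalize (1 + 4 * M / κ)⁻¹ = r at h1 h3
  linarith

end SpinM1

theorem propositionP (n m : ℕ) (hn : 2 ≤ n) (hm : 2 * n = m + 1) (a : Fin n → ℝ)
    (ha : ∀ i j : Fin n, i < j → |a j| ≤ a i) (ha0 : ∀ i : Fin n, a i ≠ 0)
    (f : SpinM1.𝔤Dual m) (hf : f = SpinM1.fElliptic m hm.le a) :
    (∀ φ : SpinM1.Orb f, SpinM1.DepthOne (SpinM1.q f φ)) ∧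
    (∀ x : SpinM1.G m, Nonempty (Unique
      (SpinM1.ReducedSpace f (SpinM1.q f ⟨x • f, MulAction.mem_orbit f x⟩)))) ∧
    (∀ Ω : Set (SpinM1.𝔭Dual m), IsCompact Ω → Ω ⊆ (SpinM1.𝔩Dual m)ᶜ →
      IsCompact (SpinM1.q f ⁻¹' Ω)) ∧
    ¬ (∀ Ω : Set (SpinM1.𝔭Dual m), IsCompact Ω → IsCompact (SpinM1.q f ⁻¹' Ω)) := by
  subst hf
  refine ⟨?_, ?_, ?_, ?_⟩
  · rintro ⟨_, x, rfl⟩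
    exact SpinM1.depthOne_of_notMem (SpinM1.res_smul_fElliptic_notMem hm ha0 x)
  · intro x
    refine ⟨⟨⟨Quotient.mk'' ⟨⟨_, MulAction.mem_orbit _ x⟩, rfl⟩⟩, fun ψ => ?_⟩⟩
    induction ψ using Quotient.inductionOn' with
    | h ψ =>
      obtain ⟨⟨_, x', rfl⟩, hψ⟩ := ψ
      obtain ⟨y, hy⟩ := SpinM1.exists_P_smul_eq hm ha0 x x' hψ.symm
      -- Equivariance of `q`: an element of `P` that carries one point of a fibre to another fixes
      -- their common value.
      have hstab : y ∈ MulAction.stabilizer (SpinM1.P m)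
          (SpinM1.q (SpinM1.fElliptic m hm.le a) ⟨_, MulAction.mem_orbit _ x⟩) := by
        rw [MulAction.mem_stabilizer_iff, ← SpinM1.q_smul]
        refine Eq.trans ?_ hψ
        exact congrArg SpinM1.res hy
      refine Quotient.sound' ⟨⟨y, hstab⟩, Subtype.ext (Subtype.ext ?_)⟩
      exact hy
  · intro Ω hΩ hΩl
    exact SpinM1.isCompact_preimage_q hm ha0 hΩ hΩl
  · intro hall
    obtain ⟨Ω, hΩ, hn'⟩ :=
      SpinM1.exists_isCompact_not_isCompact_preimage_q hm ha0
    exact hn' (hall Ω hΩ)
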